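/- Let $p,q$ be positive integers with $2\le p/q<4$. Graphs are finite and simple. A $(p,q)$-colouring of a graph $G$ is a map $f:V(G)\to\{0,\dots,p-1\}$ with $q\le |f(u)-f(v)|\le p-q$ for every edge $uv$. We say that $f$ reconfigures to $g$ if there is a reconfiguration sequence $f=f_0,f_1,\dots,f_m=g$ of $(p,q)$-colourings of $G$ in which $f_i$ and $f_{i+1}$ differ on exactly one vertex for each $i<m$. A vertex $v$ is fixed under $f$ if $h(v)=f(v)$ for every $h$ to which $f$ reconfigures. Given an orientation $\overrightarrow{G}$ of $G$, the edge labelling $\varphi_f:E(G)\to\{0,\dots,p-1\}$ induced by $f$ is $\varphi_f(e)=f(v)-f(u) \bmod p$ for $e=\overrightarrow{uv}$. The weight $\varphi_f(W)$ of a path or cycle $W$, traversed in a chosen direction, is the integer obtained by adding $\varphi_f(e)$ over the edges $e$ of $W$ traversed along their orientation and $p-\varphi_f(e)$ over the edges $e$ of $W$ traversed against it. **Theorem.** Let $f$ and $g$ be $(p,q)$-colourings of a graph $G$, and let $\overrightarrow{G}$ be an orientation of $G$. Then $f$ reconfigures to $g$ if and only if 1. the same vertices are fixed under $f$ and under $g$,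 and $f(v)=g(v)$ for every fixed vertex $v$; 2. $\varphi_f(C)=\varphi_g(C)$ for every cycle $C$ of $G$ (traversed in the same direction for $f$ and $g$); and 3. $\varphi_f(P)=\varphi_g(P)$ for every path $P$ of $G$ whose end points are fixed (traversed in the same direction for $f$ and $g$). Moreover, for fixed $p$ and $q$ there is an algorithm which, given $G$, $f$ and $g$, returns in time polynomial in $|V(G)|$ either a reconfiguration sequence from $f$ to $g$ or an obstruction, that is, a vertex violating (1), a cycle violating (2), or a path violating (3). (Time is the number of steps of a unit-cost random access machine with addition and truncated subtraction, where $G$ is given by its adjacency matrix.) -/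

import Mathlib

namespace CircularColouring

/-! ### Circular colourings and their reconfiguration -/

/-- `f : V → {0, …, p-1}` is a `(p,q)`-colouring of `G`:
`q ≤ |f u - f v| ≤ p - q` (computed in `ℤ`) for every edge `uv`. -/
def IsColouring {V : Type*} (G : SimpleGraph V) {p : ℕ} (q : ℕ) (f : V → Fin p) : Prop :=
  ∀ u v : V, G.Adj u v →
    (q : ℤ) ≤ |((f u : ℕ) : ℤ) - ((f v : ℕ) : ℤ)| ∧
      |((f u : ℕ) : ℤ) - ((f v : ℕ) : ℤ)| ≤ (p : ℤ) - (q : ℤ)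

/-- `c 0, c 1, …, c m` is a reconfiguration sequence from `f` to `g`: all its members are
`(p,q)`-colourings and consecutive members differ on exactly one vertex. -/
structure IsReconfigurationSequence {V : Type*} (G : SimpleGraph V) {p : ℕ} (q : ℕ)
    (f g : V → Fin p) (m : ℕ) (c : ℕ → V → Fin p) : Prop where
  start : c 0 = f
  finish : c m = g
  colouring : ∀ i ≤ m, IsColouring G q (c i)
  step : ∀ i < m, ∃! v : V, c i v ≠ c (i + 1) v

/-- `f` reconfigures (recolours) to `g`. -/
def Reconfigures {V : Type*} (G : SimpleGraph V) {p : ℕ} (q : ℕ) (f g : V → Fin p) : Prop :=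
  ∃ (m : ℕ) (c : ℕ → V → Fin p), IsReconfigurationSequence G q f g m c

/-- The vertex `v` is fixed under `f`: its colour never changes under any sequence of
recolourings that starts from `f`. -/
def IsFixed {V : Type*} (G : SimpleGraph V) {p : ℕ} (q : ℕ) (f : V → Fin p) (v : V) : Prop :=
  ∀ h : V → Fin p, Reconfigures G q f h → h v = f v

/-! ### Orientations, edge labellings and weights -/

/-- An orientation of `G`: every edge `e` becomes the arc from `tail e` to `head e`. -/
structure Orientation {V : Type*} (G : SimpleGraph V) where
  tail : G.edgeSet → V
  head : G.edgeSet → V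
  ends : ∀ e : G.edgeSet, s(tail e, head e) = (e : Sym2 V)

/-- The edge labelling `φ_f` induced by `f`: the arc `e = uv` gets the label
`f v - f u mod p` in `{0, …, p-1}` (subtraction in `Fin p` is subtraction modulo `p`). -/
def edgeLabelling {V : Type*} {G : SimpleGraph V} (o : Orientation G) {p : ℕ} (f : V → Fin p)
    (e : G.edgeSet) : Fin p :=
  f (o.head e) - f (o.tail e)

open Classical in
/-- The weight `φ(W)` of a walk (in particular of a path or of a cycle, in the direction in which
it is traversed): the sum in `ℤ` of `φ(e)` over its forward arcs and of `p - φ(e)` over its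
backward arcs. -/
noncomputable def weight {V : Type*} {G : SimpleGraph V} (o : Orientation G) {p : ℕ}
    (φ : G.edgeSet → Fin p) {u v : V} (W : G.Walk u v) : ℤ :=
  (W.darts.map fun d =>
    if d.fst = o.tail ⟨d.edge, d.edge_mem⟩ then ((φ ⟨d.edge, d.edge_mem⟩ : ℕ) : ℤ)
    else (p : ℤ) - ((φ ⟨d.edge, d.edge_mem⟩ : ℕ) : ℤ)).sum

/-! ### A machine model: unit-cost random access machines

Programs act on registers and on arrays of natural numbers. A program names finitely many
registers and arrays; cells of an array are addressed by the contents of registers. The only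
arithmetic operations are addition and (truncated) subtraction, so that unit cost is polynomially
equivalent to the running time of a Turing machine. -/

/-- A memory state: the register `x` holds `reg x`, the cell `i` of the array `a` holds
`mem a i`. -/
structure State where
  reg : ℕ → ℕ
  mem : ℕ → ℕ → ℕ

/-- The state after writing `k` into the register `x`. -/
def State.setReg (s : State) (x k : ℕ) : State :=
  { s with reg := Function.update s.reg x k }

/-- The state after writing `k` into the cell `i` of the array `a`. -/
def State.setMem (s : State) (a i k : ℕ) : State :=
  { s with mem := Function.update s.mem a (Function.update (s.mem a) i k) }

/-- Programs. Below, `x`, `y`, `z` are registers, `a` is an array and `k` is a constant. -/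
inductive Program where
  /-- `x := k` -/
  | const (x k : ℕ)
  /-- `x := y + z` -/
  | add (x y z : ℕ)
  /-- `x := y - z`, or `0` if `y < z` -/
  | sub (x y z : ℕ)
  /-- `x := a[y]` -/
  | load (x a y : ℕ)
  /-- `a[y] := x` -/
  | store (a y x : ℕ)
  /-- run `P`, then `Q` -/
  | seq (P Q : Program)
  /-- run `P` if `x ≠ 0`, otherwise `Q` -/
  | branch (x : ℕ) (P Q : Program)
  /-- while `x ≠ 0`, run `P` -/
  | loop (x : ℕ) (P : Program)

/-- `Runs P s s' t`: started in the state `s`, the program `P` halts in the state `s'` after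
exactly `t` steps. Every elementary instruction and every test takes one step. -/
inductive Runs : Program → State → State → ℕ → Prop where
  | const (x k : ℕ) (s : State) : Runs (.const x k) s (s.setReg x k) 1
  | add (x y z : ℕ) (s : State) : Runs (.add x y z) s (s.setReg x (s.reg y + s.reg z)) 1
  | sub (x y z : ℕ) (s : State) : Runs (.sub x y z) s (s.setReg x (s.reg y - s.reg z)) 1
  | load (x a y : ℕ) (s : State) : Runs (.load x a y) s (s.setReg x (s.mem a (s.reg y))) 1
  | store (a y x : ℕ) (s : State) : Runs (.store a y x) s (s.setMem a (s.reg y) (s.reg x)) 1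
  | seq {P Q : Program} {s s' s'' : State} {t t' : ℕ} :
      Runs P s s' t → Runs Q s' s'' t' → Runs (.seq P Q) s s'' (t + t')
  | branch_then {x : ℕ} {P Q : Program} {s s' : State} {t : ℕ} :
      s.reg x ≠ 0 → Runs P s s' t → Runs (.branch x P Q) s s' (t + 1)
  | branch_else {x : ℕ} {P Q : Program} {s s' : State} {t : ℕ} :
      s.reg x = 0 → Runs Q s s' t → Runs (.branch x P Q) s s' (t + 1)
  | loop_end {x : ℕ} {P : Program} {s : State} :
      s.reg x = 0 → Runs (.loop x P) s s 1
  | loop_step {x : ℕ} {P : Program} {s s' s'' : State} {t t' : ℕ} :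
      s.reg x ≠ 0 → Runs P s s' t → Runs (.loop x P) s' s'' t' →
        Runs (.loop x P) s s'' (t + t' + 1)

open Classical in
/-- The initial state for the instance `(G, f, g)` with vertices `0, …, n-1`: register `0` holds
`n`, array `0` holds the adjacency matrix of `G` row by row, arrays `1` and `2` hold the colours
under `f` and under `g`. Everything else is `0`. -/
noncomputable def inputState {n p : ℕ} (G : SimpleGraph (Fin n)) (f g : Fin n → Fin p) : State where
  reg x := if x = 0 then n else 0
  mem a k :=
    if a = 0 then
      if ∃ i j : Fin n, G.Adj i j ∧ k = (i : ℕ) * n + (j : ℕ) then 1 else 0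
    else if a = 1 then
      if h : k < n then (f ⟨k, h⟩ : ℕ) else 0
    else if a = 2 then
      if h : k < n then (g ⟨k, h⟩ : ℕ) else 0
    else 0

/-! ### Outputs of the algorithm

Register `0` of the final state tells the kind of the answer, register `1` and array `3` hold the
answer itself. -/

/-- The state holds the walk `W`: its length in register `1`, its vertices, in order of traversal,
in array `3`. -/
def State.HoldsWalk {n : ℕ} {G : SimpleGraph (Fin n)} (s : State) {u v : Fin n} (W : G.Walk u v) :
    Prop :=
  s.reg 1 = W.length ∧ ∀ i ≤ W.length, s.mem 3 i = (W.getVert i : ℕ)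

/-- The state holds a reconfiguration sequence `c 0, …, c m` from `f` to `g`: the number `m` in
register `1`, the colours of all vertices under `c 0`, then those under `c 1`, and so on up to
`c m`, in array `3`. -/
def State.HoldsSequence {n p : ℕ} (s : State) (G : SimpleGraph (Fin n)) (q : ℕ)
    (f g : Fin n → Fin p) : Prop :=
  ∃ c : ℕ → Fin n → Fin p, IsReconfigurationSequence G q f g (s.reg 1) c ∧
    ∀ i ≤ s.reg 1, ∀ v : Fin n, s.mem 3 (i * n + (v : ℕ)) = (c i v : ℕ)

/-- The state holds, in register `1`, a vertex that is fixed under exactly one of `f` and `g`, or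
is fixed and has different colours under `f` and `g`. -/
def State.HoldsBadVertex {n p : ℕ} (s : State) (G : SimpleGraph (Fin n)) (q : ℕ)
    (f g : Fin n → Fin p) : Prop :=
  ∃ v : Fin n, s.reg 1 = (v : ℕ) ∧
    (¬ (IsFixed G q f v ↔ IsFixed G q g v) ∨ (IsFixed G q f v ∧ f v ≠ g v))

/-- The state holds a cycle with different weights under `φ_f` and `φ_g`. -/
def State.HoldsBadCycle {n p : ℕ} (s : State) (G : SimpleGraph (Fin n))
    (f g : Fin n → Fin p) : Prop :=
  ∃ (u : Fin n) (C : G.Walk u u), C.IsCycle ∧ s.HoldsWalk C ∧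
    ∀ o : Orientation G, weight o (edgeLabelling o f) C ≠ weight o (edgeLabelling o g) C

/-- The state holds a path whose end points are fixed (under `f` and under `g`) and which has
different weights under `φ_f` and `φ_g`. -/
def State.HoldsBadPath {n p : ℕ} (s : State) (G : SimpleGraph (Fin n)) (q : ℕ)
    (f g : Fin n → Fin p) : Prop :=
  ∃ (u v : Fin n) (W : G.Walk u v), W.IsPath ∧ s.HoldsWalk W ∧
    (IsFixed G q f u ∧ IsFixed G q g u) ∧ (IsFixed G q f v ∧ IsFixed G q g v) ∧
    ∀ o : Orientation G, weight o (edgeLabelling o f) W ≠ weight o (edgeLabelling o g) W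

/-- The state holds a correct answer for the instance `(G, f, g)`: a reconfiguration sequence from
`f` to `g` (kind `0`), or an obstruction, namely a vertex (kind `1`), a cycle (kind `2`) or a path
(kind `3`). -/
def State.HoldsAnswer {n p : ℕ} (s : State) (G : SimpleGraph (Fin n)) (q : ℕ)
    (f g : Fin n → Fin p) : Prop :=
  (s.reg 0 = 0 ∧ s.HoldsSequence G q f g) ∨
  (s.reg 0 = 1 ∧ s.HoldsBadVertex G q f g) ∨
  (s.reg 0 = 2 ∧ s.HoldsBadCycle G f g) ∨
  (s.reg 0 = 3 ∧ s.HoldsBadPath G q f g)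

end CircularColouring

namespace CircularColouring

/-! ### A language of loop programs -/

/-- Memories: cell `i` of array `a` holds `m a i`. -/
abbrev Mem := ℕ → ℕ → ℕ

/-- Expressions over loop variables, arrays and the size `n` of the instance. -/
inductive Exp where
  | const (k : ℕ)
  | size
  | var (x : ℕ)
  | add (a b : Exp)
  | sub (a b : Exp)
  | scale (e : Exp)
  | load (a : ℕ) (e : Exp)
  | ite (c a b : Exp)
  | sup (x : ℕ) (e : Exp)

/-- The value of an expression. -/
def Exp.eval (n : ℕ) (m : Mem) : Exp → (ℕ → ℕ) → ℕ
  | .const k, _ => k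
  | .size, _ => n
  | .var x, ρ => ρ x
  | .add a b, ρ => a.eval n m ρ + b.eval n m ρ
  | .sub a b, ρ => a.eval n m ρ - b.eval n m ρ
  | .scale e, ρ => e.eval n m ρ * n
  | .load a e, ρ => m a (e.eval n m ρ)
  | .ite c a b, ρ => if c.eval n m ρ ≠ 0 then a.eval n m ρ else b.eval n m ρ
  | .sup x e, ρ => (Finset.range n).sup fun i => e.eval n m (Function.update ρ x i)

/-- Statements: all loops run `n` times. `row a j x e` assigns simultaneously the values of `e`,
for `x < n`, to the cells `j * n + x` of `a`. -/
inductive Stm where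
  | skip
  | put (a : ℕ) (i e : Exp)
  | row (a : ℕ) (j : Exp) (x : ℕ) (e : Exp)
  | seq (S T : Stm)
  | ite (c : Exp) (S T : Stm)
  | loop (x : ℕ) (S : Stm)

/-- The memory after execution of a statement. -/
def Stm.run (n : ℕ) : Stm → (ℕ → ℕ) → Mem → Mem
  | .skip, _, m => m
  | .put a i e, ρ, m =>
      Function.update m a (Function.update (m a) (i.eval n m ρ) (e.eval n m ρ))
  | .row a j x e, ρ, m =>
      Function.update m a fun k =>
        if j.eval n m ρ * n ≤ k ∧ k < j.eval n m ρ * n + n then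
          e.eval n m (Function.update ρ x (k - j.eval n m ρ * n)) else m a k
  | .seq S T, ρ, m => T.run n ρ (S.run n ρ m)
  | .ite c S T, ρ, m => if c.eval n m ρ ≠ 0 then S.run n ρ m else T.run n ρ m
  | .loop x S, ρ, m =>
      Nat.rec (motive := fun _ => Mem) m (fun i m' => S.run n (Function.update ρ x i) m') n

/-! ### Compilation -/

/-- Array `4` of the machine is reserved for the simultaneous assignments. -/
def arr (a : ℕ) : ℕ := if a < 4 then a else a + 1

theorem arr_ne (a : ℕ) : arr a ≠ 4 := by
  unfold arr; split_ifs <;> omega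

theorem arr_injective : Function.Injective arr := by
  intro a b h
  unfold arr at h
  split_ifs at h <;> omega

/-- The memory visible to loop programs. -/
def State.visible (s : State) : Mem := fun a => s.mem (arr a)

theorem State.visible_congr {s s' : State} (h : s.mem = s'.mem) : s.visible = s'.visible := by
  unfold State.visible; rw [h]

/-- Run `B` for all values of register `i` below the value of register `0`. -/
def forProgram (i : ℕ) (B : Program) : Program :=
  .seq (.const i 0) (.seq (.sub (i + 1) 0 i) (.loop (i + 1)
    (.seq B (.seq (.const (i + 2) 1) (.seq (.add i i (i + 2)) (.sub (i + 1) 0 i))))))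

theorem forProgram_runs {i n τ : ℕ} {B : Program} (I : ℕ → State → Prop) (hi : 0 < i)
    (hI : ∀ k s s', I k s → s'.mem = s.mem → (∀ x < i, s'.reg x = s.reg x) → I k s')
    (hstep : ∀ k < n, ∀ s, I k s → s.reg i = k → s.reg 0 = n →
      ∃ s' t, Runs B s s' t ∧ t ≤ τ ∧ s'.reg 0 = n ∧ s'.reg i = k ∧ I (k + 1) s')
    {s : State} (h0 : s.reg 0 = n) (hs : I 0 s) :
    ∃ s' t, Runs (forProgram i B) s s' t ∧ t ≤ n * (τ + 4) + 3 ∧ s'.reg 0 = n ∧ I n s' := by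
  have key : ∀ d k, k + d = n → ∀ s : State, I k s → s.reg i = k → s.reg 0 = n →
      s.reg (i + 1) = n - k → ∃ s' t, Runs (.loop (i + 1)
        (.seq B (.seq (.const (i + 2) 1) (.seq (.add i i (i + 2)) (.sub (i + 1) 0 i))))) s s' t ∧
        t ≤ d * (τ + 4) + 1 ∧ s'.reg 0 = n ∧ I n s' := by
    intro d
    induction d with
    | zero =>
      intro k hk s hs hik h0 h1
      obtain rfl : k = n := by omega
      exact ⟨s, 1, .loop_end (by omega), by omega, h0, hs⟩
    | succ d ih =>
      intro k hk s hs hik h0 h1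
      obtain ⟨s₁, t₁, r₁, ht₁, h0₁, hi₁, hI₁⟩ := hstep k (by omega) s hs hik h0
      let s₂ := s₁.setReg (i + 2) 1
      let s₃ := s₂.setReg i (s₂.reg i + s₂.reg (i + 2))
      let s₄ := s₃.setReg (i + 1) (s₃.reg 0 - s₃.reg i)
      have e0 : s₄.reg 0 = n := by
        simp [s₄, s₃, s₂, State.setReg, h0₁, hi.ne]
      have ei : s₄.reg i = k + 1 := by
        simp [s₄, s₃, s₂, State.setReg, Function.update_apply, hi₁]
      have e1 : s₄.reg (i + 1) = n - (k + 1) := by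
        simp [s₄, s₃, s₂, State.setReg, hi₁, h0₁, hi.ne]
      have hI₄ : I (k + 1) s₄ := by
        refine hI _ s₁ _ hI₁ rfl fun x hx => ?_
        have a1 : x ≠ i := by omega
        have a2 : x ≠ i + 1 := by omega
        have a3 : x ≠ i + 2 := by omega
        simp [s₄, s₃, s₂, State.setReg, Function.update_apply, a1, a2, a3]
      obtain ⟨s', t, r, ht, h0', hI'⟩ := ih (k + 1) (by omega) s₄ hI₄ ei e0 e1
      refine ⟨s', t₁ + (1 + (1 + 1)) + t + 1, ?_, ?_, h0', hI'⟩
      · refine .loop_step (by omega) (.seq r₁ (.seq (.const _ _ _) (.seq (.add _ _ _ _)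
          (.sub _ _ _ _)))) r
      · rw [Nat.succ_mul]; omega
  let s₁ := s.setReg i 0
  let s₂ := s₁.setReg (i + 1) (s₁.reg 0 - s₁.reg i)
  have e0 : s₂.reg 0 = n := by
    simp [s₂, s₁, State.setReg, h0, hi.ne]
  have ei : s₂.reg i = 0 := by
    simp [s₂, s₁, State.setReg, Function.update_apply]
  have e1 : s₂.reg (i + 1) = n - 0 := by
    simp [s₂, s₁, State.setReg, h0, hi.ne]
  have hI₂ : I 0 s₂ := by
    refine hI _ s _ hs rfl fun x hx => ?_
    have a1 : x ≠ i := by omega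
    have a2 : x ≠ i + 1 := by omega
    simp [s₂, s₁, State.setReg, Function.update_apply, a1, a2]
  obtain ⟨s', t, r, ht, h0', hI'⟩ := key n 0 (by omega) s₂ hI₂ ei e0 e1
  exact ⟨s', 1 + (1 + t), .seq (.const _ _ _) (.seq (.sub _ _ _ _) r), by omega, h0', hI'⟩

/-- The program for an expression: `θ` gives the registers of the variables, the result appears in
register `r`, and only registers from `r` on are used. -/
def Exp.compile : Exp → (ℕ → ℕ) → ℕ → Program
  | .const k, _, r => .const r k
  | .size, _, r => .seq (.const (r + 1) 0) (.add r 0 (r + 1))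
  | .var x, θ, r => .seq (.const (r + 1) 0) (.add r (θ x) (r + 1))
  | .add a b, θ, r => .seq (a.compile θ r) (.seq (b.compile θ (r + 1)) (.add r r (r + 1)))
  | .sub a b, θ, r => .seq (a.compile θ r) (.seq (b.compile θ (r + 1)) (.sub r r (r + 1)))
  | .scale e, θ, r =>
      .seq (e.compile θ (r + 1)) (.seq (.const r 0) (forProgram (r + 2) (.add r r (r + 1))))
  | .load a e, θ, r => .seq (e.compile θ r) (.load r (arr a) r)
  | .ite c a b, θ, r => .seq (c.compile θ r) (.branch r (a.compile θ r) (b.compile θ r))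
  | .sup x e, θ, r =>
      .seq (.const r 0) (forProgram (r + 1)
        (.seq (e.compile (Function.update θ x (r + 1)) (r + 2))
          (.seq (.sub (r + 2) (r + 2) r) (.add r r (r + 2)))))

open Polynomial in
/-- A bound for the running time of an expression. -/
noncomputable def Exp.cost : Exp → ℕ[X]
  | .const _ => 1
  | .size => 2
  | .var _ => 2
  | .add a b => a.cost + b.cost + 1
  | .sub a b => a.cost + b.cost + 1
  | .scale e => e.cost + 1 + (X * 5 + 3)
  | .load _ e => e.cost + 1
  | .ite c a b => c.cost + (a.cost + b.cost + 1)
  | .sup _ e => 1 + (X * (e.cost + 2 + 4) + 3)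

theorem Exp.compile_runs (e : Exp) : ∀ (θ : ℕ → ℕ) (r n : ℕ) (s : State), 0 < r →
    (∀ x, θ x < r) → s.reg 0 = n →
    ∃ s' t, Runs (e.compile θ r) s s' t ∧ t ≤ e.cost.eval n ∧
      s'.reg r = e.eval n s.visible (fun x => s.reg (θ x)) ∧ s'.mem = s.mem ∧
      ∀ x < r, s'.reg x = s.reg x := by
  induction e with
  | const k =>
    intro θ r n s hr hθ h0
    refine ⟨_, _, .const _ _ _, by simp [cost], by simp [State.setReg, eval], rfl, fun x hx => ?_⟩
    simp [State.setReg, hx.ne]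
  | size =>
    intro θ r n s hr hθ h0
    refine ⟨_, _, .seq (.const _ _ _) (.add _ _ _ _), by simp [cost], ?_, rfl, fun x hx => ?_⟩
    · simp [State.setReg, eval, h0]
    · have : x ≠ r + 1 := by omega
      simp [State.setReg, hx.ne, this]
  | var x =>
    intro θ r n s hr hθ h0
    refine ⟨_, _, .seq (.const _ _ _) (.add _ _ _ _), by simp [cost], ?_, rfl, fun x hx => ?_⟩
    · have := hθ x
      have : θ x ≠ r + 1 := by omega
      simp [State.setReg, eval, this]
    · have : x ≠ r + 1 := by omega
      simp [State.setReg, Function.update_apply, hx.ne, this]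
  | add a b iha ihb =>
    intro θ r n s hr hθ h0
    obtain ⟨s₁, t₁, r₁, ht₁, hv₁, hm₁, hx₁⟩ := iha θ r n s hr hθ h0
    obtain ⟨s₂, t₂, r₂, ht₂, hv₂, hm₂, hx₂⟩ := ihb θ (r + 1) n s₁ (by omega)
      (fun x => (hθ x).trans (by omega)) (by rw [hx₁ 0 hr, h0])
    refine ⟨_, _, .seq r₁ (.seq r₂ (.add _ _ _ _)), by simp [cost]; omega, ?_, ?_, fun x hx => ?_⟩
    · have e1 : s₁.visible = s.visible := State.visible_congr hm₁
      have e2 : (fun x => s₁.reg (θ x)) = fun x => s.reg (θ x) := funext fun x => hx₁ _ (hθ x)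
      simp [State.setReg, eval, hx₂ r (by omega), hv₁, hv₂, e1, e2]
    · simp [State.setReg, hm₁, hm₂]
    · simp [State.setReg, hx.ne, hx₁ x hx, hx₂ x (by omega)]
  | sub a b iha ihb =>
    intro θ r n s hr hθ h0
    obtain ⟨s₁, t₁, r₁, ht₁, hv₁, hm₁, hx₁⟩ := iha θ r n s hr hθ h0
    obtain ⟨s₂, t₂, r₂, ht₂, hv₂, hm₂, hx₂⟩ := ihb θ (r + 1) n s₁ (by omega)
      (fun x => (hθ x).trans (by omega)) (by rw [hx₁ 0 hr, h0])
    refine ⟨_, _, .seq r₁ (.seq r₂ (.sub _ _ _ _)), by simp [cost]; omega, ?_, ?_, fun x hx => ?_⟩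
    · have e1 : s₁.visible = s.visible := State.visible_congr hm₁
      have e2 : (fun x => s₁.reg (θ x)) = fun x => s.reg (θ x) := funext fun x => hx₁ _ (hθ x)
      simp [State.setReg, eval, hx₂ r (by omega), hv₁, hv₂, e1, e2]
    · simp [State.setReg, hm₁, hm₂]
    · simp [State.setReg, hx.ne, hx₁ x hx, hx₂ x (by omega)]
  | scale e ih =>
    intro θ r n s hr hθ h0
    obtain ⟨s₁, t₁, r₁, ht₁, hv₁, hm₁, hx₁⟩ := ih θ (r + 1) n s (by omega)
      (fun x => (hθ x).trans (by omega)) h0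
    let s₂ := s₁.setReg r 0
    obtain ⟨s', t, r', ht', -, hm', hv', hr', hx'⟩ := forProgram_runs (i := r + 2) (n := n) (τ := 1)
      (B := .add r r (r + 1))
      (fun k s' => s'.mem = s.mem ∧ s'.reg (r + 1) = s₁.reg (r + 1) ∧
        s'.reg r = k * s₁.reg (r + 1) ∧ ∀ x < r, s'.reg x = s.reg x) (by omega)
      (by
        rintro k u u' ⟨h1, h2, h3, h4⟩ hm hx
        refine ⟨hm.trans h1, ?_, ?_, fun x hx' => ?_⟩
        · rw [hx _ (by omega), h2]
        · rw [hx _ (by omega), h3]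
        · rw [hx _ (by omega), h4 x hx'])
      (by
        rintro k hk u ⟨h1, h2, h3, h4⟩ hi h0'
        refine ⟨_, _, .add _ _ _ _, le_rfl, ?_, ?_, h1, ?_, ?_, fun x hx => ?_⟩
        · simp [State.setReg, hr.ne, h0']
        · simp [State.setReg, hi]
        · simp [State.setReg, h2]
        · simp [State.setReg, h2, h3, Nat.succ_mul]
        · simp [State.setReg, hx.ne, h4 x hx])
      (s := s₂) (by simp [s₂, State.setReg, hr.ne, hx₁ 0 (by omega), h0])
      (by
        refine ⟨hm₁, ?_, ?_, fun x hx => ?_⟩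
        · simp [s₂, State.setReg]
        · simp [s₂, State.setReg]
        · simp [s₂, State.setReg, hx.ne, hx₁ x (by omega)])
    refine ⟨s', _, .seq r₁ (.seq (.const _ _ _) r'), ?_, ?_, hm', hx'⟩
    · simp [cost]; omega
    · rw [hr', hv₁, eval, mul_comm]
  | load a e ih =>
    intro θ r n s hr hθ h0
    obtain ⟨s₁, t₁, r₁, ht₁, hv₁, hm₁, hx₁⟩ := ih θ r n s hr hθ h0
    refine ⟨_, _, .seq r₁ (.load _ _ _ _), by simp [cost]; omega, ?_, hm₁, fun x hx => ?_⟩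
    · simp [State.setReg, eval, hv₁, hm₁, State.visible]
    · simp [State.setReg, hx.ne, hx₁ x hx]
  | ite c a b ihc iha ihb =>
    intro θ r n s hr hθ h0
    obtain ⟨s₁, t₁, r₁, ht₁, hv₁, hm₁, hx₁⟩ := ihc θ r n s hr hθ h0
    have e1 : s₁.visible = s.visible := State.visible_congr hm₁
    have e2 : (fun x => s₁.reg (θ x)) = fun x => s.reg (θ x) := funext fun x => hx₁ _ (hθ x)
    by_cases hc : s₁.reg r = 0
    · obtain ⟨s₂, t₂, r₂, ht₂, hv₂, hm₂, hx₂⟩ := ihb θ r n s₁ hr hθ (by rw [hx₁ 0 hr, h0])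
      refine ⟨_, _, .seq r₁ (.branch_else hc r₂), by simp [cost]; omega, ?_, hm₂.trans hm₁,
        fun x hx => (hx₂ x hx).trans (hx₁ x hx)⟩
      rw [hv₁] at hc
      rw [hv₂, e1, e2, eval, if_neg (by simpa using hc)]
    · obtain ⟨s₂, t₂, r₂, ht₂, hv₂, hm₂, hx₂⟩ := iha θ r n s₁ hr hθ (by rw [hx₁ 0 hr, h0])
      refine ⟨_, _, .seq r₁ (.branch_then hc r₂), by simp [cost]; omega, ?_, hm₂.trans hm₁,
        fun x hx => (hx₂ x hx).trans (hx₁ x hx)⟩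
      rw [hv₁] at hc
      rw [hv₂, e1, e2, eval, if_pos hc]
  | sup x e ih =>
    intro θ r n s hr hθ h0
    let v : ℕ → ℕ := fun i =>
      e.eval n s.visible (Function.update (fun x => s.reg (θ x)) x i)
    obtain ⟨s', t, r', ht', -, hm', hr', hx'⟩ := forProgram_runs (i := r + 1) (n := n)
      (τ := e.cost.eval n + 2)
      (B := .seq (e.compile (Function.update θ x (r + 1)) (r + 2))
          (.seq (.sub (r + 2) (r + 2) r) (.add r r (r + 2))))
      (fun k s' => s'.mem = s.mem ∧ s'.reg r = (Finset.range k).sup v ∧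
        ∀ x < r, s'.reg x = s.reg x) (by omega)
      (by
        rintro k u u' ⟨h1, h2, h3⟩ hm hx
        refine ⟨hm.trans h1, ?_, fun x hx' => ?_⟩
        · rw [hx _ (by omega), h2]
        · rw [hx _ (by omega), h3 x hx'])
      (by
        rintro k hk u ⟨h1, h2, h3⟩ hi h0'
        obtain ⟨s₁, t₁, r₁, ht₁, hv₁, hm₁, hx₁⟩ := ih (Function.update θ x (r + 1)) (r + 2) n u
          (by omega) (fun y => by
            have := hθ y
            rw [Function.update_apply]; split_ifs <;> omega) h0'
        have e1 : u.visible = s.visible := State.visible_congr h1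
        have e2 : (fun y => u.reg (Function.update θ x (r + 1) y)) =
            Function.update (fun x => s.reg (θ x)) x k := by
          funext y
          by_cases hy : y = x
          · subst hy; simp [hi]
          · simp [hy, h3 _ (hθ y)]
        rw [e1, e2] at hv₁
        refine ⟨_, _, .seq r₁ (.seq (.sub _ _ _ _) (.add _ _ _ _)), by omega, ?_, ?_, ?_, ?_,
          fun y hy => ?_⟩
        · simp [State.setReg, hr.ne, hx₁ 0, h0']
        · simp [State.setReg, hx₁ (r + 1), hi]
        · exact hm₁.trans h1
        · have : s₁.reg r = (Finset.range k).sup v := by rw [hx₁ r (by omega), h2]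
          simp [State.setReg, this, hv₁, Finset.range_add_one]
          change _ + (v k - _) = max (v k) _
          omega
        · have : y ≠ r + 2 := by omega
          simp [State.setReg, hy.ne, this, hx₁ y (by omega), h3 y hy])
      (s := s.setReg r 0) (by simp [State.setReg, hr.ne, h0])
      (by
        refine ⟨rfl, ?_, fun x hx => ?_⟩
        · simp [State.setReg]
        · simp [State.setReg, hx.ne])
    refine ⟨s', _, .seq (.const _ _ _) r', ?_, ?_, hm', hx'⟩
    · simp [cost]; omega
    · rw [hr', eval]

/-- The program for a statement; only registers from `r` on are used. -/
def Stm.compile : Stm → (ℕ → ℕ) → ℕ → Program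
  | .skip, _, r => .const r 0
  | .put a i e, θ, r =>
      .seq (i.compile θ r) (.seq (e.compile θ (r + 1)) (.store (arr a) r (r + 1)))
  | .row a j x e, θ, r =>
      .seq (j.scale.compile θ r) (.seq
        (forProgram (r + 1) (.seq (e.compile (Function.update θ x (r + 1)) (r + 2))
          (.store 4 (r + 1) (r + 2))))
        (forProgram (r + 1) (.seq (.load (r + 2) 4 (r + 1))
          (.seq (.add (r + 3) r (r + 1)) (.store (arr a) (r + 3) (r + 2))))))
  | .seq S T, θ, r => .seq (S.compile θ r) (T.compile θ r)
  | .ite c S T, θ, r => .seq (c.compile θ r) (.branch r (S.compile θ r) (T.compile θ r))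
  | .loop x S, θ, r => forProgram r (S.compile (Function.update θ x r) (r + 1))

open Polynomial in
/-- A bound for the running time of a statement. -/
noncomputable def Stm.cost : Stm → ℕ[X]
  | .skip => 1
  | .put _ i e => i.cost + e.cost + 1
  | .row _ j _ e => j.scale.cost + (X * (e.cost + 1 + 4) + 3) + (X * 7 + 3)
  | .seq S T => S.cost + T.cost
  | .ite c S T => c.cost + (S.cost + T.cost + 1)
  | .loop _ S => X * (S.cost + 4) + 3

theorem Stm.compile_runs (S : Stm) : ∀ (θ : ℕ → ℕ) (r n : ℕ) (s : State), 0 < r →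
    (∀ x, θ x < r) → s.reg 0 = n →
    ∃ s' t, Runs (S.compile θ r) s s' t ∧ t ≤ S.cost.eval n ∧
      s'.visible = S.run n (fun x => s.reg (θ x)) s.visible ∧ ∀ x < r, s'.reg x = s.reg x := by
  induction S with
  | skip =>
    intro θ r n s hr hθ h0
    refine ⟨_, _, .const _ _ _, by simp [cost], rfl, fun x hx => ?_⟩
    simp [State.setReg, hx.ne]
  | put a i e =>
    intro θ r n s hr hθ h0
    obtain ⟨s₁, t₁, r₁, ht₁, hv₁, hm₁, hx₁⟩ := i.compile_runs θ r n s hr hθ h0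
    obtain ⟨s₂, t₂, r₂, ht₂, hv₂, hm₂, hx₂⟩ := e.compile_runs θ (r + 1) n s₁ (by omega)
      (fun x => (hθ x).trans (by omega)) (by rw [hx₁ 0 hr, h0])
    have e1 : s₁.visible = s.visible := State.visible_congr hm₁
    have e2 : (fun x => s₁.reg (θ x)) = fun x => s.reg (θ x) := funext fun x => hx₁ _ (hθ x)
    refine ⟨_, _, .seq r₁ (.seq r₂ (.store _ _ _ _)), by simp [cost]; omega, ?_, fun x hx => ?_⟩
    · funext b
      simp only [State.visible, State.setMem, run, hx₂ r (by omega), hv₁, hv₂, e1, e2, hm₁, hm₂,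
        Function.update_apply, arr_injective.eq_iff]
    · simp [State.setMem, hx₁ x hx, hx₂ x (by omega)]
  | row a j x e =>
    intro θ r n s hr hθ h0
    obtain ⟨s₁, t₁, r₁, ht₁, hv₁, hm₁, hx₁⟩ := j.scale.compile_runs θ r n s hr hθ h0
    let v : ℕ → ℕ := fun i =>
      e.eval n s.visible (Function.update (fun x => s.reg (θ x)) x i)
    obtain ⟨s₂, t₂, r₂, ht₂, h0₂, hm₂, hv₂, hr₂, hx₂⟩ := forProgram_runs (i := r + 1) (n := n)
      (τ := e.cost.eval n + 1)
      (B := .seq (e.compile (Function.update θ x (r + 1)) (r + 2)) (.store 4 (r + 1) (r + 2)))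
      (fun k s' => s'.visible = s.visible ∧ (∀ i < k, s'.mem 4 i = v i) ∧ s'.reg r = s₁.reg r ∧
        ∀ x < r, s'.reg x = s.reg x) (by omega)
      (by
        rintro k u u' ⟨h1, h2, h3, h4⟩ hm hx
        refine ⟨?_, by rwa [hm], ?_, fun x hx' => ?_⟩
        · rw [← h1]; exact State.visible_congr hm
        · rw [hx _ (by omega), h3]
        · rw [hx _ (by omega), h4 x hx'])
      (by
        rintro k hk u ⟨h1, h2, h3, h4⟩ hi h0'
        obtain ⟨s₁, t₁, r₁, ht₁, hv₁, hm₁, hx₁⟩ := e.compile_runs (Function.update θ x (r + 1))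
          (r + 2) n u (by omega) (fun y => by
            have := hθ y
            rw [Function.update_apply]; split_ifs <;> omega) h0'
        have e2 : (fun y => u.reg (Function.update θ x (r + 1) y)) =
            Function.update (fun x => s.reg (θ x)) x k := by
          funext y
          by_cases hy : y = x
          · subst hy; simp [hi]
          · simp [hy, h4 _ (hθ y)]
        rw [h1, e2] at hv₁
        refine ⟨_, _, .seq r₁ (.store _ _ _ _), by omega, ?_, ?_, ?_, fun i hi' => ?_, ?_,
          fun y hy => ?_⟩
        · simp [State.setMem, hx₁ 0, h0']
        · simp [State.setMem, hx₁ (r + 1), hi]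
        · rw [← h1]
          funext b
          simp [State.visible, State.setMem, arr_ne, hm₁]
        · simp only [State.setMem, Function.update_self, hx₁ (r + 1) (by omega), hi, hv₁,
            Function.update_apply, hm₁]
          split_ifs with h
          · rw [h]
          · exact h2 i (by omega)
        · simp [State.setMem, hx₁ r, h3]
        · simp [State.setMem, hx₁ y (by omega : y < r + 2), h4 y hy])
      (s := s₁) (by rw [hx₁ 0 hr, h0])
      ⟨State.visible_congr hm₁, fun i hi => absurd hi (by omega), rfl, hx₁⟩
    set J := j.eval n s.visible (fun x => s.reg (θ x)) * n with hJ
    have hrJ : s₁.reg r = J := hv₁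
    obtain ⟨s₃, t₃, r₃, ht₃, -, hm₃, hv₃, hr₃, hx₃⟩ := forProgram_runs (i := r + 1) (n := n)
      (τ := 3)
      (B := .seq (.load (r + 2) 4 (r + 1))
          (.seq (.add (r + 3) r (r + 1)) (.store (arr a) (r + 3) (r + 2))))
      (fun k s' => (s'.visible = Function.update s.visible a fun i =>
          if J ≤ i ∧ i < J + k then v (i - J) else s.visible a i) ∧
        (∀ i < n, s'.mem 4 i = v i) ∧ s'.reg r = J ∧ ∀ x < r, s'.reg x = s.reg x) (by omega)
      (by
        rintro k u u' ⟨h1, h2, h3, h4⟩ hm hx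
        refine ⟨?_, by rwa [hm], ?_, fun x hx' => ?_⟩
        · rw [← h1]; exact State.visible_congr hm
        · rw [hx _ (by omega), h3]
        · rw [hx _ (by omega), h4 x hx'])
      (by
        rintro k hk u ⟨h1, h2, h3, h4⟩ hi h0'
        refine ⟨_, _, .seq (.load _ _ _ _) (.seq (.add _ _ _ _) (.store _ _ _ _)), by omega,
          ?_, ?_, ?_, fun i hi' => ?_, ?_, fun y hy => ?_⟩
        · simp [State.setMem, State.setReg, h0']
        · simp [State.setMem, State.setReg, hi]
        · funext b i
          have h1b := congrFun (congrFun h1 b) i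
          simp only [State.visible, Function.update_apply] at h1b
          simp only [State.setMem, State.setReg, State.visible, Function.update_apply,
            arr_injective.eq_iff]
          by_cases hb : b = a
          · subst hb
            have n1 : r + 1 ≠ r + 2 := by omega
            have n2 : r ≠ r + 2 := by omega
            have n3 : r + 2 ≠ r + 3 := by omega
            simp only [↓reduceIte, n1, n2, n3, hi, h3, h2 k hk]
            by_cases hik : i = J + k
            · subst hik; simp
            · rw [Function.update_of_ne hik]
              simp only [↓reduceIte] at h1b
              rw [h1b]
              exact if_congr ⟨fun h => ⟨h.1, by omega⟩, fun h => ⟨h.1, by omega⟩⟩ rfl rfl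
          · simpa [hb] using h1b
        · simp [State.setMem, State.setReg, (arr_ne a).symm, h2 i hi']
        · simp [State.setMem, State.setReg, h3]
        · have b2 : y ≠ r + 2 := by omega
          have b3 : y ≠ r + 3 := by omega
          simp [State.setMem, State.setReg, b2, b3, h4 y hy])
      (s := s₂) h0₂
      ⟨by
        rw [hm₂]
        funext b i
        by_cases hb : b = a
        · subst hb
          have : ¬ (J ≤ i ∧ i < J) := by omega
          simp [this]
        · simp [hb], hv₂, hr₂.trans hrJ, hx₂⟩
    refine ⟨s₃, _, .seq r₁ (.seq r₂ r₃), ?_, ?_, hx₃⟩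
    · simp [cost]; omega
    · rw [hm₃, run]
  | seq S T ihS ihT =>
    intro θ r n s hr hθ h0
    obtain ⟨s₁, t₁, r₁, ht₁, hv₁, hx₁⟩ := ihS θ r n s hr hθ h0
    obtain ⟨s₂, t₂, r₂, ht₂, hv₂, hx₂⟩ := ihT θ r n s₁ hr hθ (by rw [hx₁ 0 hr, h0])
    have e2 : (fun x => s₁.reg (θ x)) = fun x => s.reg (θ x) := funext fun x => hx₁ _ (hθ x)
    refine ⟨s₂, _, .seq r₁ r₂, by simp [cost]; omega, ?_, fun x hx => (hx₂ x hx).trans (hx₁ x hx)⟩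
    rw [hv₂, hv₁, e2, run]
  | ite c S T ihS ihT =>
    intro θ r n s hr hθ h0
    obtain ⟨s₁, t₁, r₁, ht₁, hv₁, hm₁, hx₁⟩ := c.compile_runs θ r n s hr hθ h0
    have e1 : s₁.visible = s.visible := State.visible_congr hm₁
    have e2 : (fun x => s₁.reg (θ x)) = fun x => s.reg (θ x) := funext fun x => hx₁ _ (hθ x)
    by_cases hc : s₁.reg r = 0
    · obtain ⟨s₂, t₂, r₂, ht₂, hv₂, hx₂⟩ := ihT θ r n s₁ hr hθ (by rw [hx₁ 0 hr, h0])
      refine ⟨_, _, .seq r₁ (.branch_else hc r₂), by simp [cost]; omega, ?_,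
        fun x hx => (hx₂ x hx).trans (hx₁ x hx)⟩
      rw [hv₁] at hc
      rw [hv₂, e1, e2, run, if_neg (by simpa using hc)]
    · obtain ⟨s₂, t₂, r₂, ht₂, hv₂, hx₂⟩ := ihS θ r n s₁ hr hθ (by rw [hx₁ 0 hr, h0])
      refine ⟨_, _, .seq r₁ (.branch_then hc r₂), by simp [cost]; omega, ?_,
        fun x hx => (hx₂ x hx).trans (hx₁ x hx)⟩
      rw [hv₁] at hc
      rw [hv₂, e1, e2, run, if_pos hc]
  | loop x S ih =>
    intro θ r n s hr hθ h0
    let M : ℕ → Mem := fun k => Nat.rec (motive := fun _ => Mem) s.visible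
      (fun i m' => S.run n (Function.update (fun x => s.reg (θ x)) x i) m') k
    obtain ⟨s', t, r', ht', -, hm', hx'⟩ := forProgram_runs (i := r) (n := n)
      (τ := S.cost.eval n) (B := S.compile (Function.update θ x r) (r + 1))
      (fun k s' => s'.visible = M k ∧ ∀ x < r, s'.reg x = s.reg x) hr
      (by
        rintro k u u' ⟨h1, h2⟩ hm hx
        refine ⟨?_, fun x hx' => ?_⟩
        · rw [← h1]; exact State.visible_congr hm
        · rw [hx _ (by omega), h2 x hx'])
      (by
        rintro k hk u ⟨h1, h3⟩ hi h0'
        obtain ⟨s₁, t₁, r₁, ht₁, hv₁, hx₁⟩ := ih (Function.update θ x r) (r + 1) n u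
          (by omega) (fun y => by
            have := hθ y
            rw [Function.update_apply]; split_ifs <;> omega) h0'
        have e2 : (fun y => u.reg (Function.update θ x r y)) =
            Function.update (fun x => s.reg (θ x)) x k := by
          funext y
          by_cases hy : y = x
          · subst hy; simp [hi]
          · simp [hy, h3 _ (hθ y)]
        rw [h1, e2] at hv₁
        refine ⟨s₁, t₁, r₁, ht₁, ?_, ?_, hv₁, fun y hy => ?_⟩
        · rw [hx₁ 0 (by omega), h0']
        · rw [hx₁ r (by omega), hi]
        · rw [hx₁ y (by omega), h3 y hy])
      (s := s) h0 ⟨rfl, fun _ _ => rfl⟩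
    exact ⟨s', t, r', by simpa [cost] using ht', hm', hx'⟩

end CircularColouring

namespace CircularColouring

/-! ### Lifting recolourings to integer shifts -/

section Lifts

variable {V : Type*} {G : SimpleGraph V} {p q : ℕ}

/-- The label `f v - f u mod p` of the arc `uv`, as an integer in `[0, p)`. -/
def arc (f : V → Fin p) (u v : V) : ℤ := (((f v : ℕ) : ℤ) - ((f u : ℕ) : ℤ)) % (p : ℤ)

theorem arc_cases (f : V → Fin p) (u v : V) :
    ((f u : ℕ) ≤ (f v : ℕ) ∧ arc f u v = (f v : ℕ) - (f u : ℕ)) ∨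
      ((f v : ℕ) < (f u : ℕ) ∧ arc f u v = (f v : ℕ) - (f u : ℕ) + p) := by
  have hu := (f u).isLt
  have hv := (f v).isLt
  unfold arc
  rcases le_or_gt (f u : ℕ) (f v : ℕ) with h | h
  · exact .inl ⟨h, Int.emod_eq_of_lt (by omega) (by omega)⟩
  · refine .inr ⟨h, ?_⟩
    rw [← Int.add_emod_right]
    exact Int.emod_eq_of_lt (by omega) (by omega)

theorem isColouring_iff_arc {f : V → Fin p} :
    IsColouring G q f ↔ ∀ u v, G.Adj u v → (q : ℤ) ≤ arc f u v ∧ arc f u v ≤ p - q := by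
  refine forall₃_congr fun u v _ => ?_
  rcases arc_cases f u v with ⟨h, e⟩ | ⟨h, e⟩
  · rw [e, abs_of_nonpos (by omega)]
    omega
  · rw [e, abs_of_nonneg (by omega)]
    omega

theorem arc_swap {f : V → Fin p} (hq : 0 < q) (hf : IsColouring G q f) {u v : V} (h : G.Adj u v) :
    arc f v u = p - arc f u v := by
  have h1 := (isColouring_iff_arc.1 hf u v h)
  have h2 := (isColouring_iff_arc.1 hf v u h.symm)
  rcases arc_cases f u v with ⟨h, e⟩ | ⟨h, e⟩ <;> rcases arc_cases f v u with ⟨h', e'⟩ | ⟨h', e'⟩ <;>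
    omega

/-- The colouring obtained from `f` by adding `y` modulo `p`. -/
def shift (f : V → Fin p) (y : V → ℤ) (v : V) : Fin p :=
  ⟨((((f v : ℕ) : ℤ) + y v) % (p : ℤ)).toNat, by
    have h0 : (0 : ℤ) < p := by exact_mod_cast (f v).pos
    have h1 := Int.emod_lt_of_pos (((f v : ℕ) : ℤ) + y v) h0
    have h2 := Int.emod_nonneg (((f v : ℕ) : ℤ) + y v) h0.ne'
    omega⟩

theorem shift_coe (f : V → Fin p) (y : V → ℤ) (v : V) :
    ((shift f y v : ℕ) : ℤ) = (((f v : ℕ) : ℤ) + y v) % (p : ℤ) := by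
  have h0 : (0 : ℤ) < p := by exact_mod_cast (f v).pos
  have h2 := Int.emod_nonneg (((f v : ℕ) : ℤ) + y v) h0.ne'
  simp [shift, h2]

theorem eq_shift {f g : V → Fin p} {y : V → ℤ} {v : V}
    (h : ((g v : ℕ) : ℤ) ≡ (f v : ℕ) + y v [ZMOD p]) : g v = shift f y v := by
  have h1 : ((g v : ℕ) : ℤ) % p = (g v : ℕ) :=
    Int.emod_eq_of_lt (by omega) (by have := (g v).isLt; omega)
  have h2 := shift_coe f y v
  rw [← h.eq, h1] at h2
  exact Fin.ext (by exact_mod_cast h2.symm)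

theorem shift_modEq (f : V → Fin p) (y : V → ℤ) (v : V) :
    ((shift f y v : ℕ) : ℤ) ≡ (f v : ℕ) + y v [ZMOD p] := by
  rw [shift_coe]; exact Int.mod_modEq _ _

theorem shift_eq_self {f : V → Fin p} {y : V → ℤ} {v : V} (h : y v = 0) : shift f y v = f v :=
  (eq_shift (by rw [h, add_zero])).symm

theorem shift_shift (f : V → Fin p) (y z : V → ℤ) :
    shift (shift f y) z = shift f (y + z) := by
  funext v
  refine eq_shift ?_
  refine (shift_modEq _ _ v).trans ?_
  rw [Pi.add_apply, ← add_assoc]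
  exact (shift_modEq _ _ v).add_right _

theorem shift_ne_self {f : V → Fin p} {y : V → ℤ} {v : V} (hp : 2 ≤ p) (h : y v = 1 ∨ y v = -1) :
    shift f y v ≠ f v := by
  intro he
  have h1 := shift_modEq f y v
  rw [he] at h1
  have h2 : (p : ℤ) ∣ y v := by
    have := h1.dvd
    rwa [add_sub_cancel_left] at this
  have h3 : (p : ℤ) ∣ 1 := by
    rcases h with h | h <;> rw [h] at h2
    · exact h2
    · exact (dvd_neg (b := (1 : ℤ))).1 h2
  have := Int.le_of_dvd one_pos h3
  omega

/-- `y` lifts a recolouring of `f` to `g`. -/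
structure IsLift (G : SimpleGraph V) (f : V → Fin p) (y : V → ℤ) (g : V → Fin p) : Prop where
  modEq : ∀ v, ((g v : ℕ) : ℤ) ≡ (f v : ℕ) + y v [ZMOD p]
  arc_eq : ∀ u v, G.Adj u v → arc g u v = arc f u v + y v - y u

theorem IsLift.eq_shift {f g : V → Fin p} {y : V → ℤ} (h : IsLift G f y g) : g = shift f y :=
  funext fun v => CircularColouring.eq_shift (h.modEq v)

theorem IsLift.refl (f : V → Fin p) : IsLift G f 0 f :=
  ⟨fun v => by simp [Int.ModEq.refl], fun u v _ => by simp⟩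

theorem IsLift.trans {f g h : V → Fin p} {y z : V → ℤ} (h₁ : IsLift G f y g)
    (h₂ : IsLift G g z h) : IsLift G f (y + z) h :=
  ⟨fun v => by
    refine (h₂.modEq v).trans ?_
    rw [Pi.add_apply, ← add_assoc]
    exact (h₁.modEq v).add_right _,
  fun u v huv => by rw [h₂.arc_eq u v huv, h₁.arc_eq u v huv, Pi.add_apply, Pi.add_apply]; ring⟩

theorem isLift_of_bounds {f g : V → Fin p} {y : V → ℤ}
    (h : ∀ v, ((g v : ℕ) : ℤ) ≡ (f v : ℕ) + y v [ZMOD p])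
    (hb : ∀ u v, G.Adj u v → 0 ≤ arc f u v + y v - y u ∧ arc f u v + y v - y u < p) :
    IsLift G f y g := by
  refine ⟨h, fun u v huv => ?_⟩
  have h1 : ((g v : ℕ) : ℤ) - (g u : ℕ) ≡ arc f u v + y v - y u [ZMOD p] := by
    refine ((h v).sub (h u)).trans ?_
    have : ((f v : ℕ) : ℤ) - (f u : ℕ) ≡ arc f u v [ZMOD p] := (Int.mod_modEq _ _).symm
    have h2 := (this.add_right (y v)).sub_right (y u)
    convert h2 using 1
    ring
  rw [arc, h1.eq]
  exact Int.emod_eq_of_lt (hb u v huv).1 (hb u v huv).2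

/-- Shifting `f` by `y` keeps all edges properly coloured. -/
def Feasible (G : SimpleGraph V) (q : ℕ) (f : V → Fin p) (y : V → ℤ) : Prop :=
  ∀ u v, G.Adj u v → (q : ℤ) ≤ arc f u v + y v - y u

theorem Feasible.isLift (hq : 0 < q) {f : V → Fin p} {y : V → ℤ} (hf : IsColouring G q f)
    (h : Feasible G q f y) : IsLift G f y (shift f y) := by
  refine isLift_of_bounds (shift_modEq f y) fun u v huv => ?_
  have h1 := h u v huv
  have h2 := h v u huv.symm
  rw [arc_swap hq hf huv] at h2
  omega

theorem Feasible.isColouring (hq : 0 < q) {f : V → Fin p} {y : V → ℤ} (hf : IsColouring G q f)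
    (h : Feasible G q f y) : IsColouring G q (shift f y) := by
  refine isColouring_iff_arc.2 fun u v huv => ?_
  rw [(h.isLift hq hf).arc_eq u v huv]
  have h1 := h u v huv
  have h2 := h v u huv.symm
  rw [arc_swap hq hf huv] at h2
  omega

theorem IsLift.feasible {f g : V → Fin p} {y : V → ℤ} (hg : IsColouring G q g)
    (h : IsLift G f y g) : Feasible G q f y := fun u v huv => by
  rw [← h.arc_eq u v huv]
  exact (isColouring_iff_arc.1 hg u v huv).1

open Classical in
/-- For `p < 4q`, recolouring a single vertex amounts to shifting it along the circle. -/
theorem exists_isLift_single (hq : 0 < q) (h4 : p < 4 * q) {f g : V → Fin p}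
    (hf : IsColouring G q f) (hg : IsColouring G q g) {w : V} (h : ∀ v, v ≠ w → f v = g v) :
    ∃ k : ℤ, IsLift G f (Pi.single w k) g := by
  set k₀ : ℤ := (((g w : ℕ) : ℤ) - (f w : ℕ)) % p with hk₀
  have hp : (0 : ℤ) < p := by exact_mod_cast (f w).pos
  have hk1 := Int.emod_lt_of_pos (((g w : ℕ) : ℤ) - (f w : ℕ)) hp
  have hk2 := Int.emod_nonneg (((g w : ℕ) : ℤ) - (f w : ℕ)) hp.ne'
  rw [← hk₀] at hk1 hk2
  have hmod : k₀ ≡ ((g w : ℕ) : ℤ) - (f w : ℕ) [ZMOD p] := Int.mod_modEq _ _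
  have hw : ∀ v, G.Adj w v → arc g w v = arc f w v - k₀ ∨ arc g w v = arc f w v - k₀ + p := by
    intro v hv
    have e : f v = g v := h v hv.ne'
    have c1 := (isColouring_iff_arc.1 hf w v hv)
    have c2 := (isColouring_iff_arc.1 hg w v hv)
    have : (p : ℤ) ∣ arc g w v - (arc f w v - k₀) := by
      apply Int.ModEq.dvd
      have a1 : arc g w v ≡ ((g v : ℕ) : ℤ) - (g w : ℕ) [ZMOD p] := Int.mod_modEq _ _
      have a2 : arc f w v ≡ ((f v : ℕ) : ℤ) - (f w : ℕ) [ZMOD p] := Int.mod_modEq _ _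
      refine ((a2.sub hmod).trans ?_).trans a1.symm
      rw [e]
      change _ % _ = _ % _
      congr 1
      ring
    obtain ⟨t, ht⟩ := this
    have t0 : -1 < t := by
      by_contra hcon
      nlinarith
    have t1 : t < 2 := by
      by_contra hcon
      nlinarith
    obtain rfl | rfl : t = 0 ∨ t = 1 := by omega
    · left; linarith
    · right; linarith
  have key : ∃ k : ℤ, (p : ℤ) ∣ k - k₀ ∧ ∀ v, G.Adj w v → arc g w v = arc f w v - k := by
    by_cases hall : ∀ v, G.Adj w v → arc g w v = arc f w v - k₀
    · exact ⟨k₀, by simp, hall⟩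
    · push Not at hall
      obtain ⟨v₁, hv₁, hne⟩ := hall
      have e₁ := (hw v₁ hv₁).resolve_left hne
      refine ⟨k₀ - p, by simp, fun v hv => ?_⟩
      rcases hw v hv with e | e
      · have c1 := (isColouring_iff_arc.1 hf w v hv)
        have c2 := (isColouring_iff_arc.1 hg w v hv)
        have c3 := (isColouring_iff_arc.1 hf w v₁ hv₁)
        have c4 := (isColouring_iff_arc.1 hg w v₁ hv₁)
        omega
      · rw [e]; ring
  obtain ⟨k, hk, hkw⟩ := key
  refine ⟨k, fun v => ?_, fun u v huv => ?_⟩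
  · by_cases hv : v = w
    · subst hv
      rw [Pi.single_eq_same]
      have : k ≡ ((g v : ℕ) : ℤ) - (f v : ℕ) [ZMOD p] :=
        (Int.modEq_iff_dvd.2 hk).symm.trans hmod
      have := (this.add_left ((f v : ℕ) : ℤ)).symm
      rwa [add_sub_cancel] at this
    · rw [Pi.single_eq_of_ne hv, add_zero, h v hv]
  · by_cases hu : u = w
    · subst hu
      rw [Pi.single_eq_same, Pi.single_eq_of_ne huv.ne', hkw v huv]
      ring
    · by_cases hv : v = w
      · subst hv
        rw [Pi.single_eq_same, Pi.single_eq_of_ne hu, arc_swap hq hg huv.symm,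
          arc_swap hq hf huv.symm, hkw u huv.symm]
        ring
      · rw [Pi.single_eq_of_ne hu, Pi.single_eq_of_ne hv, arc, arc, h u hu, h v hv]
        ring

/-! ### Reconfiguration as a reachability relation -/

/-- `f` and `g` are colourings that differ on exactly one vertex. -/
def Step (G : SimpleGraph V) (q : ℕ) (f g : V → Fin p) : Prop :=
  IsColouring G q f ∧ IsColouring G q g ∧ ∃! v, f v ≠ g v

theorem Step.symm {f g : V → Fin p} (h : Step G q f g) : Step G q g f := by
  refine ⟨h.2.1, h.1, ?_⟩
  simpa only [ne_comm] using h.2.2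

theorem IsReconfigurationSequence.snoc {f g g' : V → Fin p} {m : ℕ} {c : ℕ → V → Fin p}
    (h : IsReconfigurationSequence G q f g m c) (hs : Step G q g g') :
    IsReconfigurationSequence G q f g' (m + 1) fun i => if i ≤ m then c i else g' := by
  obtain ⟨h0, hm, hc, hst⟩ := h
  refine ⟨by simpa using h0, by simp, ?_, ?_⟩
  · intro i hi
    split_ifs with h
    · exact hc i h
    · exact hs.2.1
  · intro i hi
    rcases Nat.lt_or_ge i m with h | h
    · simpa [h.le, Nat.succ_le_of_lt h] using hst i h
    · obtain rfl : i = m := by omega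
      simpa [hm] using hs.2.2

theorem reconfigures_iff {f g : V → Fin p} :
    Reconfigures G q f g ↔ IsColouring G q f ∧ Relation.ReflTransGen (Step G q) f g := by
  constructor
  · rintro ⟨m, c, h0, hm, hc, hs⟩
    refine ⟨h0 ▸ hc 0 (Nat.zero_le _), ?_⟩
    have : ∀ i ≤ m, Relation.ReflTransGen (Step G q) f (c i) := by
      intro i
      induction i with
      | zero => intro _; rw [h0]
      | succ i ih =>
        intro hi
        exact (ih (by omega)).tail ⟨hc i (by omega), hc (i + 1) hi, hs i (by omega)⟩
    exact hm ▸ this m le_rfl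
  · rintro ⟨hf, h⟩
    induction h with
    | refl => exact ⟨0, fun _ => f, rfl, rfl, fun _ _ => hf, fun i hi => absurd hi (by omega)⟩
    | @tail g g' _ hs ih =>
      obtain ⟨m, c, hc⟩ := ih
      exact ⟨m + 1, _, hc.snoc hs⟩

theorem Reconfigures.symm {f g : V → Fin p} (h : Reconfigures G q f g) :
    Reconfigures G q g f := by
  rw [reconfigures_iff] at h ⊢
  obtain ⟨hf, h⟩ := h
  have hg : IsColouring G q g := by
    cases h with
    | refl => exact hf
    | tail _ h => exact h.2.1
  refine ⟨hg, ?_⟩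
  induction h with
  | refl => rfl
  | tail _ h ih => exact Relation.ReflTransGen.head h.symm (ih h.1)

theorem Reconfigures.trans {f g h : V → Fin p} (h₁ : Reconfigures G q f g)
    (h₂ : Reconfigures G q g h) : Reconfigures G q f h := by
  rw [reconfigures_iff] at h₁ h₂ ⊢
  exact ⟨h₁.1, h₁.2.trans h₂.2⟩

theorem isFixed_congr {f g : V → Fin p} (h : Reconfigures G q f g) {v : V}
    (hv : IsFixed G q f v) : IsFixed G q g v := fun h' hh => by
  rw [hv h' (h.trans hh), hv g h]

/-! ### Stuck vertices -/

/-- The label of an arc `vw` that prevents `v` from moving by `ε = 1` or `ε = -1`. -/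
def tightLabel (p q : ℕ) (ε : ℤ) : ℤ := if ε = 1 then q else p - q

/-- There are `t` consecutive tight arcs starting from `v`. -/
def Stuck (G : SimpleGraph V) (q : ℕ) (f : V → Fin p) (ε : ℤ) : ℕ → V → Prop
  | 0, _ => True
  | t + 1, v => ∃ w, G.Adj v w ∧ arc f v w = tightLabel p q ε ∧ Stuck G q f ε t w

/-- There are arbitrarily long walks of tight arcs starting from `v`. -/
def Blocked (G : SimpleGraph V) (q : ℕ) (f : V → Fin p) (ε : ℤ) (v : V) : Prop :=
  ∀ t, Stuck G q f ε t v

theorem Stuck.of_succ {f : V → Fin p} {ε : ℤ} {t : ℕ} : ∀ {v : V}, Stuck G q f ε (t + 1) v →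
    Stuck G q f ε t v := by
  induction t with
  | zero => intro v _; trivial
  | succ t ih =>
    rintro v ⟨w, h, e, hs⟩
    exact ⟨w, h, e, ih hs⟩

theorem blocked_of_postfixed {f : V → Fin p} {ε : ℤ} {S : V → Prop}
    (hS : ∀ v, S v → ∃ w, G.Adj v w ∧ arc f v w = tightLabel p q ε ∧ S w) {v : V} (hv : S v) :
    Blocked G q f ε v := by
  intro t
  induction t generalizing v with
  | zero => trivial
  | succ t ih =>
    obtain ⟨w, h, e, hw⟩ := hS v hv
    exact ⟨w, h, e, ih hw⟩

theorem stuck_stable {f : V → Fin p} {ε : ℤ} {j : ℕ}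
    (h : ∀ v, Stuck G q f ε j v → Stuck G q f ε (j + 1) v) {v : V} (hv : Stuck G q f ε j v) :
    Blocked G q f ε v :=
  blocked_of_postfixed (S := Stuck G q f ε j) h hv

theorem stuck_antitone {f : V → Fin p} {ε : ℤ} {v : V} {s t : ℕ} (h : s ≤ t)
    (hv : Stuck G q f ε t v) : Stuck G q f ε s v := by
  induction h with
  | refl => exact hv
  | step _ ih => exact ih hv.of_succ

theorem blocked_of_stuck_card [Finite V] {f : V → Fin p} {ε : ℤ} {v : V}
    (hv : Stuck G q f ε (Nat.card V) v) : Blocked G q f ε v := by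
  classical
  have key : ∀ t, (∃ j ≤ t, ∀ v, Stuck G q f ε j v → Stuck G q f ε (j + 1) v) ∨
      {v | Stuck G q f ε t v}.ncard + t ≤ Nat.card V := by
    intro t
    induction t with
    | zero => right; exact Set.ncard_le_card _
    | succ t ih =>
      rcases ih with ⟨j, hj, h⟩ | h
      · exact .inl ⟨j, by omega, h⟩
      · by_cases hs : ∀ v, Stuck G q f ε t v → Stuck G q f ε (t + 1) v
        · exact .inl ⟨t, by omega, hs⟩
        · right
          have : {v | Stuck G q f ε (t + 1) v}.ncard < {v | Stuck G q f ε t v}.ncard := by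
            refine Set.ncard_lt_ncard ⟨fun v hv => hv.of_succ, fun hcon => hs fun v hv => hcon hv⟩
              (Set.toFinite _)
          omega
  rcases key (Nat.card V) with ⟨j, hj, h⟩ | h
  · exact stuck_stable h (stuck_antitone hj hv)
  · have : {v | Stuck G q f ε (Nat.card V) v}.ncard = 0 := by omega
    rw [Set.ncard_eq_zero (Set.toFinite _)] at this
    exact absurd hv (by simpa using Set.eq_empty_iff_forall_notMem.1 this v)

theorem Blocked.exists_tight [Finite V] {f : V → Fin p} {ε : ℤ} {v : V}
    (hv : Blocked G q f ε v) :
    ∃ w, G.Adj v w ∧ arc f v w = tightLabel p q ε ∧ Blocked G q f ε w := by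
  obtain ⟨w, h, e, hw⟩ := hv (Nat.card V + 1)
  exact ⟨w, h, e, blocked_of_stuck_card hw⟩

/-- A tight arc `vw` forbids `v` to move further than `w`. -/
theorem Feasible.le_of_tight (hq : 0 < q) {f : V → Fin p} {y : V → ℤ} {ε : ℤ}
    (hε : ε = 1 ∨ ε = -1) (hf : IsColouring G q f) (h : Feasible G q f y) {v w : V}
    (hvw : G.Adj v w) (ht : arc f v w = tightLabel p q ε) : ε * y v ≤ ε * y w := by
  have h1 := h v w hvw
  have h2 := h w v hvw.symm
  rw [arc_swap hq hf hvw] at h2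
  rcases hε with rfl | rfl <;> simp [tightLabel] at ht <;> omega

/-- `y` is a feasible shift that does not move blocked vertices into the blocked direction. -/
structure Good (G : SimpleGraph V) (q : ℕ) (f : V → Fin p) (y : V → ℤ) : Prop where
  colouring : IsColouring G q f
  feasible : Feasible G q f y
  nonpos : ∀ ε : ℤ, ε = 1 ∨ ε = -1 → ∀ v, Blocked G q f ε v → ε * y v ≤ 0

theorem exists_isLift [Finite V] (hq : 0 < q) (h4 : p < 4 * q) {f g : V → Fin p}
    (h : Reconfigures G q f g) : ∃ y, IsLift G f y g ∧ Good G q f y := by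
  classical
  obtain ⟨hf, hr⟩ := reconfigures_iff.1 h
  clear h
  induction hr with
  | refl =>
    refine ⟨0, IsLift.refl f, hf, (IsLift.refl f).feasible hf, fun ε _ v _ => by simp⟩
  | @tail g g' _ hs ih =>
    obtain ⟨y, hy, hgood⟩ := ih
    obtain ⟨w, hw, hw'⟩ := hs.2.2
    obtain ⟨k, hk⟩ := exists_isLift_single hq h4 hs.1 hs.2.1 (w := w) fun v hv => by
      by_contra hne
      exact hv (hw' v hne)
    have hl := hy.trans hk
    have hfe := hl.feasible hs.2.1
    refine ⟨_, hl, hf, hfe, fun ε hε v hv => ?_⟩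
    by_cases hvw : v = w
    · obtain ⟨u, hvu, htu, hu⟩ := hv.exists_tight
      refine (hfe.le_of_tight hq hε hf hvu htu).trans ?_
      rw [Pi.add_apply, Pi.single_eq_of_ne (by rintro rfl; exact hvu.ne hvw), add_zero]
      exact hgood.nonpos ε hε u hu
    · rw [Pi.add_apply, Pi.single_eq_of_ne hvw, add_zero]
      exact hgood.nonpos ε hε v hv

/-- The vertex `w` can be moved by `ε` in the direction of `y`. -/
def Movable (G : SimpleGraph V) (q : ℕ) (f : V → Fin p) (y : V → ℤ) (w : V) (ε : ℤ) : Prop :=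
  0 < ε * y w ∧ ∀ u, G.Adj w u → arc f w u ≠ tightLabel p q ε

theorem Good.exists_movable (hq : 0 < q) {f : V → Fin p} {y : V → ℤ} (h : Good G q f y)
    (hy : y ≠ 0) : ∃ w ε, (ε = 1 ∨ ε = -1) ∧ Movable G q f y w ε := by
  obtain ⟨v, hv⟩ := Function.ne_iff.1 hy
  obtain ⟨ε, hε, hv⟩ : ∃ ε : ℤ, (ε = 1 ∨ ε = -1) ∧ 0 < ε * y v := by
    rcases lt_or_gt_of_ne hv with h | h
    · exact ⟨-1, .inr rfl, by simp at h ⊢; omega⟩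
    · exact ⟨1, .inl rfl, by simp at h ⊢; omega⟩
  by_contra! hcon
  have : Blocked G q f ε v := by
    refine blocked_of_postfixed (S := fun v => 0 < ε * y v) (fun u hu => ?_) hv
    have := hcon u ε hε
    simp only [Movable, not_and, not_forall, not_not] at this
    obtain ⟨w, huw, ht⟩ := this hu
    exact ⟨w, huw, ht, hu.trans_le (h.feasible.le_of_tight hq hε h.colouring huw ht)⟩
  exact absurd (h.nonpos ε hε v this) (by omega)

theorem feasible_single [DecidableEq V] (hq : 0 < q) {f : V → Fin p} (hf : IsColouring G q f)
    {w : V} {ε : ℤ} (hε : ε = 1 ∨ ε = -1) (h : ∀ u, G.Adj w u → arc f w u ≠ tightLabel p q ε) :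
    Feasible G q f (Pi.single w ε) := by
  intro u v huv
  have c := isColouring_iff_arc.1 hf u v huv
  by_cases hu : u = w
  · subst hu
    rw [Pi.single_eq_same, Pi.single_eq_of_ne huv.ne']
    have := h v huv
    rcases hε with rfl | rfl <;> simp [tightLabel] at this <;> omega
  · rw [Pi.single_eq_of_ne hu]
    by_cases hv : v = w
    · subst hv
      rw [Pi.single_eq_same]
      have := h u huv.symm
      rw [arc_swap hq hf huv] at this
      rcases hε with rfl | rfl <;> simp [tightLabel] at this <;> omega
    · rw [Pi.single_eq_of_ne hv]
      omega

theorem Good.move [Finite V] [DecidableEq V] (hq : 0 < q) {f : V → Fin p} {y : V → ℤ}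
    (h : Good G q f y) {w : V} {ε : ℤ} (hε : ε = 1 ∨ ε = -1) (hm : Movable G q f y w ε) :
    Good G q (shift f (Pi.single w ε)) (y - Pi.single w ε) := by
  have hfs := feasible_single hq h.colouring hε hm.2
  have hcol := hfs.isColouring hq h.colouring
  have hl := hfs.isLift hq h.colouring
  have hfe : Feasible G q (shift f (Pi.single w ε)) (y - Pi.single w ε) := fun u v huv => by
    rw [hl.arc_eq u v huv, Pi.sub_apply, Pi.sub_apply]
    have := h.feasible u v huv
    omega
  refine ⟨hcol, hfe, ?_⟩
  have key : ∀ ε' : ℤ, ε' = 1 ∨ ε' = -1 → ∀ v, v ≠ w →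
      Blocked G q (shift f (Pi.single w ε)) ε' v →
      (ε' ≠ ε → ¬ Blocked G q (shift f (Pi.single w ε)) ε' w) → Blocked G q f ε' v := by
    intro ε' hε' v hvw hv hopp
    refine blocked_of_postfixed (S := fun v => v ≠ w ∧
      Blocked G q (shift f (Pi.single w ε)) ε' v) ?_ ⟨hvw, hv⟩
    rintro v ⟨hvw, hv⟩
    obtain ⟨u, hvu, ht, hu⟩ := hv.exists_tight
    have huw : u ≠ w := by
      rintro rfl
      rw [hl.arc_eq v u hvu, Pi.single_eq_same, Pi.single_eq_of_ne hvw] at ht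
      have c := isColouring_iff_arc.1 h.colouring v u hvu
      by_cases hee : ε' = ε
      · subst hee
        rcases hε with rfl | rfl <;> simp [tightLabel] at ht <;> omega
      · exact hopp hee hu
    refine ⟨u, hvu, ?_, huw, hu⟩
    rw [← ht, hl.arc_eq v u hvu, Pi.single_eq_of_ne huw, Pi.single_eq_of_ne hvw]
    ring
  intro ε' hε' v hv
  have hopp : ε' ≠ ε → ¬ Blocked G q (shift f (Pi.single w ε)) ε' w := by
    intro hne hw
    obtain ⟨u, hwu, ht, -⟩ := hw.exists_tight
    rw [hl.arc_eq w u hwu, Pi.single_eq_same, Pi.single_eq_of_ne hwu.ne'] at ht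
    have c := isColouring_iff_arc.1 h.colouring w u hwu
    rcases hε with rfl | rfl <;> rcases hε' with rfl | rfl <;> simp [tightLabel] at ht hne <;>
      omega
  by_cases hvw : v = w
  · subst hvw
    obtain ⟨u, hvu, ht, hu⟩ := hv.exists_tight
    refine (hfe.le_of_tight hq hε' hcol hvu ht).trans ?_
    have := h.nonpos ε' hε' u (key ε' hε' u hvu.ne' hu hopp)
    rwa [Pi.sub_apply, Pi.single_eq_of_ne hvu.ne', sub_zero]
  · have := h.nonpos ε' hε' v (key ε' hε' v hvw hv hopp)
    rwa [Pi.sub_apply, Pi.single_eq_of_ne hvw, sub_zero]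

theorem Good.step [DecidableEq V] (hq : 0 < q) (hp : 2 ≤ p) {f : V → Fin p} {y : V → ℤ}
    (h : Good G q f y) {w : V} {ε : ℤ} (hε : ε = 1 ∨ ε = -1) (hm : Movable G q f y w ε) :
    Step G q f (shift f (Pi.single w ε)) := by
  refine ⟨h.colouring, (feasible_single hq h.colouring hε hm.2).isColouring hq h.colouring, w,
    (shift_ne_self hp (by simpa using hε)).symm, fun v hv => ?_⟩
  by_contra hvw
  exact hv (shift_eq_self (Pi.single_eq_of_ne hvw _)).symm

theorem sum_natAbs_move [Fintype V] [DecidableEq V] {y : V → ℤ} {w : V} {ε : ℤ}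
    (hε : ε = 1 ∨ ε = -1) (hm : 0 < ε * y w) :
    ∑ v, ((y - Pi.single w ε : V → ℤ) v).natAbs + 1 = ∑ v, (y v).natAbs := by
  rw [← Finset.add_sum_erase _ _ (Finset.mem_univ w),
    ← Finset.add_sum_erase _ (fun v => (y v).natAbs) (Finset.mem_univ w)]
  have : ∑ v ∈ Finset.univ.erase w, ((y - Pi.single w ε : V → ℤ) v).natAbs =
      ∑ v ∈ Finset.univ.erase w, (y v).natAbs :=
    Finset.sum_congr rfl fun v hv => by simp [Finset.ne_of_mem_erase hv]
  rw [this, Pi.sub_apply, Pi.single_eq_same]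
  rcases hε with rfl | rfl <;> omega

theorem Good.reconfigures [Finite V] (hq : 0 < q) (hp : 2 ≤ p) {f : V → Fin p} {y : V → ℤ}
    (h : Good G q f y) : Reconfigures G q f (shift f y) := by
  classical
  have := Fintype.ofFinite V
  induction hN : ∑ v, (y v).natAbs using Nat.strong_induction_on generalizing f y with
  | _ N ih =>
    by_cases hy : y = 0
    · subst hy
      rw [reconfigures_iff, show shift f 0 = f from funext fun v => shift_eq_self rfl]
      exact ⟨h.colouring, .refl⟩
    · obtain ⟨w, ε, hε, hm⟩ := h.exists_movable hq hy
      have := sum_natAbs_move hε hm.1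
      have h2 := ih _ (by omega) (h.move hq hε hm) rfl
      rw [shift_shift, add_sub_cancel] at h2
      exact Reconfigures.trans (reconfigures_iff.2 ⟨h.colouring, .single (h.step hq hp hε hm)⟩) h2

theorem isFixed_iff_blocked [Finite V] (hq : 0 < q) (hp : 2 ≤ p) (h4 : p < 4 * q) {f : V → Fin p}
    (hf : IsColouring G q f) (v : V) :
    IsFixed G q f v ↔ Blocked G q f 1 v ∧ Blocked G q f (-1) v := by
  classical
  constructor
  · intro hv
    have key : ∀ ε : ℤ, ε = 1 ∨ ε = -1 → Blocked G q f ε v := by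
      intro ε hε
      by_contra hb
      let y : V → ℤ := fun u => if Blocked G q f ε u then 0 else ε
      have hgood : Good G q f y := by
        refine ⟨hf, fun u w huw => ?_, fun ε' hε' u hu => ?_⟩
        · have c := isColouring_iff_arc.1 hf u w huw
          have c' := arc_swap hq hf huw
          have hst : ∀ a b, G.Adj a b → ¬ Blocked G q f ε a → Blocked G q f ε b →
              arc f a b ≠ tightLabel p q ε := by
            intro a b hab ha hb ht
            refine ha fun t => ?_
            cases t with
            | zero => trivial
            | succ t => exact ⟨b, hab, ht, hb t⟩
          dsimp only [y]
          by_cases hu : Blocked G q f ε u <;> by_cases hw : Blocked G q f ε w <;>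
            simp only [hu, hw, if_true, if_false]
          · omega
          · have h1 := hst w u huw.symm hw hu
            rcases hε with rfl | rfl <;> simp [tightLabel] at h1 <;> omega
          · have h1 := hst u w huw hu hw
            rcases hε with rfl | rfl <;> simp [tightLabel] at h1 <;> omega
          · omega
        · dsimp only [y]
          split_ifs with hb
          · simp
          · have : ε' ≠ ε := by rintro rfl; exact hb hu
            rcases hε with rfl | rfl <;> rcases hε' with rfl | rfl <;> simp at this ⊢
      refine shift_ne_self hp ?_ (hv _ (hgood.reconfigures hq hp))
      simpa [y, hb] using hε
    exact ⟨key 1 (.inl rfl), key (-1) (.inr rfl)⟩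
  · rintro ⟨h1, h2⟩ g hg
    obtain ⟨y, hy, hgood⟩ := exists_isLift hq h4 hg
    have e1 := hgood.nonpos 1 (.inl rfl) v h1
    have e2 := hgood.nonpos (-1) (.inr rfl) v h2
    rw [hy.eq_shift, shift_eq_self (by omega)]

/-- It suffices that a feasible shift does not move the fixed vertices. -/
theorem Feasible.good [Finite V] (hq : 0 < q) (hp : 2 ≤ p) (h4 : p < 4 * q) {f : V → Fin p}
    {y : V → ℤ} (hf : IsColouring G q f) (h : Feasible G q f y)
    (h0 : ∀ v, IsFixed G q f v → y v = 0) : Good G q f y := by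
  refine ⟨hf, h, fun ε hε v hv => ?_⟩
  have key : ∀ t, ∃ u, Blocked G q f ε u ∧ ε * y v ≤ ε * y u ∧ Stuck G q f (-ε) t u := by
    intro t
    induction t with
    | zero => exact ⟨v, hv, le_rfl, trivial⟩
    | succ t ih =>
      obtain ⟨u, hu, hle, hs⟩ := ih
      obtain ⟨w, huw, ht, hw⟩ := hu.exists_tight
      refine ⟨w, hw, hle.trans (h.le_of_tight hq hε hf huw ht), u, huw.symm, ?_, hs⟩
      rw [arc_swap hq hf huw, ht]
      rcases hε with rfl | rfl <;> simp [tightLabel]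
  obtain ⟨u, hu, hle, hs⟩ := key (Nat.card V)
  have hs := blocked_of_stuck_card hs
  have hfix : IsFixed G q f u := by
    rw [isFixed_iff_blocked hq hp h4 hf]
    rcases hε with rfl | rfl
    · exact ⟨hu, hs⟩
    · exact ⟨by simpa using hs, hu⟩
  rw [h0 u hfix, mul_zero] at hle
  exact hle

end Lifts

end CircularColouring

namespace CircularColouring

/-! ### Weights of walks -/

section Walks

variable {V : Type*} {G : SimpleGraph V} {p q : ℕ}

/-- The difference of the weights of a walk under `g` and under `f`. -/
def gain (f g : V → Fin p) {u v : V} (W : G.Walk u v) : ℤ :=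
  (W.darts.map fun d => arc g d.fst d.snd - arc f d.fst d.snd).sum

@[simp]
theorem gain_nil (f g : V → Fin p) (u : V) : gain f g (.nil : G.Walk u u) = 0 := rfl

@[simp]
theorem gain_cons (f g : V → Fin p) {u v w : V} (h : G.Adj u v) (W : G.Walk v w) :
    gain f g (.cons h W) = arc g u v - arc f u v + gain f g W := by
  simp [gain]

@[simp]
theorem gain_append (f g : V → Fin p) {u v w : V} (W : G.Walk u v) (W' : G.Walk v w) :
    gain f g (W.append W') = gain f g W + gain f g W' := by
  simp [gain]

theorem gain_reverse (hq : 0 < q) {f g : V → Fin p} (hf : IsColouring G q f)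
    (hg : IsColouring G q g) {u v : V} (W : G.Walk u v) :
    gain f g W.reverse = - gain f g W := by
  induction W with
  | nil => simp
  | cons h W ih =>
    rw [SimpleGraph.Walk.reverse_cons, gain_append, ih, gain_cons, gain_cons, gain_nil,
      arc_swap hq hf h, arc_swap hq hg h]
    ring

theorem edgeLabelling_cast (o : Orientation G) (f : V → Fin p) (e : G.edgeSet) :
    ((edgeLabelling o f e : ℕ) : ℤ) = arc f (o.tail e) (o.head e) := by
  rcases arc_cases f (o.tail e) (o.head e) with ⟨h, h'⟩ | ⟨h, h'⟩
  · rw [edgeLabelling, Fin.sub_val_of_le (Fin.le_def.2 h), h']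
    omega
  · have := (f (o.tail e)).isLt
    rw [edgeLabelling, Fin.val_sub, h', Nat.mod_eq_of_lt (by omega)]
    omega

theorem weight_eq (hq : 0 < q) {f : V → Fin p} (hf : IsColouring G q f) (o : Orientation G)
    {u v : V} (W : G.Walk u v) :
    weight o (edgeLabelling o f) W = (W.darts.map fun d => arc f d.fst d.snd).sum := by
  unfold weight
  congr 1
  refine List.map_congr_left fun d _ => ?_
  have he := o.ends ⟨d.edge, d.edge_mem⟩
  have hd : d.edge = s(d.fst, d.snd) := rfl
  simp only [hd, Sym2.eq_iff] at he
  rw [edgeLabelling_cast]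
  have hadj := d.adj
  split_ifs with h
  · rcases he with ⟨h1, h2⟩ | ⟨h1, h2⟩
    · exact congrArg₂ (arc f) h1 h2
    · exact absurd (h.trans h1) hadj.ne
  · rcases he with ⟨h1, h2⟩ | ⟨h1, h2⟩
    · exact absurd h1.symm h
    · have : arc f (o.tail ⟨d.edge, d.edge_mem⟩) (o.head ⟨d.edge, d.edge_mem⟩) =
          arc f d.snd d.fst := congrArg₂ (arc f) h1 h2
      rw [this, arc_swap hq hf hadj]
      ring

theorem weight_eq_add_gain (hq : 0 < q) {f g : V → Fin p} (hf : IsColouring G q f)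
    (hg : IsColouring G q g) (o : Orientation G) {u v : V} (W : G.Walk u v) :
    weight o (edgeLabelling o g) W = weight o (edgeLabelling o f) W + gain f g W := by
  rw [weight_eq hq hf, weight_eq hq hg, gain, ← List.sum_map_add]
  simp

theorem IsLift.gain_eq {f g : V → Fin p} {y : V → ℤ} (h : IsLift G f y g) {u v : V}
    (W : G.Walk u v) : gain f g W = y v - y u := by
  induction W with
  | nil => simp
  | cons hadj W ih =>
    rw [gain_cons, ih, h.arc_eq _ _ hadj]
    ring

theorem gain_modEq (f g : V → Fin p) {u v : V} (W : G.Walk u v) :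
    gain f g W ≡ ((g v : ℕ) : ℤ) - (g u : ℕ) - ((f v : ℕ) - (f u : ℕ)) [ZMOD p] := by
  induction W with
  | nil => simp [Int.ModEq.refl]
  | @cons u v w hadj W ih =>
    rw [gain_cons]
    have a1 : arc g u v ≡ ((g v : ℕ) : ℤ) - (g u : ℕ) [ZMOD p] := Int.mod_modEq _ _
    have a2 : arc f u v ≡ ((f v : ℕ) : ℤ) - (f u : ℕ) [ZMOD p] := Int.mod_modEq _ _
    refine ((a1.sub a2).add ih).trans ?_
    change _ % _ = _ % _
    congr 1
    ring

/-- A walk that is not a path contains a closed walk. -/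
theorem exists_closed_of_not_isPath {u v : V} (W : G.Walk u v) (h : ¬ W.IsPath) :
    ∃ (x : V) (A : G.Walk u x) (C : G.Walk x x) (B : G.Walk x v), 0 < C.length ∧
      W = A.append (C.append B) := by
  classical
  induction W with
  | nil => exact absurd SimpleGraph.Walk.IsPath.nil h
  | @cons u w v hadj W ih =>
    by_cases hW : W.IsPath
    · rw [SimpleGraph.Walk.cons_isPath_iff] at h
      have hu : u ∈ W.support := by tauto
      refine ⟨u, .nil, .cons hadj (W.takeUntil u hu), W.dropUntil u hu, by simp, ?_⟩
      simp
    · obtain ⟨x, A, C, B, hC, rfl⟩ := ih hW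
      exact ⟨x, .cons hadj A, C, B, hC, by simp⟩

/-- A shortest closed walk of nonzero gain is a cycle. -/
theorem isCycle_of_minimal (hq : 0 < q) {f g : V → Fin p} (hf : IsColouring G q f)
    (hg : IsColouring G q g) {u : V} (W : G.Walk u u) (hW : gain f g W ≠ 0)
    (hmin : ∀ x (C : G.Walk x x), C.length < W.length → gain f g C = 0) : W.IsCycle := by
  cases W with
  | nil => simp at hW
  | @cons _ w _ hadj W =>
    have hpath : W.IsPath := by
      by_contra hcon
      obtain ⟨x, A, C, B, hC, rfl⟩ := exists_closed_of_not_isPath W hcon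
      have h1 := hmin x C (by simp; omega)
      have h2 := hmin u (.cons hadj (A.append B)) (by simp; omega)
      simp at h2 hW
      omega
    rw [SimpleGraph.Walk.cons_isCycle_iff]
    refine ⟨hpath, fun he => ?_⟩
    cases W with
    | nil => exact hadj.ne rfl
    | @cons _ x _ hadj' W =>
      rw [SimpleGraph.Walk.cons_isPath_iff] at hpath
      rw [SimpleGraph.Walk.edges_cons, List.mem_cons] at he
      rcases he with he | he
      · rw [Sym2.eq_iff] at he
        obtain rfl : u = x := by
          rcases he with ⟨h1, h2⟩ | ⟨h1, h2⟩
          · exact absurd h1 hadj.ne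
          · exact h1
        obtain rfl := (SimpleGraph.Walk.isPath_iff_nil.1 hpath.1).eq_nil
        simp only [gain_cons, gain_nil] at hW
        rw [arc_swap hq hf hadj, arc_swap hq hg hadj] at hW
        omega
      · exact hpath.2 (W.snd_mem_support_of_mem_edges he)

/-- A shortest walk of nonzero gain between two distinct vertices is a path, if there are no
shorter closed walks of nonzero gain. -/
theorem isPath_of_minimal {f g : V → Fin p} {u v : V} (huv : u ≠ v) (W : G.Walk u v)
    (hW : gain f g W ≠ 0) (hmin : ∀ x (C : G.Walk x x), C.length < W.length → gain f g C = 0)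
    (hmin' : ∀ W' : G.Walk u v, W'.length < W.length → gain f g W' = 0) : W.IsPath := by
  by_contra hcon
  obtain ⟨x, A, C, B, hC, rfl⟩ := exists_closed_of_not_isPath W hcon
  have h2 := hmin' (A.append B) (by simp; omega)
  have h1 := hmin x C (by
    rcases Nat.eq_zero_or_pos (A.length + B.length) with h | h
    · refine absurd ?_ huv
      rw [SimpleGraph.Walk.eq_of_length_eq_zero (p := A) (by omega),
        SimpleGraph.Walk.eq_of_length_eq_zero (p := B) (by omega)]
    · simp; omega)
  simp at h2 hW
  omega

theorem gain_closed (hq : 0 < q) {f g : V → Fin p} (hf : IsColouring G q f)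
    (hg : IsColouring G q g) (h : ∀ (u : V) (C : G.Walk u u), C.IsCycle → gain f g C = 0)
    {u : V} (W : G.Walk u u) : gain f g W = 0 := by
  induction hN : W.length using Nat.strong_induction_on generalizing u W with
  | _ N ih =>
    by_contra hW
    exact hW (h u W (isCycle_of_minimal hq hf hg W hW fun x C hC => ih _ (hN ▸ hC) C rfl))

theorem gain_unique (hq : 0 < q) {f g : V → Fin p} (hf : IsColouring G q f)
    (hg : IsColouring G q g) (h : ∀ (u : V) (C : G.Walk u u), gain f g C = 0)
    {u v : V} (W W' : G.Walk u v) : gain f g W = gain f g W' := by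
  have := h u (W.append W'.reverse)
  rw [gain_append, gain_reverse hq hf hg] at this
  omega

/-- A shift from `f` to `g` computed along walks from roots `r v`. -/
theorem good_of_roots [Finite V] (hq : 0 < q) (hp : 2 ≤ p) (h4 : p < 4 * q) {f g : V → Fin p}
    (hf : IsColouring G q f) (hg : IsColouring G q g)
    (hfix : ∀ v, IsFixed G q f v → f v = g v)
    (hC : ∀ (u : V) (C : G.Walk u u), gain f g C = 0)
    (hP : ∀ (u v : V) (W : G.Walk u v), IsFixed G q f u → IsFixed G q f v → gain f g W = 0)
    {y : V → ℤ} (r : V → V) (hr : ∀ u v, G.Adj u v → r u = r v)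
    (hrf : ∀ v, IsFixed G q f v → IsFixed G q f (r v))
    (hy : ∀ v, ∃ W : G.Walk (r v) v, y v = (g (r v) : ℕ) - (f (r v) : ℕ) + gain f g W) :
    Good G q f y ∧ shift f y = g := by
  have hl : IsLift G f y g := by
    refine ⟨fun v => ?_, fun u v huv => ?_⟩
    · obtain ⟨W, hW⟩ := hy v
      rw [hW]
      have := ((gain_modEq f g W).add_left (((f v : ℕ) : ℤ) + ((g (r v) : ℕ) - (f (r v) : ℕ)))).symm
      refine Eq.trans ?_ (this.trans ?_) <;>
      · change _ % _ = _ % _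
        congr 1
        ring
    · obtain ⟨W, hW⟩ := hy u
      obtain ⟨W', hW'⟩ := hy v
      have := hr u v huv
      revert W' hW'
      rw [← this]
      intro W' hW'
      have h1 := gain_unique hq hf hg hC W' (W.append (.cons huv .nil))
      rw [gain_append, gain_cons, gain_nil] at h1
      omega
  refine ⟨(hl.feasible hg).good hq hp h4 hf fun v hv => ?_, hl.eq_shift.symm⟩
  obtain ⟨W, hW⟩ := hy v
  rw [hW, hP _ _ W (hrf v hv) hv, hfix _ (hrf v hv)]
  ring

/-- The characterisation of reconfigurability by fixed vertices, cycles and paths. -/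
theorem reconfigures_iff_invariants [Finite V] (hq : 0 < q) (hp : 2 ≤ p) (h4 : p < 4 * q)
    {f g : V → Fin p} (hf : IsColouring G q f) (hg : IsColouring G q g) :
    Reconfigures G q f g ↔
      ((∀ v, IsFixed G q f v ↔ IsFixed G q g v) ∧ ∀ v, IsFixed G q f v → f v = g v) ∧
      (∀ (u : V) (C : G.Walk u u), C.IsCycle → gain f g C = 0) ∧
      ∀ (u v : V) (W : G.Walk u v), W.IsPath → IsFixed G q f u → IsFixed G q f v →
        gain f g W = 0 := by
  classical
  constructor
  · intro h
    obtain ⟨y, hy, hgood⟩ := exists_isLift hq h4 h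
    have h0 : ∀ v, IsFixed G q f v → y v = 0 := by
      intro v hv
      rw [isFixed_iff_blocked hq hp h4 hf] at hv
      have e1 := hgood.nonpos 1 (.inl rfl) v hv.1
      have e2 := hgood.nonpos (-1) (.inr rfl) v hv.2
      omega
    refine ⟨⟨fun v => ⟨isFixed_congr h, isFixed_congr h.symm⟩, fun v hv => (hv g h).symm⟩,
      fun u C _ => ?_, fun u v W _ hu hv => ?_⟩
    · rw [hy.gain_eq, sub_self]
    · rw [hy.gain_eq, h0 u hu, h0 v hv, sub_self]
  · rintro ⟨⟨-, h1⟩, h2, h3⟩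
    have hC : ∀ (u : V) (C : G.Walk u u), gain f g C = 0 := fun u C => gain_closed hq hf hg h2 C
    let R : V → V → Prop := fun v u => G.Reachable u v ∧
      ((∃ w, IsFixed G q f w ∧ G.Reachable w v) → IsFixed G q f u)
    have hR : ∀ v, ∃ u, R v u := by
      intro v
      by_cases h : ∃ w, IsFixed G q f w ∧ G.Reachable w v
      · obtain ⟨w, hw, hwv⟩ := h
        exact ⟨w, hwv, fun _ => hw⟩
      · exact ⟨v, .refl v, fun h' => absurd h' h⟩
    have hRadj : ∀ u v, G.Adj u v → R u = R v := by
      intro u v huv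
      have : ∀ w, G.Reachable w u ↔ G.Reachable w v :=
        fun w => ⟨fun h => h.trans huv.reachable, fun h => h.trans huv.symm.reachable⟩
      funext w
      simp only [R, this]
    have : Nonempty (V → V) := ⟨id⟩
    let r : V → V := fun v => @Classical.epsilon V ⟨v⟩ (R v)
    have hr : ∀ v, R v (r v) := fun v => @Classical.epsilon_spec_aux V ⟨v⟩ (R v) (hR v)
    choose W _ using fun v => (⟨(hr v).1.some, trivial⟩ : ∃ W : G.Walk (r v) v, True)
    obtain ⟨hgood, he⟩ := good_of_roots hq hp h4 hf hg h1 hC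
      (fun u v W hu hv => by
        rw [gain_unique hq hf hg hC W W.bypass]
        exact h3 u v _ W.bypass_isPath hu hv)
      (y := fun v => (g (r v) : ℕ) - (f (r v) : ℕ) + gain f g (W v)) r
      (fun u v huv => by
        simp only [r, hRadj u v huv])
      (fun v hv => (hr v).2 ⟨v, hv, .refl v⟩) fun v => ⟨W v, rfl⟩
    exact he ▸ hgood.reconfigures hq hp

end Walks

end CircularColouring

namespace CircularColouring

/-! ### Reasoning about loop programs -/

/-- The arrays that a statement may change. -/
def Stm.writes : Stm → List ℕ
  | .skip => []
  | .put a _ _ => [a]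
  | .row a _ _ _ => [a]
  | .seq S T => S.writes ++ T.writes
  | .ite _ S T => S.writes ++ T.writes
  | .loop _ S => S.writes

theorem Stm.run_loop_induction {n : ℕ} {x : ℕ} {S : Stm} {ρ : ℕ → ℕ} {m : Mem}
    (I : ℕ → Mem → Prop) (h0 : I 0 m)
    (hs : ∀ i < n, ∀ m, I i m → I (i + 1) (S.run n (Function.update ρ x i) m)) :
    I n ((Stm.loop x S).run n ρ m) := by
  have : ∀ k ≤ n, I k (Nat.rec (motive := fun _ => Mem) m
      (fun i m' => S.run n (Function.update ρ x i) m') k) := by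
    intro k
    induction k with
    | zero => intro _; exact h0
    | succ k ih => intro hk; exact hs k (by omega) _ (ih (by omega))
  exact this n le_rfl

theorem Stm.run_of_notMem (S : Stm) {n : ℕ} {a : ℕ} (h : a ∉ S.writes) (ρ : ℕ → ℕ) (m : Mem) :
    S.run n ρ m a = m a := by
  induction S generalizing ρ m with
  | skip => rfl
  | put b i e => simp only [writes, List.mem_singleton] at h; simp [run, h]
  | row b j x e => simp only [writes, List.mem_singleton] at h; simp [run, h]
  | seq S T ihS ihT =>
    simp only [writes, List.mem_append, not_or] at h
    rw [run, ihT h.2, ihS h.1]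
  | ite c S T ihS ihT =>
    simp only [writes, List.mem_append, not_or] at h
    rw [run]
    split_ifs
    · exact ihS h.1 _ _
    · exact ihT h.2 _ _
  | loop x S ih =>
    exact run_loop_induction (fun _ m' => m' a = m a) rfl fun i _ m' hm' => by
      rw [ih h, hm']

theorem mul_add_inj {n a b i j : ℕ} (hi : i < n) (hj : j < n) :
    a * n + i = b * n + j ↔ a = b ∧ i = j := by
  constructor
  · intro h
    have h1 := congrArg (· / n) h
    have h2 := congrArg (· % n) h
    have hn : 0 < n := by omega
    simp only [Nat.add_comm (_ * n), Nat.add_mul_div_right _ _ hn, Nat.div_eq_of_lt hi,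
      Nat.div_eq_of_lt hj, Nat.add_mul_mod_self_right, Nat.mod_eq_of_lt hi,
      Nat.mod_eq_of_lt hj] at h1 h2
    omega
  · rintro ⟨rfl, rfl⟩; rfl

theorem Stm.run_row {n a x : ℕ} {j e : Exp} {ρ : ℕ → ℕ} {m : Mem} {i k : ℕ} (hk : k < n) :
    (Stm.row a j x e).run n ρ m a (i * n + k) =
      if i = j.eval n m ρ then e.eval n m (Function.update ρ x k) else m a (i * n + k) := by
  rw [run, Function.update_self]
  by_cases h : i = j.eval n m ρ
  · subst h
    rw [if_pos ⟨by omega, by omega⟩, if_pos rfl]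
    congr 2
    omega
  · rw [if_neg h, if_neg]
    rintro ⟨h1, h2⟩
    obtain ⟨l, hl⟩ := Nat.exists_eq_add_of_le h1
    exact h ((mul_add_inj hk (by omega)).1 hl).1

theorem Stm.run_row_zero {n a x : ℕ} {e : Exp} {ρ : ℕ → ℕ} {m : Mem} {k : ℕ} (hk : k < n) :
    (Stm.row a (.const 0) x e).run n ρ m a k = e.eval n m (Function.update ρ x k) := by
  have := run_row (a := a) (x := x) (j := .const 0) (e := e) (ρ := ρ) (m := m) (i := 0) hk
  simpa [Exp.eval] using this

namespace Exp

variable {n : ℕ} {m : Mem} {ρ : ℕ → ℕ}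

/-- A nonzero value iff `a < b`. -/
def lt (a b : Exp) : Exp := .sub b a
/-- Nonzero iff `a` is zero. -/
def not (a : Exp) : Exp := .sub (.const 1) a
/-- Nonzero iff both arguments are. -/
def and (a b : Exp) : Exp := .ite a b (.const 0)
/-- Nonzero iff one of the arguments is. -/
def or (a b : Exp) : Exp := .add a b
/-- Nonzero iff the values are equal. -/
def eq (a b : Exp) : Exp := .not (.add (.sub a b) (.sub b a))
/-- `x + 1` for the last `x < n` such that `e` is nonzero; zero if there is none. -/
def find (x : ℕ) (e : Exp) : Exp := .sup x (.ite e (.add (.var x) (.const 1)) (.const 0))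
/-- The multiple `k * e`. -/
def mulConst : ℕ → Exp → Exp
  | 0, _ => .const 0
  | k + 1, e => .add (mulConst k e) e

theorem eval_lt_ne {a b : Exp} : (lt a b).eval n m ρ ≠ 0 ↔ a.eval n m ρ < b.eval n m ρ := by
  simp only [lt, eval]; omega

theorem eval_not_ne {a : Exp} : (not a).eval n m ρ ≠ 0 ↔ ¬ a.eval n m ρ ≠ 0 := by
  simp only [not, eval]; omega

theorem eval_and_ne {a b : Exp} :
    (and a b).eval n m ρ ≠ 0 ↔ a.eval n m ρ ≠ 0 ∧ b.eval n m ρ ≠ 0 := by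
  simp only [and, eval]; split_ifs <;> tauto

theorem eval_or_ne {a b : Exp} :
    (or a b).eval n m ρ ≠ 0 ↔ a.eval n m ρ ≠ 0 ∨ b.eval n m ρ ≠ 0 := by
  simp only [or, eval]; omega

theorem eval_eq_ne {a b : Exp} : (eq a b).eval n m ρ ≠ 0 ↔ a.eval n m ρ = b.eval n m ρ := by
  simp only [eq, not, eval]; omega

theorem eval_sup_ne {x : ℕ} {e : Exp} : (sup x e).eval n m ρ ≠ 0 ↔
    ∃ i : Fin n, e.eval n m (Function.update ρ x i) ≠ 0 := by
  rw [eval, ← Nat.pos_iff_ne_zero, Finset.lt_sup_iff, Fin.exists_iff]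
  simp only [Finset.mem_range, Nat.pos_iff_ne_zero, exists_prop]

theorem eval_mulConst (k : ℕ) (e : Exp) : (mulConst k e).eval n m ρ = k * e.eval n m ρ := by
  induction k with
  | zero => simp [mulConst, eval]
  | succ k ih => rw [mulConst, eval, ih, Nat.succ_mul]

theorem find_spec (x : ℕ) (e : Exp) (n : ℕ) (m : Mem) (ρ : ℕ → ℕ) :
    ((find x e).eval n m ρ = 0 ∧ ∀ i : Fin n, ¬ e.eval n m (Function.update ρ x i) ≠ 0) ∨
      ∃ i : Fin n, (find x e).eval n m ρ = i + 1 ∧ e.eval n m (Function.update ρ x i) ≠ 0 := by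
  by_cases h : (find x e).eval n m ρ = 0
  · refine .inl ⟨h, fun i hi => ?_⟩
    refine (eval_sup_ne (n := n) (m := m) (ρ := ρ)).2 ⟨i, ?_⟩ h
    simp [eval, hi]
  · right
    have hn : (Finset.range n).Nonempty := by
      obtain ⟨i, -⟩ := eval_sup_ne.1 h
      exact ⟨i, by simp⟩
    obtain ⟨i, hi, hs⟩ := Finset.exists_mem_eq_sup _ hn fun i =>
      (Exp.ite e (.add (.var x) (.const 1)) (.const 0)).eval n m (Function.update ρ x i)
    have hf : (find x e).eval n m ρ = _ := hs
    rw [Finset.mem_range] at hi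
    have he : e.eval n m (Function.update ρ x i) ≠ 0 := by
      intro h0
      simp [eval, h0] at hf
      exact h hf
    exact ⟨⟨i, hi⟩, by rw [hf]; simp [eval, he], he⟩

theorem eval_find_ne {x : ℕ} {e : Exp} : (find x e).eval n m ρ ≠ 0 ↔
    ∃ i : Fin n, e.eval n m (Function.update ρ x i) ≠ 0 := by
  rcases find_spec x e n m ρ with ⟨h, h'⟩ | ⟨i, h, h'⟩
  · simp only [h, ne_eq, not_true, false_iff, not_exists]
    exact h'
  · exact iff_of_true (by omega) ⟨i, h'⟩

theorem eval_find_congr {x : ℕ} {e : Exp} {m' : Mem} {ρ' : ℕ → ℕ}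
    (h : ∀ i : Fin n, e.eval n m (Function.update ρ x i) ≠ 0 ↔
      e.eval n m' (Function.update ρ' x i) ≠ 0) :
    (find x e).eval n m ρ = (find x e).eval n m' ρ' := by
  refine Finset.sup_congr rfl fun i hi => ?_
  have := h ⟨i, Finset.mem_range.1 hi⟩
  simp only [eval, Function.update_self]
  exact if_congr this rfl rfl

theorem eval_sup_eq {x : ℕ} {e : Exp} : (sup x e).eval n m ρ =
    Finset.univ.sup fun i : Fin n => e.eval n m (Function.update ρ x i) := by
  rw [eval]
  refine le_antisymm (Finset.sup_le fun i hi => ?_) (Finset.sup_le fun i _ => ?_)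
  · exact Finset.le_sup (f := fun i : Fin n => e.eval n m (Function.update ρ x i))
      (Finset.mem_univ (⟨i, Finset.mem_range.1 hi⟩ : Fin n))
  · exact Finset.le_sup (f := fun i : ℕ => e.eval n m (Function.update ρ x i))
      (Finset.mem_range.2 i.isLt)

/-- Whether `x` and `y` are adjacent. -/
def adj (x y : Exp) : Exp := .load 0 (.add (.scale x) y)

/-- The label of the arc from `x` to `y` under the colouring in array `c`. -/
def arc (p c : ℕ) (x y : Exp) : Exp :=
  .ite (.lt (.load c y) (.load c x)) (.sub (.add (.load c y) (.const p)) (.load c x))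
    (.sub (.load c y) (.load c x))

end Exp

section Specs

variable {n p q : ℕ} {G : SimpleGraph (Fin n)} {m : Mem} {ρ : ℕ → ℕ}

/-- Array `0` holds the adjacency matrix. -/
def HoldsGraph (m : Mem) (G : SimpleGraph (Fin n)) : Prop :=
  ∀ u v : Fin n, m 0 (u * n + v) ≠ 0 ↔ G.Adj u v

/-- Array `c` holds the colouring `f`. -/
def HoldsColouring (m : Mem) (c : ℕ) (f : Fin n → Fin p) : Prop := ∀ v : Fin n, m c v = f v

theorem HoldsGraph.congr {m' : Mem} (h : HoldsGraph m G) (e : m' 0 = m 0) : HoldsGraph m' G := by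
  unfold HoldsGraph; rwa [e]

theorem HoldsColouring.congr {m' : Mem} {c : ℕ} {f : Fin n → Fin p} (h : HoldsColouring m c f)
    (e : m' c = m c) : HoldsColouring m' c f := by
  unfold HoldsColouring; rwa [e]

theorem Exp.eval_adj_ne (hG : HoldsGraph m G) {x y : Exp} {u v : Fin n} (hx : x.eval n m ρ = u)
    (hy : y.eval n m ρ = v) : (adj x y).eval n m ρ ≠ 0 ↔ G.Adj u v := by
  rw [← hG u v, adj, eval, eval, eval, hx, hy]

theorem Exp.eval_arc {c : ℕ} {f : Fin n → Fin p} (hf : HoldsColouring m c f) {x y : Exp}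
    {u v : Fin n} (hx : x.eval n m ρ = u) (hy : y.eval n m ρ = v) :
    (((arc p c x y).eval n m ρ : ℕ) : ℤ) = CircularColouring.arc f u v := by
  have hu := (f u).isLt
  rw [arc, eval]
  simp only [eval_lt_ne]
  simp only [eval, hx, hy, hf u, hf v]
  rcases arc_cases f u v with ⟨h, e⟩ | ⟨h, e⟩
  · rw [if_neg (by omega)]; omega
  · rw [if_pos h]; omega

end Specs

/-- Array `dst` receives the vertices from which `n` consecutive arcs of label `k` start, under
the colouring in array `c`. -/
def stuckStm (p c k dst : ℕ) : Stm :=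
  .seq (.row dst (.const 0) 0 (.const 1)) (.loop 1 (.row dst (.const 0) 0 (.sup 2
    (.and (.adj (.var 0) (.var 2)) (.and (.eq (.arc p c (.var 0) (.var 2)) (.const k))
      (.load dst (.var 2)))))))

theorem stuckStm_run {n p q c k dst : ℕ} {G : SimpleGraph (Fin n)} {f : Fin n → Fin p} {m : Mem}
    {ρ : ℕ → ℕ} {ε : ℤ} (hG : HoldsGraph m G) (hf : HoldsColouring m c f) (h0 : dst ≠ 0)
    (hc : dst ≠ c) (hk : (k : ℤ) = tightLabel p q ε) (v : Fin n) :
    (stuckStm p c k dst).run n ρ m dst v ≠ 0 ↔ Stuck G q f ε n v := by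
  have key := Stm.run_loop_induction (n := n) (x := 1) (ρ := ρ) (S := .row dst (.const 0) 0 (.sup 2
    (.and (.adj (.var 0) (.var 2)) (.and (.eq (.arc p c (.var 0) (.var 2)) (.const k))
      (.load dst (.var 2)))))) (m := (Stm.row dst (.const 0) 0 (.const 1)).run n ρ m)
    (fun i m' => (∀ v : Fin n, m' dst v ≠ 0 ↔ Stuck G q f ε i v) ∧ m' 0 = m 0 ∧ m' c = m c)
    ⟨fun v => by simp [Stm.run_row_zero, Stuck, Exp.eval],
      Stm.run_of_notMem _ (by simp [Stm.writes, h0.symm]) _ _,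
      Stm.run_of_notMem _ (by simp [Stm.writes, hc.symm]) _ _⟩
    (by
      rintro i hi m' ⟨h1, h2, h3⟩
      refine ⟨fun v => ?_, ?_, ?_⟩
      · rw [Stm.run_row_zero v.isLt, Exp.eval_sup_ne, Stuck]
        refine exists_congr fun w => ?_
        rw [Exp.eval_and_ne, Exp.eval_and_ne, Exp.eval_eq_ne,
          Exp.eval_adj_ne (hG.congr h2) (u := v) (v := w) (by simp [Exp.eval])
            (by simp [Exp.eval])]
        refine and_congr_right fun _ => and_congr ?_ ?_
        · rw [← Nat.cast_inj (R := ℤ), Exp.eval_arc (hf.congr h3) (u := v) (v := w)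
            (by simp [Exp.eval]) (by simp [Exp.eval])]
          rw [← hk]; rfl
        · rw [← h1 w]; simp [Exp.eval]
      · rw [Stm.run_of_notMem _ (by simp [Stm.writes, h0.symm]), h2]
      · rw [Stm.run_of_notMem _ (by simp [Stm.writes, hc.symm]), h3])
  exact key.1 v

end CircularColouring

namespace CircularColouring

section Table

variable {n p q : ℕ} {G : SimpleGraph (Fin n)} {f g : Fin n → Fin p}

open Classical in
/-- The entry for `L`, `u`, `v` is zero if there is no walk of length `L` from `u` to `v`, and
`1 + p * L` plus the largest gain of such a walk otherwise. -/
noncomputable def table (G : SimpleGraph (Fin n)) (f g : Fin n → Fin p) :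
    ℕ → Fin n → Fin n → ℕ
  | 0, u, v => if u = v then 1 else 0
  | L + 1, u, v => Finset.univ.sup fun w =>
      if G.Adj w v ∧ table G f g L u w ≠ 0 then
        table G f g L u w + ((p : ℤ) + arc g w v - arc f w v).toNat else 0

/-- A walk of length `L` and largest gain from `u` to `w` extends to `v`. -/
def IsPred (G : SimpleGraph (Fin n)) (f g : Fin n → Fin p) (L : ℕ) (u w v : Fin n) : Prop :=
  G.Adj w v ∧ table G f g L u w ≠ 0 ∧
    table G f g L u w + ((p : ℤ) + arc g w v - arc f w v).toNat = table G f g (L + 1) u v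

theorem arc_mem (f : Fin n → Fin p) (u v : Fin n) : 0 ≤ arc f u v ∧ arc f u v < p := by
  have h0 : (0 : ℤ) < p := by exact_mod_cast (f v).pos
  exact ⟨Int.emod_nonneg _ h0.ne', Int.emod_lt_of_pos _ h0⟩

theorem abs_gain_le {u v : Fin n} (W : G.Walk u v) : |gain f g W| ≤ p * W.length := by
  induction W with
  | nil => simp
  | @cons u v w h W ih =>
    have h1 := arc_mem f u v
    have h2 := arc_mem g u v
    rw [abs_le] at ih ⊢
    rw [gain_cons, SimpleGraph.Walk.length_cons]
    push_cast
    constructor <;> linarith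

theorem exists_isPred {L : ℕ} {u v : Fin n} (h : table G f g (L + 1) u v ≠ 0) :
    ∃ w, IsPred G f g L u w v := by
  classical
  obtain ⟨w, -, hw⟩ := Finset.exists_mem_eq_sup Finset.univ ⟨u, Finset.mem_univ u⟩ fun w =>
      if G.Adj w v ∧ table G f g L u w ≠ 0 then
        table G f g L u w + ((p : ℤ) + arc g w v - arc f w v).toNat else 0
  have hw' : table G f g (L + 1) u v = _ := hw
  by_cases hc : G.Adj w v ∧ table G f g L u w ≠ 0
  · rw [if_pos hc] at hw'
    exact ⟨w, hc.1, hc.2, hw'.symm⟩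
  · rw [if_neg hc] at hw'
    exact absurd hw' h

theorem exists_walk_of_table {L : ℕ} {u : Fin n} (c : ℕ → Fin n) (h0 : table G f g 0 u (c 0) ≠ 0)
    (hc : ∀ j < L, IsPred G f g j u (c j) (c (j + 1))) :
    ∃ W : G.Walk u (c L), W.length = L ∧ (∀ i ≤ L, W.getVert i = c i) ∧
      (table G f g L u (c L) : ℤ) = 1 + p * L + gain f g W := by
  induction L with
  | zero =>
    have hu : u = c 0 := by
      by_contra hne
      simp [table, hne] at h0
    subst hu
    refine ⟨.nil, rfl, ?_, by simp [table]⟩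
    intro i hi
    obtain rfl : i = 0 := by omega
    simp
  | succ L ih =>
    obtain ⟨W, hW, hv, ht⟩ := ih fun j hj => hc j (by omega)
    obtain ⟨h1, h2, h3⟩ := hc L (by omega)
    refine ⟨W.append (.cons h1 .nil), by simp [hW], fun i hi => ?_, ?_⟩
    · rw [SimpleGraph.Walk.getVert_append, hW]
      split_ifs with h
      · exact hv i h.le
      · rcases Nat.lt_or_ge L i with h' | h'
        · obtain rfl : i = L + 1 := by omega
          simp
        · obtain rfl : i = L := by omega
          simp
    · have a1 := arc_mem f (c L) (c (L + 1))
      have a2 := arc_mem g (c L) (c (L + 1))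
      rw [gain_append, gain_cons, gain_nil, ← h3]
      push_cast
      rw [ht, Int.toNat_of_nonneg (by omega)]
      ring

theorem exists_walk {L : ℕ} {u v : Fin n} (h : table G f g L u v ≠ 0) :
    ∃ W : G.Walk u v, W.length = L ∧ (table G f g L u v : ℤ) = 1 + p * L + gain f g W := by
  have key : ∀ L v, table G f g L u v ≠ 0 → ∃ c : ℕ → Fin n, c L = v ∧
      table G f g 0 u (c 0) ≠ 0 ∧ ∀ j < L, IsPred G f g j u (c j) (c (j + 1)) := by
    intro L
    induction L with
    | zero => exact fun v h => ⟨fun _ => v, rfl, h, fun j hj => absurd hj (by omega)⟩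
    | succ L ih =>
      intro v h
      obtain ⟨w, hw⟩ := exists_isPred h
      obtain ⟨c, hc, h0, hp⟩ := ih w hw.2.1
      refine ⟨fun i => if i ≤ L then c i else v, by simp, by simpa using h0, fun j hj => ?_⟩
      rcases Nat.lt_or_ge j L with h' | h'
      · simpa [h'.le, Nat.succ_le_of_lt h'] using hp j h'
      · obtain rfl : j = L := by omega
        simpa [hc] using hw
  obtain ⟨c, rfl, h0, hp⟩ := key L v h
  obtain ⟨W, h1, -, h2⟩ := exists_walk_of_table c h0 hp
  exact ⟨W, h1, h2⟩

theorem le_table {L : ℕ} {u v : Fin n} (W : G.Walk u v) (hW : W.length = L) :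
    1 + p * L + gain f g W ≤ (table G f g L u v : ℤ) := by
  classical
  induction L generalizing v with
  | zero =>
    cases W with
    | nil => simp [table]
    | cons h W => simp at hW
  | succ L ih =>
    cases W with
    | nil => simp at hW
    | @cons _ x _ h W =>
      obtain ⟨w, W', h', e⟩ := SimpleGraph.Walk.exists_cons_eq_concat h W
      rw [e] at hW ⊢
      rw [SimpleGraph.Walk.length_concat] at hW
      have h1 := ih W' (by omega)
      have h2 := (abs_le.1 (abs_gain_le (f := f) (g := g) W')).1
      have h3 : W'.length = L := by omega
      rw [h3] at h2
      have a1 := arc_mem f w v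
      have a2 := arc_mem g w v
      have h4 : table G f g L u w ≠ 0 := by omega
      have h5 := Finset.le_sup (f := fun w =>
        if G.Adj w v ∧ table G f g L u w ≠ 0 then
          table G f g L u w + ((p : ℤ) + arc g w v - arc f w v).toNat else 0) (Finset.mem_univ w)
      rw [if_pos ⟨h', h4⟩] at h5
      have h6 : table G f g L u w + ((p : ℤ) + arc g w v - arc f w v).toNat ≤
        table G f g (L + 1) u v := h5
      rw [SimpleGraph.Walk.concat_eq_append, gain_append, gain_cons, gain_nil]
      zify at h6
      rw [Int.toNat_of_nonneg (by omega)] at h6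
      push_cast
      linarith

theorem table_ne_zero_iff {L : ℕ} {u v : Fin n} :
    table G f g L u v ≠ 0 ↔ ∃ W : G.Walk u v, W.length = L := by
  constructor
  · intro h
    obtain ⟨W, hW, -⟩ := exists_walk h
    exact ⟨W, hW⟩
  · rintro ⟨W, hW⟩
    have h1 := le_table (f := f) (g := g) W hW
    have h2 := (abs_le.1 (abs_gain_le (f := f) (g := g) W)).1
    rw [hW] at h2
    omega

/-- There is a walk of length `L` and positive gain that is closed or joins two vertices
satisfying `F`. -/
def BadPair (G : SimpleGraph (Fin n)) (f g : Fin n → Fin p) (F : Fin n → Prop) (L : ℕ)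
    (u v : Fin n) : Prop :=
  (u = v ∨ F u ∧ F v) ∧ 1 + p * L < table G f g L u v

theorem exists_badPair (hq : 0 < q) (hf : IsColouring G q f) (hg : IsColouring G q g)
    {F : Fin n → Prop} {u v : Fin n} (W : G.Walk u v) (huv : u = v ∨ F u ∧ F v)
    (hW : gain f g W ≠ 0) : 0 < W.length ∧ ∃ u' v', BadPair G f g F W.length u' v' := by
  constructor
  · by_contra h0
    have := (abs_le.1 (abs_gain_le (f := f) (g := g) W))
    rw [show W.length = 0 by omega] at this
    simp at this
    omega
  · rcases lt_or_gt_of_ne hW with h | h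
    · refine ⟨v, u, by tauto, ?_⟩
      have := le_table (f := f) (g := g) W.reverse (SimpleGraph.Walk.length_reverse W)
      rw [gain_reverse hq hf hg] at this
      zify
      omega
    · refine ⟨u, v, huv, ?_⟩
      have := le_table (f := f) (g := g) W rfl
      zify
      omega

theorem gain_of_minimal (hq : 0 < q) (hf : IsColouring G q f) (hg : IsColouring G q g)
    {F : Fin n → Prop} {L : ℕ}
    (hmin : ∀ l, 0 < l → l < L → ∀ u v, ¬ BadPair G f g F l u v)
    {u v : Fin n} (W : G.Walk u v) (huv : u = v ∨ F u ∧ F v) (hW : W.length < L) :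
    gain f g W = 0 := by
  by_contra hne
  obtain ⟨h0, u', v', h⟩ := exists_badPair hq hf hg W huv hne
  exact hmin _ h0 hW u' v' h

theorem cycle_length_le {u : Fin n} {C : G.Walk u u} (hC : C.IsCycle) : C.length ≤ n := by
  have h := hC.support_nodup.length_le_card
  simpa using h

theorem gain_of_no_badPair (hq : 0 < q) (hf : IsColouring G q f) (hg : IsColouring G q g)
    {F : Fin n → Prop} (hno : ∀ l, 0 < l → l ≤ n → ∀ u v, ¬ BadPair G f g F l u v) :
    (∀ (u : Fin n) (C : G.Walk u u), gain f g C = 0) ∧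
      ∀ (u v : Fin n) (W : G.Walk u v), F u → F v → gain f g W = 0 := by
  classical
  have hmin : ∀ l, 0 < l → l < n + 1 → ∀ u v, ¬ BadPair G f g F l u v :=
    fun l h0 hl => hno l h0 (by omega)
  have hC : ∀ (u : Fin n) (C : G.Walk u u), gain f g C = 0 := fun u C =>
    gain_closed hq hf hg (fun u C hC => gain_of_minimal hq hf hg hmin C (.inl rfl)
      (by have := cycle_length_le hC; omega)) C
  refine ⟨hC, fun u v W hu hv => ?_⟩
  rw [gain_unique hq hf hg hC W W.bypass]
  refine gain_of_minimal hq hf hg hmin _ (.inr ⟨hu, hv⟩) ?_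
  have := W.bypass_isPath.length_lt
  simp at this
  omega

end Table

end CircularColouring

namespace CircularColouring

namespace Exp

/-- The entry of the table of gains for walks of length `L` from `u` to `v`. -/
def entry (L u v : Exp) : Exp := .load 9 (.add (.scale (.add (.scale L) u)) v)

/-- The contribution of the arc from `x` to `y` to the table of gains. -/
def stepGain (p : ℕ) (x y : Exp) : Exp := .sub (.add (.const p) (.arc p 2 x y)) (.arc p 1 x y)

/-- Whether `x` is blocked in both directions under the first colouring. -/
def fixed (x : Exp) : Exp := .and (.load 4 x) (.load 5 x)

/-- Whether there is a bad pair `x`, `y` for walks of length `L`. -/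
def badPair (p : ℕ) (L x y : Exp) : Exp :=
  .and (.or (.eq x y) (.and (.fixed x) (.fixed y)))
    (.lt (.add (.const 1) (.mulConst p L)) (.entry L x y))

/-- Whether there is any bad pair for walks of length `L`. -/
def anyBadPair (p : ℕ) (L : Exp) : Exp := .sup 0 (.sup 1 (.badPair p L (.var 0) (.var 1)))

end Exp

/-- Computes the table of gains. -/
def tableStm (p : ℕ) : Stm :=
  .seq (.loop 0 (.row 9 (.var 0) 1 (.ite (.eq (.var 0) (.var 1)) (.const 1) (.const 0))))
    (.loop 2 (.loop 0 (.row 9 (.add (.scale (.add (.var 2) (.const 1))) (.var 0)) 1 (.sup 3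
      (.ite (.and (.adj (.var 3) (.var 1)) (.entry (.var 2) (.var 0) (.var 3)))
        (.add (.entry (.var 2) (.var 0) (.var 3)) (.stepGain p (.var 3) (.var 1)))
        (.const 0))))))

/-- Searches for the least length of a bad pair. -/
def searchStm (p : ℕ) : Stm :=
  .put 11 (.const 0) (.find 2 (.and (.anyBadPair p (.add (.var 2) (.const 1)))
    (.not (.sup 3 (.and (.lt (.var 3) (.var 2)) (.anyBadPair p (.add (.var 3) (.const 1))))))))

/-- One step of the construction of a walk from its end. -/
def traceStm (p : ℕ) : Stm :=
  .ite (.lt (.var 4) (.load 11 (.const 0)))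
    (.put 3 (.sub (.sub (.load 11 (.const 0)) (.var 4)) (.const 1))
      (.sub (.find 0 (.and
        (.adj (.var 0) (.load 3 (.sub (.load 11 (.const 0)) (.var 4)))) (.and
        (.entry (.sub (.sub (.load 11 (.const 0)) (.var 4)) (.const 1))
          (.load 11 (.const 1)) (.var 0))
        (.eq (.add (.entry (.sub (.sub (.load 11 (.const 0)) (.var 4)) (.const 1))
            (.load 11 (.const 1)) (.var 0))
            (.stepGain p (.var 0) (.load 3 (.sub (.load 11 (.const 0)) (.var 4)))))
          (.entry (.sub (.load 11 (.const 0)) (.var 4)) (.load 11 (.const 1))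
            (.load 3 (.sub (.load 11 (.const 0)) (.var 4)))))))) (.const 1)))
    .skip

/-- Selects a bad pair for walks of the length found. -/
def selectStm (p : ℕ) : Stm :=
  .seq (.put 11 (.const 1) (.sub (.find 0 (.sup 1
    (.badPair p (.load 11 (.const 0)) (.var 0) (.var 1)))) (.const 1)))
  (.put 11 (.const 2) (.sub (.find 1
    (.badPair p (.load 11 (.const 0)) (.load 11 (.const 1)) (.var 1))) (.const 1)))

/-- Outputs a walk of nonzero gain. -/
def walkStm (p : ℕ) : Stm :=
  .seq (selectStm p) (.seq (.put 3 (.load 11 (.const 0)) (.load 11 (.const 2)))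
  (.seq (.loop 4 (traceStm p))
  (.seq (.put 10 (.const 0) (.ite (.eq (.load 11 (.const 1)) (.load 11 (.const 2)))
    (.const 2) (.const 3)))
  (.put 10 (.const 1) (.load 11 (.const 0))))))

section Specs

variable {n p q : ℕ} {G : SimpleGraph (Fin n)} {f g : Fin n → Fin p} {F : Fin n → Prop}
  {m m' : Mem} {ρ : ℕ → ℕ}

/-- The memory holds the instance `(G, f, g)`. -/
structure HoldsInstance (m : Mem) (G : SimpleGraph (Fin n)) (f g : Fin n → Fin p) : Prop where
  graph : HoldsGraph m G
  left : HoldsColouring m 1 f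
  right : HoldsColouring m 2 g

theorem HoldsInstance.congr (h : HoldsInstance m G f g) (h0 : m' 0 = m 0) (h1 : m' 1 = m 1)
    (h2 : m' 2 = m 2) : HoldsInstance m' G f g :=
  ⟨h.graph.congr h0, h.left.congr h1, h.right.congr h2⟩

/-- Array `9` holds the table of gains. -/
def HoldsTable (m : Mem) (G : SimpleGraph (Fin n)) (f g : Fin n → Fin p) : Prop :=
  ∀ L ≤ n, ∀ u v : Fin n, m 9 ((L * n + u) * n + v) = table G f g L u v

/-- Arrays `4` and `5` tell which vertices satisfy `F`. -/
def HoldsFixed (m : Mem) (F : Fin n → Prop) : Prop :=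
  ∀ v : Fin n, m 4 v ≠ 0 ∧ m 5 v ≠ 0 ↔ F v

theorem HoldsTable.congr (h : HoldsTable m G f g) (e : m' 9 = m 9) : HoldsTable m' G f g := by
  unfold HoldsTable; rwa [e]

theorem HoldsFixed.congr (h : HoldsFixed m F) (h4 : m' 4 = m 4) (h5 : m' 5 = m 5) :
    HoldsFixed m' F := by
  unfold HoldsFixed; rwa [h4, h5]

theorem Exp.eval_stepGain (h : HoldsInstance m G f g) {x y : Exp} {u v : Fin n}
    (hx : x.eval n m ρ = u) (hy : y.eval n m ρ = v) :
    (stepGain p x y).eval n m ρ =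
      ((p : ℤ) + CircularColouring.arc g u v - CircularColouring.arc f u v).toNat := by
  have h1 := Exp.eval_arc h.left hx hy
  have h2 := Exp.eval_arc h.right hx hy
  rw [← h1, ← h2, stepGain, eval, eval, eval]
  omega

theorem Exp.eval_fixed_ne (h : HoldsFixed m F) {x : Exp} {u : Fin n} (hx : x.eval n m ρ = u) :
    (fixed x).eval n m ρ ≠ 0 ↔ F u := by
  rw [fixed, eval_and_ne, eval, eval, hx, h]

theorem Exp.eval_add {a b : Exp} :
    (add a b).eval n m ρ = a.eval n m ρ + b.eval n m ρ := rfl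

theorem Exp.eval_entry {L x y : Exp} : (entry L x y).eval n m ρ =
    m 9 ((L.eval n m ρ * n + x.eval n m ρ) * n + y.eval n m ρ) := rfl

theorem Exp.eval_badPair_ne (hF : HoldsFixed m F) (hT : HoldsTable m G f g) {L x y : Exp} {l : ℕ}
    {u v : Fin n} (hL : L.eval n m ρ = l) (hl : l ≤ n) (hx : x.eval n m ρ = u)
    (hy : y.eval n m ρ = v) : (badPair p L x y).eval n m ρ ≠ 0 ↔ BadPair G f g F l u v := by
  rw [badPair, eval_and_ne, eval_or_ne, eval_eq_ne, eval_and_ne, eval_fixed_ne hF hx,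
    eval_fixed_ne hF hy, eval_lt_ne, eval_entry, eval, eval, eval_mulConst, hL, hx, hy,
    hT l hl u v, BadPair, Fin.ext_iff]

theorem Exp.eval_anyBadPair_ne (hF : HoldsFixed m F) (hT : HoldsTable m G f g) {L : Exp} {l : ℕ}
    (hL : ∀ i j, L.eval n m (Function.update (Function.update ρ 0 i) 1 j) = l) (hl : l ≤ n) :
    (anyBadPair p L).eval n m ρ ≠ 0 ↔ ∃ u v, BadPair G f g F l u v := by
  rw [anyBadPair, eval_sup_ne]
  refine exists_congr fun u => ?_
  rw [eval_sup_ne]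
  exact exists_congr fun v => eval_badPair_ne hF hT (hL _ _) hl (by simp [eval]) (by simp [eval])

theorem tableStm_run (h : HoldsInstance m G f g) :
    HoldsTable ((tableStm p).run n ρ m) G f g := by
  classical
  rw [tableStm, Stm.run]
  set m₁ := (Stm.loop 0 (.row 9 (.var 0) 1 (.ite (.eq (.var 0) (.var 1)) (.const 1)
    (.const 0)))).run n ρ m with hm₁
  have e₁ : ∀ a, a ≠ 9 → m₁ a = m a := fun a ha =>
    Stm.run_of_notMem _ (by simpa [Stm.writes] using ha) _ _
  have h₁ : ∀ u v : Fin n, m₁ 9 (u * n + v) = table G f g 0 u v := by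
    have := Stm.run_loop_induction (n := n) (x := 0) (ρ := ρ) (m := m)
      (S := .row 9 (.var 0) 1 (.ite (.eq (.var 0) (.var 1)) (.const 1) (.const 0)))
      (fun i m' => ∀ u v : Fin n, (u : ℕ) < i → m' 9 (u * n + v) = table G f g 0 u v)
      (fun u v hu => absurd hu (by omega))
      (by
        intro i hi m' hm' u v hu
        rw [Stm.run_row v.isLt]
        split_ifs with hui
        · simp only [Exp.eval, Exp.eval_eq_ne, Function.update_self, Function.update_apply] at hui ⊢
          simp [← hui, table, Fin.ext_iff]
        · refine hm' u v ?_
          simp only [Exp.eval, Function.update_self] at hui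
          omega)
    exact fun u v => this u v u.isLt
  have key := Stm.run_loop_induction (n := n) (x := 2) (ρ := ρ) (m := m₁)
    (S := .loop 0 (.row 9 (.add (.scale (.add (.var 2) (.const 1))) (.var 0)) 1 (.sup 3
      (.ite (.and (.adj (.var 3) (.var 1)) (.entry (.var 2) (.var 0) (.var 3)))
        (.add (.entry (.var 2) (.var 0) (.var 3)) (.stepGain p (.var 3) (.var 1)))
        (.const 0)))))
    (fun i m' => (∀ L ≤ i, ∀ u v : Fin n, m' 9 ((L * n + u) * n + v) = table G f g L u v) ∧
      ∀ a, a ≠ 9 → m' a = m a)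
    ⟨fun L hL u v => by
      obtain rfl : L = 0 := by omega
      simpa using h₁ u v, e₁⟩
    (by
      rintro i hi m₂ ⟨ht, he⟩
      have := Stm.run_loop_induction (n := n) (x := 0) (ρ := Function.update ρ 2 i) (m := m₂)
        (S := .row 9 (.add (.scale (.add (.var 2) (.const 1))) (.var 0)) 1 (.sup 3
          (.ite (.and (.adj (.var 3) (.var 1)) (.entry (.var 2) (.var 0) (.var 3)))
            (.add (.entry (.var 2) (.var 0) (.var 3)) (.stepGain p (.var 3) (.var 1)))
            (.const 0))))
        (fun k m' => (∀ L ≤ i, ∀ u v : Fin n, m' 9 ((L * n + u) * n + v) = table G f g L u v) ∧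
          (∀ u v : Fin n, (u : ℕ) < k →
            m' 9 (((i + 1) * n + u) * n + v) = table G f g (i + 1) u v) ∧
          ∀ a, a ≠ 9 → m' a = m a)
        ⟨ht, fun u v hu => absurd hu (by omega), he⟩
        (by
          rintro k hk m₃ ⟨ht, hs, he⟩
          refine ⟨fun L hL u v => ?_, fun u v hu => ?_, fun a ha => ?_⟩
          · rw [Stm.run_row v.isLt, if_neg, ht L hL]
            simp only [Exp.eval, Function.update_self, Function.update_apply]
            simp only [OfNat.ofNat_ne_zero, if_false]
            rw [mul_add_inj u.isLt hk]
            omega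
          · rw [Stm.run_row v.isLt]
            split_ifs with hui
            · have huk : (u : ℕ) = k := by
                simp only [Exp.eval, Function.update_self, Function.update_apply] at hui
                simp only [OfNat.ofNat_ne_zero, if_false] at hui
                simpa [mul_add_inj u.isLt hk] using hui
              rw [Exp.eval_sup_eq, table]
              refine Finset.sup_congr rfl fun w _ => ?_
              have hinst : HoldsInstance m₃ G f g :=
                h.congr (he 0 (by omega)) (he 1 (by omega)) (he 2 (by omega))
              have : (Exp.entry (.var 2) (.var 0) (.var 3)).eval n m₃
                  (Function.update (Function.update (Function.update (Function.update ρ 2 i) 0 k)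
                    1 v) 3 w) = table G f g i u w := by
                rw [Exp.eval_entry, ← ht i le_rfl u w, huk]
                simp [Exp.eval]
              rw [Exp.eval]
              refine if_congr ?_ ?_ rfl
              · rw [Exp.eval_and_ne, Exp.eval_adj_ne (u := w) (v := v) hinst.graph
                  (by simp [Exp.eval]) (by simp [Exp.eval]), this]
              · rw [Exp.eval, this, Exp.eval_stepGain (u := w) (v := v) hinst
                  (by simp [Exp.eval]) (by simp [Exp.eval])]
            · refine hs u v ?_
              have : (u : ℕ) ≠ k := by
                rintro huk
                apply hui
                simp [Exp.eval, huk]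
              omega
          · rw [Stm.run_of_notMem _ (by simpa [Stm.writes] using ha), he a ha])
      refine ⟨fun L hL u v => ?_, this.2.2⟩
      rcases Nat.lt_or_ge i L with h' | h'
      · obtain rfl : L = i + 1 := by omega
        exact this.2.1 u v u.isLt
      · exact this.1 L h' u v)
  exact key.1

theorem searchStm_run (hF : HoldsFixed m F) (hT : HoldsTable m G f g) :
    ((searchStm p).run n ρ m 11 0 = 0 ∧ ∀ l, 0 < l → l ≤ n → ∀ u v, ¬ BadPair G f g F l u v) ∨
    ∃ L, (searchStm p).run n ρ m 11 0 = L ∧ 0 < L ∧ L ≤ n ∧ (∃ u v, BadPair G f g F L u v) ∧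
      ∀ l, 0 < l → l < L → ∀ u v, ¬ BadPair G f g F l u v := by
  set e : Exp := .and (.anyBadPair p (.add (.var 2) (.const 1)))
    (.not (.sup 3 (.and (.lt (.var 3) (.var 2)) (.anyBadPair p (.add (.var 3) (.const 1)))))) with he
  have hrun : (searchStm p).run n ρ m 11 0 = (Exp.find 2 e).eval n m ρ := by
    simp [searchStm, Stm.run, Exp.eval, he]
  have heval : ∀ x : Fin n, e.eval n m (Function.update ρ 2 x) ≠ 0 ↔
      (∃ u v, BadPair G f g F (x + 1) u v) ∧
        ¬ ∃ y : Fin n, (y : ℕ) < x ∧ ∃ u v, BadPair G f g F (y + 1) u v := by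
    intro x
    rw [he, Exp.eval_and_ne, Exp.eval_not_ne, Exp.eval_sup_ne,
      Exp.eval_anyBadPair_ne (l := x + 1) hF hT (fun i j => by simp [Exp.eval]) x.isLt]
    refine and_congr_right fun _ => not_congr <| exists_congr fun y => ?_
    rw [Exp.eval_and_ne, Exp.eval_lt_ne,
      Exp.eval_anyBadPair_ne (l := y + 1) hF hT (fun i j => by simp [Exp.eval]) y.isLt]
    simp [Exp.eval]
  rw [hrun]
  rcases Exp.find_spec 2 e n m ρ with ⟨h0, h⟩ | ⟨x, hx, h⟩
  · left
    refine ⟨h0, fun l hl0 hl => ?_⟩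
    have key : ∀ x : ℕ, ∀ hx : x < n, ¬ ∃ u v, BadPair G f g F (x + 1) u v := by
      intro x
      induction x using Nat.strong_induction_on with
      | _ x ih =>
        intro hx hbad
        exact h ⟨x, hx⟩ ((heval ⟨x, hx⟩).2 ⟨hbad, fun ⟨y, hy, hy'⟩ => ih y hy y.isLt hy'⟩)
    obtain ⟨l, rfl⟩ : ∃ k, l = k + 1 := ⟨l - 1, by omega⟩
    simpa using key l (by omega)
  · right
    obtain ⟨h1, h2⟩ := (heval x).1 h
    refine ⟨x + 1, hx, by omega, x.isLt, h1, fun l hl0 hl u v hbad => h2 ?_⟩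
    obtain ⟨l, rfl⟩ : ∃ k, l = k + 1 := ⟨l - 1, by omega⟩
    exact ⟨⟨l, by omega⟩, by simpa using hl, u, v, hbad⟩

theorem selectStm_run (hF : HoldsFixed m F) (hT : HoldsTable m G f g) {L : ℕ} (hL : m 11 0 = L)
    (hLn : L ≤ n) (hbad : ∃ u v, BadPair G f g F L u v) :
    ∃ u v, BadPair G f g F L u v ∧ (selectStm p).run n ρ m 11 0 = L ∧
      (selectStm p).run n ρ m 11 1 = u ∧ (selectStm p).run n ρ m 11 2 = v := by
  rw [selectStm, Stm.run]
  set m₁ := (Stm.put 11 (.const 1) (.sub (.find 0 (.sup 1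
    (.badPair p (.load 11 (.const 0)) (.var 0) (.var 1)))) (.const 1))).run n ρ m with hm₁
  obtain ⟨u, hu, hbu⟩ : ∃ u : Fin n, m₁ 11 1 = u ∧ ∃ v, BadPair G f g F L u v := by
    rcases Exp.find_spec 0 (.sup 1 (.badPair p (.load 11 (.const 0)) (.var 0) (.var 1))) n m ρ with
      ⟨h0, h⟩ | ⟨u, hu, h⟩
    · obtain ⟨u, v, hb⟩ := hbad
      refine absurd ?_ (h u)
      rw [Exp.eval_sup_ne]
      exact ⟨v, (Exp.eval_badPair_ne hF hT (by simpa [Exp.eval] using hL) hLn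
        (by simp [Exp.eval]) (by simp [Exp.eval])).2 hb⟩
    · refine ⟨u, by simp [hm₁, Stm.run, Exp.eval]; rw [hu, Nat.add_sub_cancel], ?_⟩
      obtain ⟨v, hv⟩ := Exp.eval_sup_ne.1 h
      exact ⟨v, (Exp.eval_badPair_ne hF hT (by simpa [Exp.eval] using hL) hLn
        (by simp [Exp.eval]) (by simp [Exp.eval])).1 hv⟩
  have e₁ : ∀ a, a ≠ 11 → m₁ a = m a := fun a ha =>
    Stm.run_of_notMem _ (by simpa [Stm.writes] using ha) _ _
  have hL₁ : m₁ 11 0 = L := by simp [hm₁, Stm.run, Exp.eval, hL]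
  have hF₁ := hF.congr (e₁ 4 (by omega)) (e₁ 5 (by omega))
  have hT₁ := hT.congr (e₁ 9 (by omega))
  clear_value m₁
  rcases Exp.find_spec 1 (.badPair p (.load 11 (.const 0)) (.load 11 (.const 1)) (.var 1)) n m₁ ρ
    with ⟨h0, h⟩ | ⟨v, hv, h⟩
  · obtain ⟨v, hb⟩ := hbu
    exact absurd ((Exp.eval_badPair_ne hF₁ hT₁ (by simpa [Exp.eval] using hL₁) hLn
      (by simpa [Exp.eval] using hu) (by simp [Exp.eval])).2 hb) (h v)
  · refine ⟨u, v, (Exp.eval_badPair_ne hF₁ hT₁ (by simpa [Exp.eval] using hL₁) hLn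
      (by simpa [Exp.eval] using hu) (by simp [Exp.eval])).1 h, ?_, ?_, ?_⟩
    · simp [Stm.run, Exp.eval, hL₁]
    · simp [Stm.run, Exp.eval, hu]
    · simp [Stm.run, Exp.eval]
      rw [hv, Nat.add_sub_cancel]

/-- The memory holds the last arcs, from position `k` on, of a walk of largest gain. -/
def HoldsTail (m : Mem) (G : SimpleGraph (Fin n)) (f g : Fin n → Fin p) (L : ℕ) (u v : Fin n)
    (k : ℕ) : Prop :=
  ∃ c : ℕ → Fin n, c L = v ∧ (∀ j, k ≤ j → j ≤ L → m 3 j = c j) ∧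
    (∀ j, k ≤ j → j < L → IsPred G f g j u (c j) (c (j + 1))) ∧ table G f g k u (c k) ≠ 0

theorem traceStm_run (h : HoldsInstance m G f g) (hT : HoldsTable m G f g) {L : ℕ} {u v : Fin n}
    (hL : m 11 0 = L) (hLn : L ≤ n) (hu : m 11 1 = u) {i : ℕ} (hi : ρ 4 = i)
    (ht : HoldsTail m G f g L u v (L - i)) :
    HoldsTail ((traceStm p).run n ρ m) G f g L u v (L - (i + 1)) := by
  rw [traceStm, Stm.run]
  simp only [Exp.eval_lt_ne]
  by_cases hiL : i < L
  · rw [if_pos (by simpa [Exp.eval, hi, hL] using hiL)]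
    obtain ⟨c, hc, hm, hp, h0⟩ := ht
    obtain ⟨k, hk⟩ : ∃ k, L - i = k + 1 := ⟨L - i - 1, by omega⟩
    have hk' : L - (i + 1) = k := by omega
    rw [hk] at hm hp h0
    rw [hk']
    obtain ⟨w, hw⟩ := exists_isPred h0
    have hmk := hm (k + 1) le_rfl (by omega)
    generalize he : Exp.and (.adj (.var 0) (.load 3 (.sub (.load 11 (.const 0)) (.var 4)))) (.and
        (.entry (.sub (.sub (.load 11 (.const 0)) (.var 4)) (.const 1))
          (.load 11 (.const 1)) (.var 0))
        (.eq (.add (.entry (.sub (.sub (.load 11 (.const 0)) (.var 4)) (.const 1))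
            (.load 11 (.const 1)) (.var 0))
            (.stepGain p (.var 0) (.load 3 (.sub (.load 11 (.const 0)) (.var 4)))))
          (.entry (.sub (.load 11 (.const 0)) (.var 4)) (.load 11 (.const 1))
            (.load 3 (.sub (.load 11 (.const 0)) (.var 4)))))) = e
    have heval : ∀ x : Fin n, e.eval n m (Function.update ρ 0 x) ≠ 0 ↔
        IsPred G f g k u x (c (k + 1)) := by
      intro x
      have e1 : (Exp.load 3 (.sub (.load 11 (.const 0)) (.var 4))).eval n m
          (Function.update ρ 0 x) = c (k + 1) := by
        simp [Exp.eval, hi, hL, hk, hmk]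
      rw [← he, Exp.eval_and_ne, Exp.eval_and_ne, Exp.eval_eq_ne,
        Exp.eval_adj_ne (u := x) h.graph (by simp [Exp.eval]) e1, Exp.eval_add,
        Exp.eval_entry, Exp.eval_stepGain (u := x) h (by simp [Exp.eval]) e1, Exp.eval_entry, e1,
        IsPred, ← hT k (by omega) u x, ← hT (k + 1) (by omega) u (c (k + 1))]
      simp [Exp.eval, hi, hL, hk, hu]
    obtain ⟨x, hx, hxp⟩ : ∃ x : Fin n, (Exp.find 0 e).eval n m ρ = x + 1 ∧
        IsPred G f g k u x (c (k + 1)) := by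
      rcases Exp.find_spec 0 e n m ρ with ⟨-, h'⟩ | ⟨x, hx, h'⟩
      · exact absurd ((heval w).2 hw) (h' w)
      · exact ⟨x, hx, (heval x).1 h'⟩
    refine ⟨Function.update c k x, ?_, fun j hj hjL => ?_, fun j hj hjL => ?_, ?_⟩
    · rw [Function.update_of_ne (by omega), hc]
    · by_cases hjk : j = k
      · subst hjk
        simp [Stm.run, Exp.eval, hi, hL, hk, hx]
      · have := hm j (by omega) hjL
        simp [Stm.run, Exp.eval, hi, hL, hk, hjk, this]
    · rw [Function.update_of_ne (by omega : j + 1 ≠ k)]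
      by_cases hjk : j = k
      · subst hjk
        rwa [Function.update_self]
      · rw [Function.update_of_ne hjk]
        exact hp j (by omega) hjL
    · rw [Function.update_self]
      exact hxp.2.1
  · rw [if_neg (by simpa [Exp.eval, hi, hL] using hiL), Stm.run]
    rwa [show L - (i + 1) = L - i by omega]

theorem walkStm_run (h : HoldsInstance m G f g) (hF : HoldsFixed m F) (hT : HoldsTable m G f g)
    {L : ℕ} (hL : m 11 0 = L) (hLn : L ≤ n) (hbad : ∃ u v, BadPair G f g F L u v) :
    ∃ (u v : Fin n) (W : G.Walk u v), (u = v ∨ F u ∧ F v) ∧ W.length = L ∧ gain f g W ≠ 0 ∧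
      (walkStm p).run n ρ m 10 0 = (if u = v then 2 else 3) ∧
      (walkStm p).run n ρ m 10 1 = L ∧
      ∀ i ≤ L, (walkStm p).run n ρ m 3 i = (W.getVert i : ℕ) := by
  obtain ⟨u, v, hb, hL', hu, hv⟩ := selectStm_run (p := p) (ρ := ρ) hF hT hL hLn hbad
  rw [walkStm, Stm.run]
  have e₁ : ∀ a, a ≠ 11 → (selectStm p).run n ρ m a = m a := fun a ha =>
    Stm.run_of_notMem _ (by simpa [selectStm, Stm.writes] using ha) _ _
  generalize (selectStm p).run n ρ m = m₁ at *
  rw [Stm.run]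
  generalize hm₂ : (Stm.put 3 (.load 11 (.const 0)) (.load 11 (.const 2))).run n ρ m₁ = m₂
  have e₂ : ∀ a, a ≠ 3 → m₂ a = m₁ a := fun a ha => by
    rw [← hm₂]; exact Stm.run_of_notMem _ (by simpa [Stm.writes] using ha) _ _
  have hv₂ : m₂ 3 L = v := by rw [← hm₂]; simp [Stm.run, Exp.eval, hL', hv]
  rw [Stm.run]
  obtain ⟨⟨c, hc, hm, hp, h0⟩, e₃⟩ := Stm.run_loop_induction (n := n) (x := 4) (ρ := ρ) (m := m₂)
    (S := traceStm p)
    (fun i m' => HoldsTail m' G f g L u v (L - i) ∧ ∀ a, a ≠ 3 → m' a = m₁ a)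
    ⟨by
      refine ⟨fun _ => v, rfl, fun j hj hj' => ?_, fun j hj hj' => absurd hj (by omega), ?_⟩
      · obtain rfl : j = L := by omega
        exact hv₂
      · have := hb.2
        change table G f g L u v ≠ 0
        omega, e₂⟩
    (by
      rintro i hi m' ⟨h1, h2⟩
      refine ⟨traceStm_run (v := v)
        (h.congr ((h2 0 (by omega)).trans (e₁ 0 (by omega)))
          ((h2 1 (by omega)).trans (e₁ 1 (by omega))) ((h2 2 (by omega)).trans (e₁ 2 (by omega))))
        (hT.congr ((h2 9 (by omega)).trans (e₁ 9 (by omega))))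
        (by rw [h2 11 (by omega), hL']) hLn (by rw [h2 11 (by omega), hu]) (by simp) h1,
        fun a ha => ?_⟩
      rw [Stm.run_of_notMem _ (by simpa [traceStm, Stm.writes] using ha), h2 a ha])
  generalize (Stm.loop 4 (traceStm p)).run n ρ m₂ = m₃ at *
  rw [show L - n = 0 by omega] at hm hp h0
  obtain ⟨W, hW, hvert, htab⟩ := exists_walk_of_table c h0 fun j hj => hp j (by omega) hj
  subst hc
  obtain ⟨hb1, hb2⟩ := hb
  refine ⟨u, c L, W, hb1, hW, ?_, ?_, ?_, fun i hi => ?_⟩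
  · zify at hb2
    omega
  · have := e₃ 11 (by omega)
    simp only [Stm.run, Exp.eval, Exp.eval_eq_ne, Function.update_self, Function.update_apply,
      this, hu, hv]
    simp [Fin.ext_iff]
  · have := e₃ 11 (by omega)
    simp [Stm.run, Exp.eval, this, hL']
  · rw [hvert i hi, ← hm i (by omega) hi]
    simp [Stm.run]

end Specs

end CircularColouring

namespace CircularColouring

/-- Whether there is a walk of length less than `n` from `x` to `y`. -/
def Exp.connected (x y : Exp) : Exp := .sup 3 (.entry (.var 3) x y)

/-- Array `15` receives the root of the component of each vertex (a fixed vertex if there is one),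
array `16` the length of a walk from the root. -/
def rootStm : Stm :=
  .seq (.row 15 (.const 0) 1 (.sub (.ite
      (.find 0 (.and (.fixed (.var 0)) (.connected (.var 0) (.var 1))))
      (.find 0 (.and (.fixed (.var 0)) (.connected (.var 0) (.var 1))))
      (.find 0 (.connected (.var 0) (.var 1)))) (.const 1)))
    (.row 16 (.const 0) 1
      (.sub (.find 3 (.entry (.var 3) (.load 15 (.var 1)) (.var 1))) (.const 1)))

/-- Arrays `12` and `13` receive the positive and the negative part of the shift from the first
colouring to the second. -/
def shiftStm (p : ℕ) : Stm :=
  .seq (.row 12 (.const 0) 1 (.sub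
      (.add (.load 2 (.load 15 (.var 1))) (.entry (.load 16 (.var 1)) (.load 15 (.var 1)) (.var 1)))
      (.add (.load 1 (.load 15 (.var 1))) (.add (.const 1) (.mulConst p (.load 16 (.var 1)))))))
    (.row 13 (.const 0) 1 (.sub
      (.add (.load 1 (.load 15 (.var 1))) (.add (.const 1) (.mulConst p (.load 16 (.var 1)))))
      (.add (.load 2 (.load 15 (.var 1)))
        (.entry (.load 16 (.var 1)) (.load 15 (.var 1)) (.var 1)))))

/-- The current colouring starts as the first one, and is the first member of the output. -/
def startStm : Stm :=
  .seq (.row 14 (.const 0) 1 (.load 1 (.var 1))) (.seq (.row 3 (.const 0) 1 (.load 1 (.var 1)))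
    (.put 10 (.const 1) (.const 0)))

/-- Gives the colour `e` to the vertex selected in cell `d` of array `17`, decreases the distance
in array `Y`, and outputs the new colouring. -/
def moveStm (Y d : ℕ) (e : Exp) : Stm :=
  .seq (.put 14 (.sub (.load 17 (.const d)) (.const 1)) e)
  (.seq (.put Y (.sub (.load 17 (.const d)) (.const 1))
    (.sub (.load Y (.sub (.load 17 (.const d)) (.const 1))) (.const 1)))
  (.seq (.put 10 (.const 1) (.add (.load 10 (.const 1)) (.const 1)))
  (.row 3 (.load 10 (.const 1)) 1 (.load 14 (.var 1)))))

/-- A vertex that may be moved, where `Y` holds the distances and `k` is the tight label. -/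
def Exp.movable (p Y k : ℕ) : Exp :=
  .find 0 (.and (.load Y (.var 0)) (.not (.sup 1
    (.and (.adj (.var 0) (.var 1)) (.eq (.arc p 14 (.var 0) (.var 1)) (.const k))))))

/-- The colour of the vertex selected in cell `0` of array `17`, plus one. -/
def Exp.colourUp (p : ℕ) : Exp :=
  .ite (.eq (.add (.load 14 (.sub (.load 17 (.const 0)) (.const 1))) (.const 1)) (.const p))
    (.const 0) (.add (.load 14 (.sub (.load 17 (.const 0)) (.const 1))) (.const 1))

/-- The colour of the vertex selected in cell `1` of array `17`, minus one. -/
def Exp.colourDown (p : ℕ) : Exp :=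
  .ite (.load 14 (.sub (.load 17 (.const 1)) (.const 1)))
    (.sub (.load 14 (.sub (.load 17 (.const 1)) (.const 1))) (.const 1)) (.const (p - 1))

/-- One recolouring, if any is left. -/
def recolourStm (p q : ℕ) : Stm :=
  .seq (.put 17 (.const 0) (.movable p 12 q)) (.seq (.put 17 (.const 1) (.movable p 13 (p - q)))
    (.ite (.load 17 (.const 0)) (moveStm 12 0 (.colourUp p))
      (.ite (.load 17 (.const 1)) (moveStm 13 1 (.colourDown p)) .skip)))

/-- Execute `S` `k` times. -/
def Stm.rep : ℕ → Stm → Stm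
  | 0, _ => .skip
  | k + 1, S => .seq (rep k S) S

/-- Outputs a reconfiguration sequence. -/
def sequenceStm (p q : ℕ) : Stm :=
  .seq rootStm (.seq (shiftStm p) (.seq startStm (.seq
    (.loop 5 (.loop 6 (.rep p (recolourStm p q)))) (.put 10 (.const 0) (.const 0)))))

section Specs

variable {n p q : ℕ} {G : SimpleGraph (Fin n)} {f g : Fin n → Fin p} {F : Fin n → Prop}
  {m m' : Mem} {ρ : ℕ → ℕ}

theorem Exp.eval_connected_ne (hT : HoldsTable m G f g) {x y : Exp} {u v : Fin n}
    (hx : ∀ i, x.eval n m (Function.update ρ 3 i) = u)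
    (hy : ∀ i, y.eval n m (Function.update ρ 3 i) = v) :
    (connected x y).eval n m ρ ≠ 0 ↔ G.Reachable u v := by
  classical
  have key : ∀ i : Fin n, (entry (.var 3) x y).eval n m (Function.update ρ 3 i) ≠ 0 ↔
      ∃ W : G.Walk u v, W.length = i := fun i => by
    rw [eval_entry, hx, hy, ← table_ne_zero_iff (f := f) (g := g), ← hT i i.isLt.le]
    simp [eval]
  rw [connected, eval_sup_ne]
  simp only [key]
  constructor
  · rintro ⟨-, W, -⟩
    exact ⟨W⟩
  · rintro ⟨W⟩
    have := W.bypass_isPath.length_lt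
    rw [Fintype.card_fin] at this
    exact ⟨⟨_, this⟩, W.bypass, rfl⟩

theorem rootStm_run (hF : HoldsFixed m F) (hT : HoldsTable m G f g) :
    ∃ (r : Fin n → Fin n) (l : Fin n → Fin n), (∀ v : Fin n, rootStm.run n ρ m 15 v = r v) ∧
      (∀ v : Fin n, rootStm.run n ρ m 16 v = l v) ∧ (∀ u v, G.Adj u v → r u = r v) ∧
      (∀ v, F v → F (r v)) ∧ ∀ v, table G f g (l v) (r v) v ≠ 0 := by
  rw [rootStm, Stm.run]
  generalize hm₁ : (Stm.row 15 (.const 0) 1 (.sub (.ite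
      (.find 0 (.and (.fixed (.var 0)) (.connected (.var 0) (.var 1))))
      (.find 0 (.and (.fixed (.var 0)) (.connected (.var 0) (.var 1))))
      (.find 0 (.connected (.var 0) (.var 1)))) (.const 1))).run n ρ m = m₁
  have hconn : ∀ u v : Fin n, (Exp.connected (.var 0) (.var 1)).eval n m
      (Function.update (Function.update ρ 1 v) 0 u) ≠ 0 ↔ G.Reachable u v := fun u v =>
    Exp.eval_connected_ne hT (by simp [Exp.eval]) (by simp [Exp.eval])
  have hfix : ∀ u v : Fin n, (Exp.and (.fixed (.var 0)) (.connected (.var 0) (.var 1))).eval n m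
      (Function.update (Function.update ρ 1 v) 0 u) ≠ 0 ↔ F u ∧ G.Reachable u v := fun u v => by
    rw [Exp.eval_and_ne, hconn, Exp.eval_fixed_ne (u := u) hF (by simp [Exp.eval])]
  have hval : ∀ v : Fin n, m₁ 15 v = (if (Exp.find 0
      (.and (.fixed (.var 0)) (.connected (.var 0) (.var 1)))).eval n m (Function.update ρ 1 v) ≠ 0
      then (Exp.find 0 (.and (.fixed (.var 0)) (.connected (.var 0) (.var 1)))).eval n m
        (Function.update ρ 1 v)
      else (Exp.find 0 (.connected (.var 0) (.var 1))).eval n m (Function.update ρ 1 v)) - 1 := by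
    intro v
    rw [← hm₁, Stm.run_row_zero v.isLt]
    rfl
  have hroot : ∀ v : Fin n, ∃ r : Fin n, m₁ 15 v = r ∧ G.Reachable r v ∧ (F v → F r) := by
    intro v
    rw [hval]
    rcases Exp.find_spec 0 (.and (.fixed (.var 0)) (.connected (.var 0) (.var 1))) n m
      (Function.update ρ 1 v) with ⟨h0, h⟩ | ⟨r, hr, h⟩
    · rw [if_neg (by simpa using h0)]
      rcases Exp.find_spec 0 (.connected (.var 0) (.var 1)) n m
        (Function.update ρ 1 v) with ⟨h0', h'⟩ | ⟨r, hr, h'⟩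
      · exact absurd ((hconn v v).2 (.refl v)) (h' v)
      · exact ⟨r, by rw [hr, Nat.add_sub_cancel], (hconn r v).1 h',
          fun hv => absurd ((hfix v v).2 ⟨hv, .refl v⟩) (h v)⟩
    · rw [if_pos (by omega)]
      exact ⟨r, by rw [hr, Nat.add_sub_cancel], ((hfix r v).1 h).2, fun _ => ((hfix r v).1 h).1⟩
  choose r hr hreach hrF using hroot
  have hadj : ∀ u v, G.Adj u v → r u = r v := by
    intro u v huv
    rw [Fin.ext_iff, ← hr, ← hr, hval, hval]
    have hiff : ∀ w, G.Reachable w u ↔ G.Reachable w v :=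
      fun w => ⟨fun h => h.trans huv.reachable, fun h => h.trans huv.symm.reachable⟩
    rw [Exp.eval_find_congr (m' := m) (ρ' := Function.update ρ 1 v) fun w => by
        rw [hfix, hfix, hiff],
      Exp.eval_find_congr (x := 0) (e := .connected (.var 0) (.var 1)) (m' := m)
        (ρ' := Function.update ρ 1 v) fun w => by rw [hconn, hconn, hiff]]
  have hT₁ : HoldsTable m₁ G f g := hT.congr (by
    rw [← hm₁]; exact Stm.run_of_notMem _ (by simp [Stm.writes]) _ _)
  have hlen : ∀ v : Fin n, ∃ l : Fin n, (Stm.row 16 (.const 0) 1 (.sub (.find 3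
      (.entry (.var 3) (.load 15 (.var 1)) (.var 1))) (.const 1))).run n ρ m₁ 16 v = l ∧
      table G f g l (r v) v ≠ 0 := by
    intro v
    rw [Stm.run_row_zero v.isLt, Exp.eval]
    have key : ∀ i : Fin n, (Exp.entry (.var 3) (.load 15 (.var 1)) (.var 1)).eval n m₁
        (Function.update (Function.update ρ 1 v) 3 i) ≠ 0 ↔ table G f g i (r v) v ≠ 0 := by
      intro i
      rw [Exp.eval_entry, ← hT₁ i i.isLt.le, ← hr v]
      simp [Exp.eval]
    rcases Exp.find_spec 3 (.entry (.var 3) (.load 15 (.var 1)) (.var 1)) n m₁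
      (Function.update ρ 1 v) with ⟨h0, h⟩ | ⟨l, hl, h⟩
    · refine absurd ?_ (Exp.eval_find_ne.not.1 (by rw [h0]; simp) : ¬ ∃ i : Fin n,
        (Exp.entry (.var 3) (.load 15 (.var 1)) (.var 1)).eval n m₁
          (Function.update (Function.update ρ 1 v) 3 i) ≠ 0)
      classical
      obtain ⟨W⟩ := hreach v
      have := W.bypass_isPath.length_lt
      rw [Fintype.card_fin] at this
      exact ⟨⟨_, this⟩, (key ⟨_, this⟩).2 (table_ne_zero_iff.2 ⟨W.bypass, rfl⟩)⟩
    · exact ⟨l, by rw [hl]; simp [Exp.eval], (key l).1 h⟩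
  choose l hl hlt using hlen
  exact ⟨r, l, fun v => by rw [Stm.run_of_notMem _ (by simp [Stm.writes]), hr], hl, hadj, hrF, hlt⟩

/-- Arrays `12` and `13` hold the positive and the negative part of `y`. -/
def HoldsShift (m : Mem) (y : Fin n → ℤ) : Prop :=
  ∀ v : Fin n, m 12 v = (y v).toNat ∧ m 13 v = (- y v).toNat

theorem shiftStm_run (h : HoldsInstance m G f g) (hT : HoldsTable m G f g) {r l : Fin n → Fin n}
    (hr : ∀ v : Fin n, m 15 v = r v) (hl : ∀ v : Fin n, m 16 v = l v) :
    HoldsShift ((shiftStm p).run n ρ m) fun v =>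
      (g (r v) : ℕ) - (f (r v) : ℕ) + ((table G f g (l v) (r v) v : ℤ) - (1 + p * (l v : ℕ))) := by
  intro v
  have h1 := h.left (r v)
  have h2 := h.right (r v)
  have h3 := hT (l v) (l v).isLt.le (r v) v
  rw [shiftStm, Stm.run]
  constructor
  · rw [Stm.run_of_notMem _ (by simp [Stm.writes]), Stm.run_row_zero v.isLt]
    simp only [Exp.eval, Exp.eval_entry, Exp.eval_mulConst, Function.update_self, hr, hl, h1, h2, h3]
    zify
    omega
  · rw [Stm.run_row_zero v.isLt]
    generalize hm₁ : Stm.run n (Stm.row 12 _ _ _) ρ m = m₁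
    have e : ∀ a, a ≠ 12 → m₁ a = m a := fun a ha => by
      rw [← hm₁]; exact Stm.run_of_notMem _ (by simpa [Stm.writes] using ha) _ _
    simp only [Exp.eval, Exp.eval_entry, Exp.eval_mulConst, Function.update_self, e 15 (by omega),
      e 16 (by omega), e 1 (by omega), e 2 (by omega), e 9 (by omega), hr, hl, h1, h2, h3]
    omega

/-- The state of the recolouring process: the current colouring `col` has been reached from `f`,
and has to be shifted by `y` to reach `g`. -/
structure Recolouring (m : Mem) (G : SimpleGraph (Fin n)) (q : ℕ) (f g col : Fin n → Fin p)
    (y : Fin n → ℤ) : Prop where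
  graph : HoldsGraph m G
  colouring : HoldsColouring m 14 col
  distance : HoldsShift m y
  good : Good G q col y
  target : shift col y = g
  sequence : ∃ c, IsReconfigurationSequence G q f col (m 10 1) c ∧
    ∀ i ≤ m 10 1, ∀ v : Fin n, m 3 (i * n + v) = c i v

theorem Recolouring.congr {col : Fin n → Fin p} {y : Fin n → ℤ} (h : Recolouring m G q f g col y)
    (he : ∀ a, a ≠ 17 → m' a = m a) : Recolouring m' G q f g col y := by
  refine ⟨h.graph.congr (he 0 (by omega)), h.colouring.congr (he 14 (by omega)), fun v => ?_,
    h.good, h.target, ?_⟩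
  · rw [he 12 (by omega), he 13 (by omega)]
    exact h.distance v
  · rw [he 10 (by omega), he 3 (by omega)]
    exact h.sequence

theorem moveStm_run (hq : 0 < q) (hp : 2 ≤ p) {col : Fin n → Fin p} {y : Fin n → ℤ}
    (h : Recolouring m G q f g col y) {w : Fin n} {ε : ℤ} {Y d : ℕ} {e : Exp}
    (hY : (ε = 1 ∧ Y = 12) ∨ (ε = -1 ∧ Y = 13)) (hd : m 17 d = w + 1)
    (hm : Movable G q col y w ε)
    (he : e.eval n m ρ = (shift col (Pi.single w ε) w : ℕ)) :
    Recolouring ((moveStm Y d e).run n ρ m) G q f g (shift col (Pi.single w ε))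
      (y - Pi.single w ε) := by
  have hε : ε = 1 ∨ ε = -1 := by omega
  have hdd : m 17 d - 1 = w := by omega
  rw [moveStm, Stm.run]
  generalize hm₁ : (Stm.put 14 (.sub (.load 17 (.const d)) (.const 1)) e).run n ρ m = m₁
  have e₁ : ∀ a, a ≠ 14 → m₁ a = m a := fun a ha => by
    rw [← hm₁]; exact Stm.run_of_notMem _ (by simpa [Stm.writes] using ha) _ _
  have h₁ : HoldsColouring m₁ 14 (shift col (Pi.single w ε)) := by
    intro v
    rw [← hm₁]
    by_cases hv : v = w
    · subst hv
      simp [Stm.run, Exp.eval, hdd, he]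
    · rw [shift_eq_self (Pi.single_eq_of_ne hv _)]
      simp [Stm.run, Exp.eval, hdd, Fin.val_inj, hv, h.colouring v]
  rw [Stm.run]
  generalize hm₂ : (Stm.put Y (.sub (.load 17 (.const d)) (.const 1))
    (.sub (.load Y (.sub (.load 17 (.const d)) (.const 1))) (.const 1))).run n ρ m₁ = m₂
  have e₂ : ∀ a, a ≠ Y → m₂ a = m₁ a := fun a ha => by
    rw [← hm₂]; exact Stm.run_of_notMem _ (by simpa [Stm.writes] using ha) _ _
  have h₂ : HoldsShift m₂ (y - Pi.single w ε) := by
    intro v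
    have hv' := h.distance v
    have hmw := hm.1
    rw [← hm₂]
    by_cases hv : v = w
    · subst hv
      rw [Pi.sub_apply, Pi.single_eq_same]
      rcases hY with ⟨rfl, rfl⟩ | ⟨rfl, rfl⟩ <;>
        simp [Stm.run, Exp.eval, hdd, e₁, hv'] <;> omega
    · rw [Pi.sub_apply, Pi.single_eq_of_ne hv, sub_zero]
      rcases hY with ⟨rfl, rfl⟩ | ⟨rfl, rfl⟩ <;>
        simp [Stm.run, Exp.eval, hdd, Fin.val_inj, hv, e₁, hv']
  obtain ⟨c, hc, hc3⟩ := h.sequence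
  have hstep := h.good.step hq hp hε hm
  have hk : ((Stm.seq (.put 10 (.const 1) (.add (.load 10 (.const 1)) (.const 1)))
      (.row 3 (.load 10 (.const 1)) 1 (.load 14 (.var 1)))).run n ρ m₂) 10 1 = m 10 1 + 1 := by
    simp [Stm.run, Exp.eval, e₂ 10 (by omega), e₁ 10]
  have e₃ : ∀ a, a ≠ 3 → a ≠ 10 →
      ((Stm.seq (.put 10 (.const 1) (.add (.load 10 (.const 1)) (.const 1)))
      (.row 3 (.load 10 (.const 1)) 1 (.load 14 (.var 1)))).run n ρ m₂) a = m₂ a :=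
    fun a ha ha' => Stm.run_of_notMem _ (by simp [Stm.writes, ha, ha']) _ _
  refine ⟨h.graph.congr ?_, h₁.congr ?_, fun v => ?_, h.good.move hq hε hm, ?_, ?_⟩
  · rw [e₃ 0 (by omega) (by omega), e₂ 0 (by omega), e₁ 0 (by omega)]
  · rw [e₃ 14 (by omega) (by omega), e₂ 14 (by omega)]
  · rw [e₃ 12 (by omega) (by omega), e₃ 13 (by omega) (by omega)]
    exact h₂ v
  · rw [shift_shift, add_sub_cancel]
    exact h.target
  · rw [hk]
    refine ⟨_, hc.snoc hstep, fun i hi v => ?_⟩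
    rw [Stm.run, Stm.run_row v.isLt]
    have e4 : (Exp.load 10 (.const 1)).eval n ((Stm.put 10 (.const 1)
        (.add (.load 10 (.const 1)) (.const 1))).run n ρ m₂) ρ = m 10 1 + 1 := by
      simp [Stm.run, Exp.eval, e₂ 10 (by omega), e₁ 10]
    rw [e4]
    split_ifs with h1 h2 h2
    · omega
    · simp [Stm.run, Exp.eval, e₂ 14 (by omega), h₁ v]
    · rw [← hc3 i h2 v]
      simp [Stm.run, e₂ 3 (by omega), e₁ 3]
    · omega

theorem eval_movable {col : Fin n → Fin p} {y : Fin n → ℤ}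
    (hG : HoldsGraph m G) (hc : HoldsColouring m 14 col) (hs : HoldsShift m y) {ε : ℤ} {Y k : ℕ}
    (hY : (ε = 1 ∧ Y = 12) ∨ (ε = -1 ∧ Y = 13)) (hk : (k : ℤ) = tightLabel p q ε) :
    ((Exp.movable p Y k).eval n m ρ = 0 ∧ ∀ w, ¬ Movable G q col y w ε) ∨
      ∃ w : Fin n, (Exp.movable p Y k).eval n m ρ = w + 1 ∧ Movable G q col y w ε := by
  have key : ∀ w : Fin n, (Exp.and (.load Y (.var 0)) (.not (.sup 1
      (.and (.adj (.var 0) (.var 1)) (.eq (.arc p 14 (.var 0) (.var 1)) (.const k)))))).eval n m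
      (Function.update ρ 0 w) ≠ 0 ↔ Movable G q col y w ε := by
    intro w
    rw [Exp.eval_and_ne, Exp.eval_not_ne, Exp.eval_sup_ne, not_exists, Movable]
    refine and_congr ?_ (forall_congr' fun u => ?_)
    · have := hs w
      rcases hY with ⟨rfl, rfl⟩ | ⟨rfl, rfl⟩ <;> simp [Exp.eval, this]
    · rw [Exp.eval_and_ne, Exp.eval_adj_ne (u := w) (v := u) hG (by simp [Exp.eval])
        (by simp [Exp.eval]), Exp.eval_eq_ne, not_and, ← Nat.cast_inj (R := ℤ),
        Exp.eval_arc (u := w) (v := u) hc (by simp [Exp.eval]) (by simp [Exp.eval]), ← hk]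
      rfl
  rcases Exp.find_spec 0 (.and (.load Y (.var 0)) (.not (.sup 1
      (.and (.adj (.var 0) (.var 1)) (.eq (.arc p 14 (.var 0) (.var 1)) (.const k)))))) n m ρ with
    ⟨h0, h⟩ | ⟨w, hw, h⟩
  · exact .inl ⟨h0, fun w hw => h w ((key w).2 hw)⟩
  · exact .inr ⟨w, hw, (key w).1 h⟩

theorem recolourStm_run (hq : 0 < q) (hp : 2 * q ≤ p) {col : Fin n → Fin p} {y : Fin n → ℤ}
    (h : Recolouring m G q f g col y) :
    ∃ col' y', Recolouring ((recolourStm p q).run n ρ m) G q f g col' y' ∧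
      ∑ v, (y' v).natAbs ≤ ∑ v, (y v).natAbs - 1 := by
  rw [recolourStm, Stm.run]
  generalize hm₁ : (Stm.put 17 (.const 0) (.movable p 12 q)).run n ρ m = m₁
  have e₁ : ∀ a, a ≠ 17 → m₁ a = m a := fun a ha => by
    rw [← hm₁]; exact Stm.run_of_notMem _ (by simpa [Stm.writes] using ha) _ _
  have v₁ : m₁ 17 0 = (Exp.movable p 12 q).eval n m ρ := by
    rw [← hm₁]; simp [Stm.run, Exp.eval]
  have hup := eval_movable (q := q) (ρ := ρ) h.graph h.colouring h.distance (ε := 1) (k := q)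
    (.inl ⟨rfl, rfl⟩) (by simp [tightLabel])
  have P₁ := h.congr e₁
  rw [Stm.run]
  generalize hm₂ : (Stm.put 17 (.const 1) (.movable p 13 (p - q))).run n ρ m₁ = m₂
  have e₂ : ∀ a, a ≠ 17 → m₂ a = m₁ a := fun a ha => by
    rw [← hm₂]; exact Stm.run_of_notMem _ (by simpa [Stm.writes] using ha) _ _
  have v₂ : m₂ 17 1 = (Exp.movable p 13 (p - q)).eval n m₁ ρ := by
    rw [← hm₂]; simp [Stm.run, Exp.eval]
  have v₂' : m₂ 17 0 = (Exp.movable p 12 q).eval n m ρ := by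
    rw [← v₁, ← hm₂]; simp [Stm.run, Exp.eval]
  have hdown := eval_movable (q := q) (ρ := ρ) P₁.graph P₁.colouring P₁.distance (ε := -1) (k := p - q)
    (.inr ⟨rfl, rfl⟩) (by simp [tightLabel]; omega)
  have P₂ := P₁.congr e₂
  have hlt := fun w => (col w).isLt
  rw [Stm.run]
  rcases hup with ⟨h0, hno⟩ | ⟨w, hw, hmov⟩
  · rw [if_neg (by simp [Exp.eval, v₂', h0]), Stm.run]
    rcases hdown with ⟨h0', hno'⟩ | ⟨w, hw, hmov⟩
    · rw [if_neg (by simp [Exp.eval, v₂, h0']), Stm.run]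
      refine ⟨col, y, P₂, ?_⟩
      have hy : y = 0 := by
        by_contra hy
        obtain ⟨w, ε, rfl | rfl, hmov⟩ := h.good.exists_movable hq hy
        · exact hno w hmov
        · exact hno' w hmov
      simp [hy]
    · rw [if_pos (by simp [Exp.eval, v₂, hw])]
      refine ⟨_, _, moveStm_run hq (by omega) P₂ (.inr ⟨rfl, rfl⟩) (v₂.trans hw) hmov ?_, ?_⟩
      · have e3 : m₂ 17 1 - 1 = w := by omega
        have h1 := shift_coe col (Pi.single w (-1)) w
        rw [Pi.single_eq_same] at h1
        simp only [Exp.colourDown, Exp.eval, e3, P₂.colouring w]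
        have := hlt w
        zify
        rw [h1]
        split_ifs with hz
        · rw [Int.emod_eq_of_lt (by omega) (by omega)]
          omega
        · rw [← Int.add_emod_right, Int.emod_eq_of_lt (by omega) (by omega)]
          omega
      · have := sum_natAbs_move (.inr rfl) hmov.1
        omega
  · rw [if_pos (by simp [Exp.eval, v₂', hw])]
    refine ⟨_, _, moveStm_run hq (by omega) P₂ (.inl ⟨rfl, rfl⟩) (v₂'.trans hw) hmov ?_, ?_⟩
    · have e3 : m₂ 17 0 - 1 = w := by omega
      have h1 := shift_coe col (Pi.single w 1) w
      rw [Pi.single_eq_same] at h1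
      simp only [Exp.colourUp, Exp.eval, Exp.eval_eq_ne, e3, P₂.colouring w]
      have := hlt w
      zify
      rw [h1]
      split_ifs with hz
      · have : ((col w : ℕ) : ℤ) + 1 = p := by exact_mod_cast hz
        simp [this]
      · rw [Int.emod_eq_of_lt (by omega) (by omega)]
    · have := sum_natAbs_move (.inl rfl) hmov.1
      omega

theorem Stm.run_rep_induction {S : Stm} (I : ℕ → Mem → Prop) {k₀ : ℕ} (h0 : I k₀ m)
    (hs : ∀ i m, I i m → I (i + 1) (S.run n ρ m)) (k : ℕ) :
    I (k₀ + k) ((Stm.rep k S).run n ρ m) := by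
  induction k with
  | zero => exact h0
  | succ k ih => exact hs _ _ ih

theorem sequenceStm_run (hq : 0 < q) (hp : 2 * q ≤ p) (h4 : p < 4 * q)
    (hf : IsColouring G q f) (hg : IsColouring G q g) (h : HoldsInstance m G f g)
    (hF : HoldsFixed m (IsFixed G q f)) (hT : HoldsTable m G f g)
    (hfix : ∀ v, IsFixed G q f v → f v = g v)
    (hC : ∀ (u : Fin n) (C : G.Walk u u), gain f g C = 0)
    (hP : ∀ (u v : Fin n) (W : G.Walk u v), IsFixed G q f u → IsFixed G q f v →
      gain f g W = 0) :
    (sequenceStm p q).run n ρ m 10 0 = 0 ∧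
    ∃ c, IsReconfigurationSequence G q f g ((sequenceStm p q).run n ρ m 10 1) c ∧
      ∀ i ≤ (sequenceStm p q).run n ρ m 10 1, ∀ v : Fin n,
        (sequenceStm p q).run n ρ m 3 (i * n + v) = c i v := by
  rw [sequenceStm, Stm.run]
  obtain ⟨r, l, hr, hl, hadj, hrF, htab⟩ := rootStm_run (ρ := ρ) hF hT
  have e₁ : ∀ a, a ≠ 15 → a ≠ 16 → rootStm.run n ρ m a = m a := fun a ha ha' =>
    Stm.run_of_notMem _ (by simp [rootStm, Stm.writes, ha, ha']) _ _
  generalize rootStm.run n ρ m = m₁ at *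
  have h₁ : HoldsInstance m₁ G f g := h.congr (e₁ 0 (by omega) (by omega))
    (e₁ 1 (by omega) (by omega)) (e₁ 2 (by omega) (by omega))
  have hy := shiftStm_run (ρ := ρ) h₁ (hT.congr (e₁ 9 (by omega) (by omega))) hr hl
  rw [Stm.run]
  have e₂ : ∀ a, a ≠ 12 → a ≠ 13 → (shiftStm p).run n ρ m₁ a = m₁ a := fun a ha ha' =>
    Stm.run_of_notMem _ (by simp [shiftStm, Stm.writes, ha, ha']) _ _
  generalize (shiftStm p).run n ρ m₁ = m₂ at *
  have h₂ : HoldsInstance m₂ G f g := h₁.congr (e₂ 0 (by omega) (by omega))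
    (e₂ 1 (by omega) (by omega)) (e₂ 2 (by omega) (by omega))
  set y : Fin n → ℤ := fun v =>
      (g (r v) : ℕ) - (f (r v) : ℕ) + ((table G f g (l v) (r v) v : ℤ) - (1 + p * (l v : ℕ))) with hyd
  have hW : ∀ v, ∃ W : G.Walk (r v) v, W.length = l v ∧
      y v = (g (r v) : ℕ) - (f (r v) : ℕ) + gain f g W := by
    intro v
    obtain ⟨W, hWl, ht⟩ := exists_walk (htab v)
    exact ⟨W, hWl, by simp only [hyd]; rw [ht]; ring⟩
  obtain ⟨hgood, htarget⟩ := good_of_roots hq (by omega) h4 hf hg hfix hC hP (y := y) r hadj hrF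
    fun v => let ⟨W, _, hy⟩ := hW v; ⟨W, hy⟩
  have hbound : ∑ v, (y v).natAbs ≤ n * (n * p) := by
    have : ∀ v ∈ (Finset.univ : Finset (Fin n)), (y v).natAbs ≤ n * p := by
      intro v _
      obtain ⟨W, hWl, hv⟩ := hW v
      have h1 := abs_le.1 (abs_gain_le (f := f) (g := g) W)
      have h2 := (f (r v)).isLt
      have h3 := (g (r v)).isLt
      have h4 : W.length + 1 ≤ n := by have := (l v).isLt; omega
      have h5 : (p : ℤ) * W.length + p ≤ n * p := by
        have : ((W.length : ℤ) + 1) ≤ n := by exact_mod_cast h4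
        nlinarith
      zify
      rw [hv, abs_le]
      constructor <;> linarith
    refine (Finset.sum_le_card_nsmul _ _ _ this).trans ?_
    simp
  rw [Stm.run]
  have P₃ : Recolouring (startStm.run n ρ m₂) G q f g f y := by
    have e₃ : ∀ a, a ≠ 14 → a ≠ 3 → a ≠ 10 → startStm.run n ρ m₂ a = m₂ a := fun a ha ha' ha'' =>
      Stm.run_of_notMem _ (by simp [startStm, Stm.writes, ha, ha', ha'']) _ _
    have hk : startStm.run n ρ m₂ 10 1 = 0 := by simp [startStm, Stm.run, Exp.eval]
    refine ⟨h₂.graph.congr (e₃ 0 (by omega) (by omega) (by omega)), fun v => ?_, fun v => ?_, hgood,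
      htarget, ?_⟩
    · rw [startStm, Stm.run, Stm.run_of_notMem _ (by simp [Stm.writes]), Stm.run_row_zero v.isLt]
      simp [Exp.eval, h₂.left v]
    · rw [e₃ 12 (by omega) (by omega) (by omega), e₃ 13 (by omega) (by omega) (by omega)]
      exact hy v
    · rw [hk]
      refine ⟨fun _ => f, ⟨rfl, rfl, fun _ _ => hf, fun i hi => absurd hi (by omega)⟩,
        fun i hi v => ?_⟩
      obtain rfl : i = 0 := by omega
      have := Stm.run_of_notMem (a := 1) (n := n) (.row 14 (.const 0) 1 (.load 1 (.var 1)))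
        (by simp [Stm.writes]) ρ m₂
      rw [zero_mul, zero_add, startStm, Stm.run]
      generalize Stm.run n (.row 14 (.const 0) 1 (.load 1 (.var 1))) ρ m₂ = m' at *
      rw [Stm.run, Stm.run_of_notMem (.put 10 (.const 1) (.const 0)) (by simp [Stm.writes]),
        Stm.run_row_zero v.isLt]
      simp [Exp.eval, this, h₂.left v]
  generalize startStm.run n ρ m₂ = m₃ at *
  obtain ⟨col, z, P, hz⟩ := Stm.run_loop_induction (n := n) (x := 5) (ρ := ρ) (m := m₃)
    (S := .loop 6 (.rep p (recolourStm p q)))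
    (fun i m' => ∃ col z, Recolouring m' G q f g col z ∧
      ∑ v, (z v).natAbs ≤ ∑ v, (y v).natAbs - i * (n * p))
    ⟨f, y, P₃, by simp⟩
    (by
      intro i hi m' hm'
      have := Stm.run_loop_induction (n := n) (x := 6) (ρ := Function.update ρ 5 i) (m := m')
        (S := .rep p (recolourStm p q))
        (fun j m' => ∃ col z, Recolouring m' G q f g col z ∧
          ∑ v, (z v).natAbs ≤ ∑ v, (y v).natAbs - (i * (n * p) + j * p))
        (by simpa using hm')
        (by
          intro j hj m' hm'
          have := Stm.run_rep_induction (n := n)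
            (ρ := Function.update (Function.update ρ 5 i) 6 j) (S := recolourStm p q)
            (fun k m' => ∃ col z, Recolouring m' G q f g col z ∧
              ∑ v, (z v).natAbs ≤ ∑ v, (y v).natAbs - k) hm'
            (by
              rintro k m' ⟨col, z, hP, hz⟩
              obtain ⟨col', z', hP', hz'⟩ := recolourStm_run
                (ρ := Function.update (Function.update ρ 5 i) 6 j) hq hp hP
              exact ⟨col', z', hP', by omega⟩) p
          simpa only [Nat.succ_mul, ← Nat.add_assoc] using this)
      simpa only [Nat.succ_mul] using this)
  have hz0 : z = 0 := by
    have : ∑ v, (z v).natAbs = 0 := by omega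
    funext v
    simpa using (Finset.sum_eq_zero_iff.1 this) v (Finset.mem_univ v)
  have hcol : col = g := by
    rw [← P.target, hz0]
    exact funext fun v => (shift_eq_self (f := col) (y := 0) (v := v) rfl).symm
  subst hcol
  rw [Stm.run]
  generalize (Stm.loop 5 (.loop 6 (.rep p (recolourStm p q)))).run n ρ m₃ = m₄ at *
  refine ⟨by simp [Stm.run, Exp.eval], ?_⟩
  have hk : (Stm.put 10 (.const 0) (.const 0)).run n ρ m₄ 10 1 = m₄ 10 1 := by
    simp [Stm.run, Exp.eval]
  rw [hk, Stm.run_of_notMem (a := 3) (.put 10 (.const 0) (.const 0)) (by simp [Stm.writes])]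
  exact P.sequence

end Specs

end CircularColouring

namespace CircularColouring

/-- Whether `x` is blocked in both directions under the second colouring. -/
def Exp.fixedRight (x : Exp) : Exp := .and (.load 6 x) (.load 7 x)

/-- Whether `x` is fixed under exactly one colouring, or is fixed with different colours. -/
def Exp.badVertex (x : Exp) : Exp :=
  .or (.and (.fixed x) (.not (.fixedRight x))) (.or (.and (.fixedRight x) (.not (.fixed x)))
    (.and (.fixed x) (.not (.eq (.load 1 x) (.load 2 x)))))

/-- Computes the fixed vertices under both colourings. -/
def fixedStm (p q : ℕ) : Stm :=
  .seq (stuckStm p 1 q 4) (.seq (stuckStm p 1 (p - q) 5) (.seq (stuckStm p 2 q 6)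
    (stuckStm p 2 (p - q) 7)))

/-- The algorithm; it leaves the kind of the answer and the answer in array `10`. -/
def answerStm (p q : ℕ) : Stm :=
  .seq (fixedStm p q) (.seq (.put 10 (.const 1) (.find 0 (.badVertex (.var 0))))
    (.ite (.load 10 (.const 1))
      (.seq (.put 10 (.const 1) (.sub (.load 10 (.const 1)) (.const 1)))
        (.put 10 (.const 0) (.const 1)))
      (.seq (tableStm p) (.seq (searchStm p) (.ite (.load 11 (.const 0)) (walkStm p)
        (sequenceStm p q))))))

/-- The program; it moves the kind of the answer and the answer to the registers. -/
def answerProgram (p q : ℕ) : Program :=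
  .seq ((answerStm p q).compile (fun _ => 0) 1) (.seq (.const 2 0) (.seq (.const 3 1)
    (.seq (.load 0 (arr 10) 2) (.load 1 (arr 10) 3))))

section Specs

variable {n p q : ℕ} {G : SimpleGraph (Fin n)} {f g : Fin n → Fin p} {m : Mem} {ρ : ℕ → ℕ}

theorem fixedStm_run (hq : 0 < q) (hp : 2 * q ≤ p) (h4 : p < 4 * q) (hf : IsColouring G q f)
    (hg : IsColouring G q g) (h : HoldsInstance m G f g) :
    HoldsFixed ((fixedStm p q).run n ρ m) (IsFixed G q f) ∧
    ∀ v : Fin n, (fixedStm p q).run n ρ m 6 v ≠ 0 ∧ (fixedStm p q).run n ρ m 7 v ≠ 0 ↔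
      IsFixed G q g v := by
  have hu : ((q : ℕ) : ℤ) = tightLabel p q 1 := by simp [tightLabel]
  have hd : ((p - q : ℕ) : ℤ) = tightLabel p q (-1) := by simp [tightLabel]; omega
  have hfix : ∀ {f : Fin n → Fin p}, IsColouring G q f → ∀ v : Fin n,
      (Stuck G q f 1 n v ∧ Stuck G q f (-1) n v ↔ IsFixed G q f v) := by
    intro f hf v
    rw [isFixed_iff_blocked hq (by omega) h4 hf]
    have hb : ∀ ε, Stuck G q f ε n v ↔ Blocked G q f ε v := fun ε =>
      ⟨fun h => blocked_of_stuck_card (by simpa using h), fun h => h n⟩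
    rw [hb, hb]
  have hcongr : ∀ (c k dst : ℕ) (m : Mem), 3 < dst → HoldsInstance m G f g →
      HoldsInstance ((stuckStm p c k dst).run n ρ m) G f g := fun c k dst m hdst h =>
    h.congr (Stm.run_of_notMem _ (by simp [stuckStm, Stm.writes]; omega) _ _)
      (Stm.run_of_notMem _ (by simp [stuckStm, Stm.writes]; omega) _ _)
      (Stm.run_of_notMem _ (by simp [stuckStm, Stm.writes]; omega) _ _)
  have hframe : ∀ (c k dst a : ℕ) (m : Mem), a ≠ dst → (stuckStm p c k dst).run n ρ m a = m a :=
    fun c k dst a m ha => Stm.run_of_notMem _ (by simp [stuckStm, Stm.writes, ha]) _ _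
  rw [fixedStm, Stm.run, Stm.run, Stm.run]
  have i₁ := hcongr 1 q 4 m (by omega) h
  have i₂ := hcongr 1 (p - q) 5 _ (by omega) i₁
  have i₃ := hcongr 2 q 6 _ (by omega) i₂
  constructor
  · intro v
    rw [hframe _ _ _ 4 _ (by omega), hframe _ _ _ 4 _ (by omega), hframe _ _ _ 4 _ (by omega),
      hframe _ _ _ 5 _ (by omega), hframe _ _ _ 5 _ (by omega),
      stuckStm_run h.graph h.left (by omega) (by omega) hu,
      stuckStm_run i₁.graph i₁.left (by omega) (by omega) hd, hfix hf]
  · intro v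
    rw [hframe _ _ _ 6 _ (by omega), stuckStm_run i₂.graph i₂.right (by omega) (by omega) hu,
      stuckStm_run i₃.graph i₃.right (by omega) (by omega) hd, hfix hg]

theorem weight_ne (hq : 0 < q) (hf : IsColouring G q f) (hg : IsColouring G q g) {u v : Fin n}
    {W : G.Walk u v} (hW : gain f g W ≠ 0) (o : Orientation G) :
    weight o (edgeLabelling o f) W ≠ weight o (edgeLabelling o g) W := by
  rw [weight_eq_add_gain hq hf hg o W]
  omega

theorem answerStm_run (hq : 0 < q) (hp : 2 * q ≤ p) (h4 : p < 4 * q) (hf : IsColouring G q f)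
    (hg : IsColouring G q g) (h : HoldsInstance m G f g) {s : State}
    (hs3 : s.mem 3 = (answerStm p q).run n ρ m 3)
    (hs0 : s.reg 0 = (answerStm p q).run n ρ m 10 0)
    (hs1 : s.reg 1 = (answerStm p q).run n ρ m 10 1) : s.HoldsAnswer G q f g := by
  obtain ⟨hF, hF'⟩ := fixedStm_run (ρ := ρ) hq hp h4 hf hg h
  rw [answerStm, Stm.run] at hs0 hs1 hs3
  have e₁ : ∀ a, a < 4 → (fixedStm p q).run n ρ m a = m a := fun a ha =>
    Stm.run_of_notMem _ (by simp [fixedStm, stuckStm, Stm.writes]; omega) _ _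
  generalize (fixedStm p q).run n ρ m = m₁ at *
  have h₁ : HoldsInstance m₁ G f g := h.congr (e₁ 0 (by omega)) (e₁ 1 (by omega)) (e₁ 2 (by omega))
  rw [Stm.run] at hs0 hs1 hs3
  generalize hm₂ : (Stm.put 10 (.const 1) (.find 0 (.badVertex (.var 0)))).run n ρ m₁ = m₂ at *
  have e₂ : ∀ a, a ≠ 10 → m₂ a = m₁ a := fun a ha => by
    rw [← hm₂]; exact Stm.run_of_notMem _ (by simpa [Stm.writes] using ha) _ _
  have v₂ : m₂ 10 1 = (Exp.find 0 (.badVertex (.var 0))).eval n m₁ ρ := by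
    rw [← hm₂]; simp [Stm.run, Exp.eval]
  have hbad : ∀ v : Fin n, (Exp.badVertex (.var 0)).eval n m₁ (Function.update ρ 0 v) ≠ 0 ↔
      (¬ (IsFixed G q f v ↔ IsFixed G q g v) ∨ (IsFixed G q f v ∧ f v ≠ g v)) := by
    intro v
    have hr : (Exp.fixedRight (.var 0)).eval n m₁ (Function.update ρ 0 v) ≠ 0 ↔
        IsFixed G q g v := by
      rw [← hF' v, Exp.fixedRight, Exp.eval_and_ne]
      simp [Exp.eval]
    have hc : (Exp.eq (.load 1 (.var 0)) (.load 2 (.var 0))).eval n m₁ (Function.update ρ 0 v) ≠ 0 ↔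
        f v = g v := by
      rw [Exp.eval_eq_ne, Fin.ext_iff, ← h₁.left v, ← h₁.right v]
      simp [Exp.eval]
    rw [Exp.badVertex, Exp.eval_or_ne, Exp.eval_or_ne, Exp.eval_and_ne, Exp.eval_and_ne,
      Exp.eval_and_ne, Exp.eval_not_ne, Exp.eval_not_ne, Exp.eval_not_ne, hr, hc,
      Exp.eval_fixed_ne (u := v) hF (by simp [Exp.eval])]
    tauto
  rw [Stm.run] at hs0 hs1 hs3
  rcases Exp.find_spec 0 (.badVertex (.var 0)) n m₁ ρ with ⟨h0, hno⟩ | ⟨v, hv, hb⟩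
  · rw [if_neg (by simp [Exp.eval, v₂, h0])] at hs0 hs1 hs3
    have hF₂ : HoldsFixed m₂ (IsFixed G q f) := hF.congr (e₂ 4 (by omega)) (e₂ 5 (by omega))
    have h₂ : HoldsInstance m₂ G f g := h₁.congr (e₂ 0 (by omega)) (e₂ 1 (by omega)) (e₂ 2 (by omega))
    have hgoodv : ∀ v, (IsFixed G q f v ↔ IsFixed G q g v) ∧ (IsFixed G q f v → f v = g v) := by
      intro v
      have := mt (hbad v).2 (hno v)
      tauto
    rw [Stm.run] at hs0 hs1 hs3
    have hT := tableStm_run (ρ := ρ) h₂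
    have e₃ : ∀ a, a ≠ 9 → (tableStm p).run n ρ m₂ a = m₂ a := fun a ha =>
      Stm.run_of_notMem _ (by simpa [tableStm, Stm.writes] using ha) _ _
    generalize (tableStm p).run n ρ m₂ = m₃ at *
    have hF₃ := hF₂.congr (e₃ 4 (by omega)) (e₃ 5 (by omega))
    have h₃ := h₂.congr (e₃ 0 (by omega)) (e₃ 1 (by omega)) (e₃ 2 (by omega))
    rw [Stm.run] at hs0 hs1 hs3
    have hsearch := searchStm_run (p := p) (ρ := ρ) hF₃ hT
    have e₄ : ∀ a, a ≠ 11 → (searchStm p).run n ρ m₃ a = m₃ a := fun a ha =>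
      Stm.run_of_notMem _ (by simpa [searchStm, Stm.writes] using ha) _ _
    generalize (searchStm p).run n ρ m₃ = m₄ at *
    have hF₄ := hF₃.congr (e₄ 4 (by omega)) (e₄ 5 (by omega))
    have h₄ := h₃.congr (e₄ 0 (by omega)) (e₄ 1 (by omega)) (e₄ 2 (by omega))
    have hT₄ := hT.congr (e₄ 9 (by omega))
    rw [Stm.run] at hs0 hs1 hs3
    rcases hsearch with ⟨hL0, hnone⟩ | ⟨L, hL, hLpos, hLn, hex, hmin⟩
    · rw [if_neg (by simp [Exp.eval, hL0])] at hs0 hs1 hs3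
      obtain ⟨hC, hP⟩ := gain_of_no_badPair hq hf hg hnone
      obtain ⟨k0, c, hc, hc'⟩ := sequenceStm_run (ρ := ρ) hq hp h4 hf hg h₄ hF₄ hT₄
        (fun v => (hgoodv v).2) hC hP
      refine .inl ⟨hs0.trans k0, c, by rwa [hs1], ?_⟩
      rwa [hs1, hs3]
    · rw [if_pos (by simp [Exp.eval, hL]; omega)] at hs0 hs1 hs3
      obtain ⟨u, v, W, huv, hWL, hgain, k0, k1, hW⟩ := walkStm_run (ρ := ρ) h₄ hF₄ hT₄ hL hLn hex
      have hholds : s.HoldsWalk W := by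
        refine ⟨by rw [hs1, k1, hWL], fun i hi => ?_⟩
        rw [hs3]
        exact hW i (by omega)
      have hclosed : ∀ x (C : G.Walk x x), C.length < W.length → gain f g C = 0 :=
        fun x C hC => gain_of_minimal hq hf hg hmin C (.inl rfl) (by omega)
      rw [k0] at hs0
      by_cases he : u = v
      · subst he
        rw [if_pos rfl] at hs0
        exact .inr (.inr (.inl ⟨hs0, u, W, isCycle_of_minimal hq hf hg W hgain hclosed, hholds,
          weight_ne hq hf hg hgain⟩))
      · rw [if_neg he] at hs0
        obtain ⟨hu, hv⟩ := huv.resolve_left he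
        exact .inr (.inr (.inr ⟨hs0, u, v, W, isPath_of_minimal he W hgain hclosed
          (fun W' hW' => gain_of_minimal hq hf hg hmin W' huv (by omega)), hholds,
          ⟨hu, (hgoodv u).1.1 hu⟩, ⟨hv, (hgoodv v).1.1 hv⟩, weight_ne hq hf hg hgain⟩))
  · rw [if_pos (by simp [Exp.eval, v₂, hv])] at hs0 hs1 hs3
    refine .inr (.inl ⟨?_, v, ?_, (hbad v).1 hb⟩)
    · rw [hs0]; simp [Stm.run, Exp.eval]
    · rw [hs1]; simp [Stm.run, Exp.eval, v₂, hv]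

theorem holdsInstance_inputState (G : SimpleGraph (Fin n)) (f g : Fin n → Fin p) :
    HoldsInstance (inputState G f g).visible G f g := by
  refine ⟨fun u v => ?_, fun v => ?_, fun v => ?_⟩
  · simp only [State.visible, inputState, arr]
    simp only [Nat.ofNat_pos, if_true]
    constructor
    · intro h
      by_contra hcon
      refine h (if_neg ?_)
      rintro ⟨i, j, hij, e⟩
      obtain ⟨hi, hj⟩ := (mul_add_inj v.isLt j.isLt).1 e
      exact hcon (by rwa [Fin.ext hi, Fin.ext hj])
    · intro h
      rw [if_pos ⟨u, v, h, rfl⟩]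
      exact one_ne_zero
  · simp [State.visible, inputState, arr]
  · simp [State.visible, inputState, arr]

open Polynomial in
theorem answerProgram_runs (hq : 0 < q) (hp : 2 * q ≤ p) (h4 : p < 4 * q) (hf : IsColouring G q f)
    (hg : IsColouring G q g) :
    ∃ (s : State) (t : ℕ), Runs (answerProgram p q) (inputState G f g) s t ∧
      t ≤ ((answerStm p q).cost + 4).eval n ∧ s.HoldsAnswer G q f g := by
  obtain ⟨s, t, hr, ht, hv, -⟩ := (answerStm p q).compile_runs (fun _ => 0) 1 n (inputState G f g)
    one_pos (fun _ => one_pos) (by simp [inputState])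
  refine ⟨_, _, .seq hr (.seq (.const _ _ _) (.seq (.const _ _ _) (.seq (.load _ _ _ _)
    (.load _ _ _ _)))), by simp; omega, ?_⟩
  refine answerStm_run (ρ := fun _ => (inputState G f g).reg 0) hq hp h4 hf hg
    (holdsInstance_inputState G f g) ?_ ?_ ?_ <;> rw [← hv] <;>
    simp [State.setReg, State.visible, arr]

end Specs

end CircularColouring

theorem mainTheorem2 (p q : ℕ) (hp : 0 < p) (hq : 0 < q)
    (h2 : (2 : ℚ) ≤ (p : ℚ) / (q : ℚ)) (h4 : (p : ℚ) / (q : ℚ) < 4) :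
    (∀ (V : Type*) [Finite V] (G : SimpleGraph V) (o : CircularColouring.Orientation G)
        (f g : V → Fin p),
        CircularColouring.IsColouring G q f → CircularColouring.IsColouring G q g →
        (CircularColouring.Reconfigures G q f g ↔
          ((∀ v : V, CircularColouring.IsFixed G q f v ↔ CircularColouring.IsFixed G q g v) ∧
              ∀ v : V, CircularColouring.IsFixed G q f v → f v = g v) ∧
          (∀ (u : V) (C : G.Walk u u), C.IsCycle →
            CircularColouring.weight o (CircularColouring.edgeLabelling o f) C =
              CircularColouring.weight o (CircularColouring.edgeLabelling o g) C) ∧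
          (∀ (u v : V) (W : G.Walk u v), W.IsPath →
            CircularColouring.IsFixed G q f u → CircularColouring.IsFixed G q f v →
            CircularColouring.weight o (CircularColouring.edgeLabelling o f) W =
              CircularColouring.weight o (CircularColouring.edgeLabelling o g) W))) ∧
    (∃ (P : CircularColouring.Program) (T : Polynomial ℕ),
      ∀ (n : ℕ) (G : SimpleGraph (Fin n)) (f g : Fin n → Fin p),
        CircularColouring.IsColouring G q f → CircularColouring.IsColouring G q g →
        ∃ (s : CircularColouring.State) (t : ℕ),
          CircularColouring.Runs P (CircularColouring.inputState G f g) s t ∧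
            t ≤ T.eval n ∧ s.HoldsAnswer G q f g) := by
  have hq' : (0 : ℚ) < q := by exact_mod_cast hq
  rw [le_div_iff₀ hq'] at h2
  rw [div_lt_iff₀ hq'] at h4
  have hpq : 2 * q ≤ p := by exact_mod_cast h2
  have hpq' : p < 4 * q := by exact_mod_cast h4
  refine ⟨fun V _ G o f g hf hg => ?_, CircularColouring.answerProgram p q, _,
    fun n G f g hf hg => CircularColouring.answerProgram_runs hq hpq hpq' hf hg⟩
  rw [CircularColouring.reconfigures_iff_invariants hq (by omega) hpq' hf hg]
  simp only [CircularColouring.weight_eq_add_gain hq hf hg o, left_eq_add]
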